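/- **Setting.** A *coloured Muller game* $\mathcal G=(V_0,V_1,E,c,(\mathcal F_0,\mathcal F_1))$ consists of a finite set of positions $V=V_0\sqcup V_1$, a set of edges $E\subseteq (V_0\times V_1)\cup(V_1\times V_0)$ such that every position has an outgoing edge, a colouring $c:V\to C$ into a finite set of colours with $|C|\le |V|$, and winning conditions with $\mathcal F_0\cup\mathcal F_1=2^C$ and $\mathcal F_0\cap\mathcal F_1=\emptyset$. Player $\sigma$ moves at the positions of $V_\sigma$ and wins an infinite play $\rho$ if $c(\mathrm{Inf}(\rho))\in\mathcal F_\sigma$, where $\mathrm{Inf}(\rho)$ is the set of positions that $\rho$ visits infinitely often. $Win_\sigma(\mathcal G)$ is the set of positions from which Player $\sigma$ has a winning strategy. For $V'\subseteq V$, let $\mathcal A(V')$ be the graph $(V,E)$ restricted to $V'$, and let $Attr_\sigma(T,\mathcal A(V'))=\bigcup_i W_i$ with $W_0=T\cap V'$ and $W_{i+1}=W_i\cup\{u\in V'\cap V_\sigma: \exists w\in W_i,\ (u,w)\in E\}\cup\{u\in V'\cap V_{\bar\sigma}:\forall w\in V',\ (u,w)\in E\Rightarrow w\in W_i\}$, where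 $\bar\sigma=1-\sigma$. The recursive procedure $\mathrm{SolveCMG}(V')$ is: let $\sigma$ be such that $c(V')\in\mathcal F_\sigma$. For each $c'\in c(V')$ (in any order): put $S=V'\setminus Attr_\sigma(c^{-1}(c'),\mathcal A(V'))$ and $(W'_0,W'_1)=\mathrm{SolveCMG}(S)$; if $W'_\sigma\neq S$, put $X=Attr_{\bar\sigma}(W'_{\bar\sigma},\mathcal A(V'))$ and $(W''_0,W''_1)=\mathrm{SolveCMG}(V'\setminus X)$, and return $W_\sigma=W''_\sigma$, $W_{\bar\sigma}=V'\setminus W_\sigma$. If the loop ends without returning, return $W_\sigma=V'$, $W_{\bar\sigma}=\emptyset$. **Theorem.** 1. For every coloured Muller game $\mathcal G$, and whatever the order in which colours are treated, $\mathrm{SolveCMG}(V)$ terminates, returns $(Win_0(\mathcal G),Win_1(\mathcal G))$, and during this call $\mathrm{SolveCMG}$ is recursively called at most $|C|!\binom{|V|}{|C|}|V|$ times. 2. There is an algorithm that, given a coloured Muller game $\mathcal G$ with $V\ne\emptyset$, computes $Win_0(\mathcal G)$ and $Win_1(\mathcal G)$ in time $O\big(|C|!\binom{|V|}{|C|}|V||E|\big)$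 and space $O(|\mathcal G|+|C||V|)$. Here an algorithm is a program of a random access machine with unit-cost operations. Its input is a listing of $V$ (with owners and colours), $E$, $\mathcal F_0$ and $\mathcal F_1$, with $V=\{0,\dots,|V|-1\}$ and $C=\{0,\dots,|C|-1\}$, and $|\mathcal G|=|V|+|E|+\sum_{S\in\mathcal F_0}|S|+\sum_{S\in\mathcal F_1}|S|$. Space $s$ means that $O(s)$ memory words are used, each holding a number that is $O(s)$. The implied constants are absolute. -/

import Mathlib

/-! ## Coloured Muller games

Players are elements of `Bool`: `false` is Player 0, `true` is Player 1, and `!σ` is the opponent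
of `σ`. -/

/-- A coloured Muller game with set of positions `V` and set of colours `C`. The positions of
Player `σ` are those `v` with `owner v = σ`. -/
structure CMG (V C : Type*) where
  owner : V → Bool
  edges : Finset (V × V)
  bipartite : ∀ u v, (u, v) ∈ edges → owner u ≠ owner v
  exists_edge : ∀ u, ∃ v, (u, v) ∈ edges
  color : V → C
  /-- `F σ` is the winning condition of Player `σ`. -/
  F : Bool → Finset (Finset C)
  cover : ∀ S, S ∈ F false ∨ S ∈ F true
  disjoint : ∀ S, ¬(S ∈ F false ∧ S ∈ F true)

namespace CMG

section Semantics

variable {V C : Type*} (G : CMG V C)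

/-- `ρ` is a play. -/
def IsPlay (ρ : ℕ → V) : Prop := ∀ i, (ρ i, ρ (i + 1)) ∈ G.edges

/-- The infinity set of a sequence of positions. -/
def infSet (ρ : ℕ → V) : Set V := {v | ∃ᶠ i in Filter.atTop, ρ i = v}

/-- Player `σ` wins the play `ρ`. -/
def WinsPlay (σ : Bool) (ρ : ℕ → V) : Prop :=
  ∃ S ∈ G.F σ, (S : Set C) = G.color '' infSet ρ

/-- `f` is a strategy of Player `σ`: on a finite sequence that ends in a position `v` of
Player `σ` it answers with a successor of `v`. -/
def IsStrategy (σ : Bool) (f : List V → V) : Prop :=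
  ∀ (h : List V) (v : V), G.owner v = σ → (v, f (h ++ [v])) ∈ G.edges

/-- In the sequence `ρ`, Player `σ` always moves as `f` says. -/
def Consistent (σ : Bool) (f : List V → V) (ρ : ℕ → V) : Prop :=
  ∀ i, G.owner (ρ i) = σ → ρ (i + 1) = f ((List.range (i + 1)).map ρ)

/-- `Win_σ(G)`: the positions from which Player `σ` has a winning strategy. -/
def winRegion (σ : Bool) : Set V :=
  {v | ∃ f, G.IsStrategy σ f ∧
    ∀ ρ, G.IsPlay ρ → ρ 0 = v → G.Consistent σ f ρ → G.WinsPlay σ ρ}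

end Semantics

/-! ## The recursive algorithm SolveCMG -/

section Algorithm

variable {V C : Type*} [DecidableEq V] [DecidableEq C] (G : CMG V C)

/-- The sets `W_i` whose union is the attractor of Player `σ` to `T` in the pseudo-arena
determined by `V'`. -/
def attrIter (V' : Finset V) (σ : Bool) (T : Finset V) : ℕ → Finset V
  | 0 => T ∩ V'
  | i + 1 =>
    attrIter V' σ T i
      ∪ {u ∈ V' | G.owner u = σ ∧ ∃ w ∈ attrIter V' σ T i, (u, w) ∈ G.edges}
      ∪ {u ∈ V' | G.owner u = !σ ∧ ∀ w ∈ V', (u, w) ∈ G.edges → w ∈ attrIter V' σ T i}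

open Classical in
/-- `Attr_σ(T, A(V'))`, the attractor of Player `σ` to `T` in the pseudo-arena of `V'`. -/
noncomputable def attr (V' : Finset V) (σ : Bool) (T : Finset V) : Finset V :=
  {v ∈ V' | ∃ i, v ∈ G.attrIter V' σ T i}

/-- The player `σ` with `c(V') ∈ F_σ`. -/
def favoured (V' : Finset V) : Bool :=
  if V'.image G.color ∈ G.F false then false else true

/-- `V' ∖ Attr_σ(c⁻¹(c'), A(V'))`, where `σ` is the player with `c(V') ∈ F_σ`. -/
noncomputable def avoid (V' : Finset V) (c' : C) : Finset V :=
  V' \ G.attr V' (G.favoured V') {v ∈ V' | G.color v = c'}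

/-- `order` tells, for every vertex set, in which order the loop of SolveCMG runs through the
colours that occur in this set. -/
def IsLoopOrder (order : Finset V → List C) : Prop :=
  ∀ V', (order V').Nodup ∧ ∀ c', c' ∈ order V' ↔ c' ∈ V'.image G.color

/-- `G.LoopRun order V' l W N`: in the body of SolveCMG on the vertex set `V'`, the for-loop, when
the colours in the list `l` are still to be treated, ends with the return value `(W_0, W_1)` and
from now on makes `N` recursive calls (all levels of recursion counted). Here `G.favoured V'` is
the player `σ` of the pseudo-code. A call on a set `S` is the loop with `l = order S`. -/
inductive LoopRun (order : Finset V → List C) :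
    Finset V → List C → (Bool → Finset V) → ℕ → Prop
  /-- The loop is over: `W_σ = V'` and the other set is empty. -/
  | done (V' : Finset V) :
      LoopRun order V' [] (fun τ => if τ = G.favoured V' then V' else ∅) 0
  /-- The test `W'_σ ≠ V' ∖ Attr_σ(c⁻¹(c'), A(V'))` fails, and the loop goes on. -/
  | next (V' : Finset V) (c' : C) (l : List C) (W' W : Bool → Finset V) (N' N : ℕ) :
      LoopRun order (G.avoid V' c') (order (G.avoid V' c')) W' N' →
      W' (G.favoured V') = G.avoid V' c' →
      LoopRun order V' l W N →
      LoopRun order V' (c' :: l) W (1 + N' + N)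
  /-- The test succeeds: a second call is made, on `V' ∖ X`, and the function returns. -/
  | found (V' : Finset V) (c' : C) (l : List C) (X : Finset V) (W' W'' : Bool → Finset V)
      (N' N'' : ℕ) :
      LoopRun order (G.avoid V' c') (order (G.avoid V' c')) W' N' →
      W' (G.favoured V') ≠ G.avoid V' c' →
      X = G.attr V' (!G.favoured V') (W' (!G.favoured V')) →
      LoopRun order (V' \ X) (order (V' \ X)) W'' N'' →
      LoopRun order V' (c' :: l)
        (fun τ => if τ = G.favoured V' then W'' (G.favoured V')
          else V' \ W'' (G.favoured V'))
        (1 + N' + (1 + N''))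

/-- The call SolveCMG(`V'`) terminates, returns `(W_0, W_1)`, and makes `N` recursive calls. -/
def SolveRun (order : Finset V → List C) (V' : Finset V) (W : Bool → Finset V) (N : ℕ) : Prop :=
  G.LoopRun order V' (order V') W N

end Algorithm

end CMG

/-! ## Random access machines

A machine has registers and a memory, both holding natural numbers, and runs structured programs
with (recursive) parameterless procedures. It has `B` memory cells, at the addresses `0, …, B - 1`,
every number that occurs in a computation has to be smaller than `B`, and the stack of return
addresses has at most `B` entries. A computation that would violate one of these limits has no
run. -/

namespace RAM

/-- Contents of the registers and of the memory. -/
structure State where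
  reg : ℕ → ℕ
  mem : ℕ → ℕ

/-- Expressions: constants, registers, memory access, sum, truncated difference, and comparisons
with value `0` or `1`. -/
inductive Expr where
  | const (a : ℕ)
  | reg (r : ℕ)
  | mem (e : Expr)
  | add (e₁ e₂ : Expr)
  | sub (e₁ e₂ : Expr)
  | lt (e₁ e₂ : Expr)
  | eq (e₁ e₂ : Expr)

namespace Expr

/-- The value of an expression. -/
def eval (s : State) : Expr → ℕ
  | const a => a
  | reg r => s.reg r
  | mem e => s.mem (e.eval s)
  | add e₁ e₂ => e₁.eval s + e₂.eval s
  | sub e₁ e₂ => e₁.eval s - e₂.eval s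
  | lt e₁ e₂ => if e₁.eval s < e₂.eval s then 1 else 0
  | eq e₁ e₂ => if e₁.eval s = e₂.eval s then 1 else 0

/-- All values that occur in the evaluation, the addresses included, are smaller than `B`. -/
def Fits (B : ℕ) (s : State) : Expr → Prop
  | const a => a < B
  | reg r => s.reg r < B
  | mem e => e.Fits B s ∧ s.mem (e.eval s) < B
  | add e₁ e₂ => e₁.Fits B s ∧ e₂.Fits B s ∧ e₁.eval s + e₂.eval s < B
  | sub e₁ e₂ => e₁.Fits B s ∧ e₂.Fits B s
  | lt e₁ e₂ => e₁.Fits B s ∧ e₂.Fits B s ∧ 1 < B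
  | eq e₁ e₂ => e₁.Fits B s ∧ e₂.Fits B s ∧ 1 < B

/-- The number of operations in an expression, which is the time of its evaluation. -/
def cost : Expr → ℕ
  | const _ => 1
  | reg _ => 1
  | mem e => e.cost + 1
  | add e₁ e₂ => e₁.cost + e₂.cost + 1
  | sub e₁ e₂ => e₁.cost + e₂.cost + 1
  | lt e₁ e₂ => e₁.cost + e₂.cost + 1
  | eq e₁ e₂ => e₁.cost + e₂.cost + 1

end Expr

/-- Commands. In tests, the value `0` means false and every other value means true. -/
inductive Cmd where
  | skip
  | assign (r : ℕ) (e : Expr)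
  | store (a e : Expr)
  | seq (c₁ c₂ : Cmd)
  | cond (e : Expr) (c₁ c₂ : Cmd)
  | loop (e : Expr) (c : Cmd)
  | call (i : ℕ)

/-- `Exec procs B d c s t s'`: with the procedure bodies `procs` and `B` memory cells, the command
`c`, started in `s`, ends in `s'` after `t` steps, with nested procedure calls of depth at most
`d`. -/
inductive Exec (procs : List Cmd) (B : ℕ) : ℕ → Cmd → State → ℕ → State → Prop
  | skip (d : ℕ) (s : State) : Exec procs B d .skip s 1 s
  | assign (d r : ℕ) (e : Expr) (s : State) :
      e.Fits B s →
      Exec procs B d (.assign r e) s (e.cost + 1)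
        { s with reg := Function.update s.reg r (e.eval s) }
  | store (d : ℕ) (a e : Expr) (s : State) :
      a.Fits B s → e.Fits B s →
      Exec procs B d (.store a e) s (a.cost + e.cost + 1)
        { s with mem := Function.update s.mem (a.eval s) (e.eval s) }
  | seq (d : ℕ) (c₁ c₂ : Cmd) (s s' s'' : State) (t t' : ℕ) :
      Exec procs B d c₁ s t s' → Exec procs B d c₂ s' t' s'' →
      Exec procs B d (.seq c₁ c₂) s (t + t') s''
  | cond_true (d : ℕ) (e : Expr) (c₁ c₂ : Cmd) (s s' : State) (t : ℕ) :
      e.Fits B s → e.eval s ≠ 0 → Exec procs B d c₁ s t s' →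
      Exec procs B d (.cond e c₁ c₂) s (e.cost + 1 + t) s'
  | cond_false (d : ℕ) (e : Expr) (c₁ c₂ : Cmd) (s s' : State) (t : ℕ) :
      e.Fits B s → e.eval s = 0 → Exec procs B d c₂ s t s' →
      Exec procs B d (.cond e c₁ c₂) s (e.cost + 1 + t) s'
  | loop_true (d : ℕ) (e : Expr) (c : Cmd) (s s' s'' : State) (t t' : ℕ) :
      e.Fits B s → e.eval s ≠ 0 → Exec procs B d c s t s' →
      Exec procs B d (.loop e c) s' t' s'' →
      Exec procs B d (.loop e c) s (e.cost + 1 + t + t') s''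
  | loop_false (d : ℕ) (e : Expr) (c : Cmd) (s : State) :
      e.Fits B s → e.eval s = 0 →
      Exec procs B d (.loop e c) s (e.cost + 1) s
  | call (d i : ℕ) (body : Cmd) (s s' : State) (t : ℕ) :
      procs[i]? = some body → Exec procs B d body s t s' →
      Exec procs B (d + 1) (.call i) s (t + 1) s'

/-- A program: finitely many procedures and a main command. -/
structure Program where
  procs : List Cmd
  main : Cmd

/-- On the input `l`, which is in the first memory cells at the start (all other cells and all
registers are `0`), the program halts in the state `s` after `t` steps, using `B` memory cells for
numbers smaller than `B` and at most `B` entries of the stack of return addresses. -/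
def Program.Runs (P : Program) (B : ℕ) (l : List ℕ) (t : ℕ) (s : State) : Prop :=
  l.length ≤ B ∧ Exec P.procs B B P.main ⟨fun _ => 0, fun a => l.getD a 0⟩ t s

end RAM

/-! ## Explicit presentations of games as inputs -/

namespace CMG

/-- The size `|G|` of the explicit presentation: the positions, the edges, and the elements of the
members of both winning conditions are listed. -/
def size {V C : Type*} [Fintype V] (G : CMG V C) : ℕ :=
  Fintype.card V + G.edges.card + ∑ σ : Bool, ∑ S ∈ G.F σ, S.card

/-- A listing, without repetitions and in any order, of the edges and of the two winning conditions
of a game with positions `0, …, n - 1` and colours `0, …, k - 1`. -/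
structure Listing {n k : ℕ} (G : CMG (Fin n) (Fin k)) where
  edges : List (Fin n × Fin n)
  edges_nodup : edges.Nodup
  mem_edges : ∀ e, e ∈ edges ↔ e ∈ G.edges
  wins : Bool → List (List (Fin k))
  set_nodup : ∀ σ, ∀ S ∈ wins σ, S.Nodup
  wins_nodup : ∀ σ, ((wins σ).map List.toFinset).Nodup
  mem_wins : ∀ σ S, S ∈ (wins σ).map List.toFinset ↔ S ∈ G.F σ

/-- The input for the machine: the numbers of positions, of colours and of edges; the owners of the
positions; the colours of the positions; the edges; and, for each player, the number of sets in the
winning condition followed by these sets, each with its number of elements in front. -/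
def Listing.encode {n k : ℕ} {G : CMG (Fin n) (Fin k)} (L : G.Listing) : List ℕ :=
  [n, k, L.edges.length]
    ++ List.ofFn (fun v => (G.owner v).toNat)
    ++ List.ofFn (fun v => (G.color v : ℕ))
    ++ L.edges.flatMap (fun e => [(e.1 : ℕ), (e.2 : ℕ)])
    ++ [false, true].flatMap (fun σ =>
        (L.wins σ).length :: (L.wins σ).flatMap (fun S => S.length :: S.map Fin.val))

end CMG

/-! Correctness. Let Player `σ` be favoured in the arena `U`. If `σ` wins everywhere in `avoid U c`
for every occurring colour `c`, then `σ` wins everywhere in `U`: he goes through the colours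
cyclically and attracts the play to the current one. Either every colour is reached again and again,
so that exactly the colours of `U` recur, or some phase never ends, and its strategy already wins
(`force_of_cycle`, `wins_favoured_of_forall_avoid`). Otherwise the opponent wins from a nonempty set
`Y` inside some `avoid U c`. That part is a trap for `σ`, so the opponent wins from `Y` in `U`,
hence from his attractor `X` to `Y`. The winner at a position of `U \ X` is the same in `U` and in
`U \ X`: Player `σ` keeps his strategy because the opponent cannot enter `X`, and the opponent plays
as in `U \ X` until `X` is entered, where he wins anyway. The same case distinction proves
determinacy (`wins_or_wins`), on which the completeness of the returned regions rests.

Number of calls. With `n` positions and `k` colours, each of the at most `k` first calls concerns at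
most `n - 1` positions and `k - 1` colours, and the only second call at most `n - 1` positions and
`k` colours. The bound `n * n.descFactorial k` solves this recurrence because of the identity
`Nat.succ_descFactorial_succ_eq_add`; `callBound` is the version with the slack that the induction
needs.

The machine. A frame has `2 * n + 2` cells: one per position (`1` in the arena, `2 + σ` won by
Player `σ`, other values outside), `n` cells of which the first `k` mark the occurring colours, the
next colour, and the favoured player. The first recursive call uses the next frame. The second one
is the last action of a call, so it is replaced by a restart of the loop in the same frame. Only
first calls are nested, and each of them loses a colour, so about `k` frames suffice. The favoured
player is looked up in a table indexed by masks of colour sets; it has `2 ^ k` entries, which is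
affordable since both winning conditions are listed in the input.

Time. An attractor `A` is computed in at most `A.card + 1` rounds of cost proportional to the number
of edges. The positions of `A` are missing from the arena of the call that follows, and this loss
pays for the rounds (`units_le`). The induction is carried out in `loopWorks`; `main_spec`,
`time_le` and `space_le` assemble the result. -/

namespace CMG

/-! ## Forcing an objective inside a part of the arena -/

section Forcing

variable {V C : Type*} (G : CMG V C)

/-- Every position of `U` has a successor in `U`. -/
def SubArena (U : Finset V) : Prop := ∀ u ∈ U, ∃ w ∈ U, (u, w) ∈ G.edges

/-- `f` is a strategy of Player `σ` that stays inside `U`. -/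
def Valid (U : Finset V) (σ : Bool) (f : List V → V) : Prop :=
  ∀ (h : List V) (v : V), v ∈ U → G.owner v = σ →
    (v, f (h ++ [v])) ∈ G.edges ∧ f (h ++ [v]) ∈ U

/-- `ρ` is a play inside `U`. -/
def PlayIn (U : Finset V) (ρ : ℕ → V) : Prop := G.IsPlay ρ ∧ ∀ i, ρ i ∈ U

/-- In the game restricted to `U`, Player `σ` can force the objective `O` from `v`. -/
def Force (U : Finset V) (σ : Bool) (O : (ℕ → V) → Prop) (v : V) : Prop :=
  ∃ f, G.Valid U σ f ∧
    ∀ ρ, G.PlayIn U ρ → ρ 0 = v → G.Consistent σ f ρ → O ρ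

/-- An objective that holds for a sequence as soon as it holds for its tail. -/
def TailClosed (O : (ℕ → V) → Prop) : Prop := ∀ ρ, O (fun i => ρ (i + 1)) → O ρ

theorem TailClosed.of_shift {O : (ℕ → V) → Prop} (hO : TailClosed O) (j : ℕ) :
    ∀ ρ : ℕ → V, O (fun i => ρ (j + i)) → O ρ := by
  induction j with
  | zero => intro ρ h; simpa using h
  | succ j ih =>
    intro ρ h
    apply hO
    apply ih
    have : (fun i => ρ (j + 1 + i)) = fun i => ρ (j + i + 1) := by
      funext i; congr 1; omega
    rwa [this] at h

theorem PlayIn.shift {G : CMG V C} {U : Finset V} {ρ : ℕ → V} (h : G.PlayIn U ρ) (j : ℕ) :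
    G.PlayIn U (fun i => ρ (j + i)) :=
  ⟨fun i => h.1 (j + i), fun i => h.2 (j + i)⟩

theorem map_range_succ (ρ : ℕ → V) (i : ℕ) :
    (List.range (i + 1)).map ρ = (List.range i).map ρ ++ [ρ i] := by
  simp [List.range_succ]

theorem map_range_add (ρ : ℕ → V) (j i : ℕ) :
    (List.range (j + i)).map ρ
      = (List.range j).map ρ ++ (List.range i).map (fun a => ρ (j + a)) := by
  simp [List.range_add, Function.comp_def]

theorem infSet_shift (ρ : ℕ → V) (j : ℕ) : infSet (fun i => ρ (j + i)) = infSet ρ := by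
  ext v
  simp only [infSet, Set.mem_ofPred_eq, Filter.frequently_atTop]
  constructor
  · intro h a
    obtain ⟨b, hb, e⟩ := h a
    exact ⟨j + b, by omega, e⟩
  · intro h a
    obtain ⟨b, hb, e⟩ := h (j + a)
    exact ⟨b - j, by omega, by rwa [Nat.add_sub_cancel' (by omega)]⟩

theorem winsPlay_shift (σ : Bool) (ρ : ℕ → V) (j : ℕ) :
    G.WinsPlay σ (fun i => ρ (j + i)) ↔ G.WinsPlay σ ρ := by
  simp [WinsPlay, infSet_shift]

theorem tailClosed_winsPlay (σ : Bool) : TailClosed (G.WinsPlay σ) := by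
  intro ρ h
  rw [← G.winsPlay_shift σ ρ 1]
  simpa [add_comm] using h

theorem tailClosed_or {O O' : (ℕ → V) → Prop} (h : TailClosed O) (h' : TailClosed O') :
    TailClosed (fun ρ => O ρ ∨ O' ρ) :=
  fun ρ hρ => hρ.imp (h ρ) (h' ρ)

theorem tailClosed_exists (p : V → Prop) : TailClosed (fun ρ : ℕ → V => ∃ i, p (ρ i)) :=
  fun _ ⟨i, hi⟩ => ⟨i + 1, hi⟩

variable {G}

theorem SubArena.exists_move [Nonempty V] {U : Finset V} (hU : G.SubArena U) :
    ∃ g : V → V, ∀ v ∈ U, (v, g v) ∈ G.edges ∧ g v ∈ U := by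
  classical
  choose! g hg using hU
  exact ⟨g, fun v hv => ⟨(hg v hv).2, (hg v hv).1⟩⟩

theorem Force.mono {U : Finset V} {σ : Bool} {O O' : (ℕ → V) → Prop} {v : V}
    (h : G.Force U σ O v) (hO : ∀ ρ, O ρ → O' ρ) : G.Force U σ O' v := by
  obtain ⟨f, hf, h⟩ := h
  exact ⟨f, hf, fun ρ h1 h2 h3 => hO _ (h ρ h1 h2 h3)⟩

/-- One strategy that works from all positions of a set. -/
theorem exists_uniform {U : Finset V} (hU : G.SubArena U) [Nonempty V] {σ : Bool}
    {O : (ℕ → V) → Prop} {Z : Set V} (hZ : ∀ v ∈ Z, G.Force U σ O v) :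
    ∃ f, G.Valid U σ f ∧
      ∀ ρ, G.PlayIn U ρ → ρ 0 ∈ Z → G.Consistent σ f ρ → O ρ := by
  classical
  obtain ⟨g, hg⟩ := hU.exists_move
  obtain ⟨v₀⟩ := ‹Nonempty V›
  choose! F hF using hZ
  -- A history never loses its first position, which can therefore select the strategy once and for
  -- all.
  refine ⟨fun h => if h.headD v₀ ∈ Z then F (h.headD v₀) h else g (h.getLastD v₀), ?_, ?_⟩
  · intro h v hv ho
    dsimp only
    split_ifs with hz
    · exact (hF _ hz).1 h v hv ho
    · simpa using hg v hv
  · intro ρ hρ h0 hc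
    refine (hF _ h0).2 ρ hρ rfl fun i hi => ?_
    have := hc i hi
    simpa [List.range_succ_eq_map, h0] using this

/-- The first move leads into `Z`. From then on the strategy that is uniform on `Z` is applied to
the history without its first position, and `TailClosed` puts this position back in front of the
play. -/
theorem Force.of_edge {U : Finset V} (hU : G.SubArena U) {σ : Bool}
    {O : (ℕ → V) → Prop} (hO : TailClosed O) {Z : Set V} (hZ : ∀ v ∈ Z, G.Force U σ O v) {v : V}
    (hv : G.owner v = σ → ∃ w ∈ U, w ∈ Z ∧ (v, w) ∈ G.edges)
    (hv' : G.owner v ≠ σ → ∀ w ∈ U, (v, w) ∈ G.edges → w ∈ Z) : G.Force U σ O v := by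
  classical
  have : Nonempty V := ⟨v⟩
  obtain ⟨f, hf, hfw⟩ := exists_uniform hU hZ
  obtain ⟨g, hg, hgv⟩ : ∃ g : V → V, (∀ v ∈ U, (v, g v) ∈ G.edges ∧ g v ∈ U) ∧
      (G.owner v = σ → g v ∈ Z) := by
    obtain ⟨g, hg⟩ := hU.exists_move
    by_cases ho : G.owner v = σ
    · obtain ⟨w, hwU, hwZ, hw⟩ := hv ho
      refine ⟨Function.update g v w, fun x hx => ?_, fun _ => by simpa using hwZ⟩
      by_cases hxv : x = v
      · subst hxv; simpa using ⟨hw, hwU⟩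
      · simpa [Function.update_of_ne hxv] using hg x hx
    · exact ⟨g, hg, fun h => absurd h ho⟩
  refine ⟨fun h => if h.length ≤ 1 then g (h.getLastD v) else f h.tail, ?_, ?_⟩
  · intro h x hx ho
    cases h with
    | nil => simpa using hg x hx
    | cons a t => simpa using hf t x hx ho
  · intro ρ hρ h0 hc
    apply hO
    have hs : ρ 1 ∈ Z := by
      by_cases ho : G.owner v = σ
      · have := hc 0 (by rw [h0, ho])
        simp [h0] at this
        rw [this]; exact hgv ho
      · exact hv' ho _ (hρ.2 1) (by have := hρ.1 0; rwa [h0] at this)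
    have hsh := hρ.shift 1
    simp only [add_comm 1] at hsh
    refine hfw _ hsh hs fun i hi => ?_
    have := hc (i + 1) hi
    dsimp only at this ⊢
    rw [this, List.range_succ_eq_map (n := i + 1)]
    simp [Function.comp_def]

/-- A strategy inside a part that the opponent cannot leave. -/
theorem Force.of_trap {S U : Finset V} (hSU : S ⊆ U) (hU : G.SubArena U) {σ : Bool}
    (hS : ∀ u ∈ S, G.owner u ≠ σ → ∀ w ∈ U, (u, w) ∈ G.edges → w ∈ S)
    {O : (ℕ → V) → Prop} {v : V} (hvS : v ∈ S) (h : G.Force S σ O v) : G.Force U σ O v := by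
  classical
  have : Nonempty V := ⟨v⟩
  obtain ⟨g, hg⟩ := hU.exists_move
  obtain ⟨f, hf, hfw⟩ := h
  -- The moves of `g` only make the strategy valid on all of `U`: a consistent play from `v` never
  -- leaves `S`.
  refine ⟨fun h => if h.getLastD v ∈ S then f h else g (h.getLastD v), ?_, ?_⟩
  · intro h x hx ho
    by_cases hxS : x ∈ S
    · have := hf h x hxS ho
      simpa [hxS] using ⟨this.1, hSU this.2⟩
    · simpa [hxS] using hg x hx
  · intro ρ hρ h0 hc
    have key : ∀ i, ρ i ∈ S →
        (G.owner (ρ i) = σ → ρ (i + 1) = f ((List.range (i + 1)).map ρ)) ∧ ρ (i + 1) ∈ S := by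
      intro i hi
      have h1 : G.owner (ρ i) = σ → ρ (i + 1) = f ((List.range (i + 1)).map ρ) := by
        intro ho
        have := hc i ho
        simpa [map_range_succ, hi] using this
      refine ⟨h1, ?_⟩
      by_cases ho : G.owner (ρ i) = σ
      · rw [h1 ho, map_range_succ]
        exact (hf _ _ hi ho).2
      · exact hS _ hi ho _ (hρ.2 _) (hρ.1 i)
    have hin : ∀ i, ρ i ∈ S := by
      intro i
      induction i with
      | zero => rw [h0]; exact hvS
      | succ i ih => exact (key i ih).2
    exact hfw ρ ⟨hρ.1, hin⟩ h0 fun i hi => (key i (hin i)).1 hi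

/-- Play in `U ∖ X` until `X` is entered, and then play from there. -/
theorem Force.of_switch [DecidableEq V] {X U : Finset V} (hU : G.SubArena U) {σ : Bool}
    {O : (ℕ → V) → Prop} (hO : TailClosed O) (hX : ∀ v ∈ X, G.Force U σ O v) {v : V}
    (h : G.Force (U \ X) σ O v) : G.Force U σ O v := by
  classical
  have : Nonempty V := ⟨v⟩
  obtain ⟨f, hf, hfw⟩ := h
  obtain ⟨e, he, hew⟩ := exists_uniform (Z := (X : Set V)) hU (by simpa using hX)
  -- `dropWhile` leaves the history since the first visit to `X`, which is the history that `e`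
  -- expects.
  refine ⟨fun h => if ∀ x ∈ h, x ∉ X then f h else e (h.dropWhile (fun x => x ∉ X)), ?_, ?_⟩
  · intro h x hx ho
    dsimp only
    split_ifs with hh
    · have := hf h x (by simp [hx, hh x]) ho
      exact ⟨this.1, (Finset.mem_sdiff.1 this.2).1⟩
    · obtain ⟨h', hh'⟩ : ∃ h', (h ++ [x]).dropWhile (fun x => x ∉ X) = h' ++ [x] := by
        rw [List.dropWhile_append]
        split_ifs with hn
        · refine ⟨[], ?_⟩
          have hall : ∀ y ∈ h, y ∉ X := by simpa [List.dropWhile_eq_nil_iff] using hn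
          have : x ∈ X := by
            by_contra hxX
            apply hh
            intro y hy
            rcases List.mem_append.1 hy with hy | hy
            · exact hall y hy
            · rw [List.mem_singleton.1 hy]; exact hxX
          simp [this]
        · exact ⟨_, rfl⟩
      rw [hh']
      exact he h' x hx ho
  · intro ρ hρ h0 hc
    by_cases hin : ∃ j, ρ j ∈ X
    · have hj := Nat.find_spec hin
      have hlt : ∀ i < Nat.find hin, ρ i ∉ X := fun i hi => Nat.find_min hin hi
      set j := Nat.find hin
      apply hO.of_shift j
      refine hew _ (hρ.shift j) hj fun i hi => ?_
      have := hc (j + i) hi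
      dsimp only at this ⊢
      rw [← add_assoc, this, if_neg, add_assoc, map_range_add, List.dropWhile_append_of_pos,
        List.range_succ_eq_map]
      · simp [hj]
      · simpa using hlt
      · intro hh
        exact hh (ρ j) (List.mem_map.2 ⟨j, by simp, rfl⟩) hj
    · push Not at hin
      refine hfw ρ ⟨hρ.1, fun i => by simp [hρ.2 i, hin i]⟩ h0 fun i hi => ?_
      rw [hc i hi]
      dsimp only
      rw [if_pos]
      intro x hx
      obtain ⟨a, -, rfl⟩ := List.mem_map.1 hx
      exact hin a

end Forcing
end CMG

/-! ### Winning by visiting all colours in turn -/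

namespace CMG

section Cycle

variable {V C : Type*} {G : CMG V C}

/-- Finiteness of `V` is essential: if each position of colour `c` were visited only finitely often,
then from some time on the colour `c` would not occur at all. -/
theorem frequently_color_of_playIn [Finite V] {U : Finset V} {ρ : ℕ → V} (hρ : G.PlayIn U ρ)
    [DecidableEq C] (h : ∀ c ∈ U.image G.color, ∃ᶠ i in Filter.atTop, G.color (ρ i) = c) :
    ((U.image G.color : Finset C) : Set C) = G.color '' infSet ρ := by
  ext c
  constructor
  · intro hc
    have h1 := h c (by simpa using hc)
    by_contra hne
    have h2 : ∀ v : V, G.color v = c → ∀ᶠ i in Filter.atTop, ρ i ≠ v := by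
      intro v hv
      by_contra hf
      exact hne ⟨v, by simpa [infSet, Filter.Frequently] using hf, hv⟩
    have h3 : ∀ᶠ i in Filter.atTop, ∀ v : V, G.color v = c → ρ i ≠ v := by
      rw [Filter.eventually_all]
      intro v
      by_cases hv : G.color v = c
      · simpa [hv] using h2 v hv
      · simp [hv]
    obtain ⟨i, hi, hi'⟩ := (h1.and_eventually h3).exists
    exact hi' _ hi rfl
  · rintro ⟨v, hv, rfl⟩
    obtain ⟨i, rfl⟩ := Filter.Frequently.exists hv
    simpa using ⟨_, hρ.2 i, rfl⟩

open Classical in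
/-- Update of the memory of the strategy that cycles through the colours `cs 0, cs 1, …`: the
current index and the history since it became current. -/
noncomputable def cycleUpd (G : CMG V C) (cs : ℕ → C) (s : ℕ × List V) (v : V) : ℕ × List V :=
  if ∃ x ∈ s.2, G.color x = cs s.1 then (s.1 + 1, [v]) else (s.1, s.2 ++ [v])

/-- In each phase the strategy for the current colour is played, with the history restarted at the
beginning of the phase; a phase ends when its colour has been seen. If infinitely many phases end,
all colours of `U` recur. If not, the strategy of the last phase is followed for ever, and as its
colour is never seen, its other alternative, a win, must hold. -/
theorem force_of_cycle [Finite V] [DecidableEq C] {U : Finset V} (hU : G.SubArena U) {σ : Bool}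
    (hσ : U.image G.color ∈ G.F σ)
    (h : ∀ c ∈ U.image G.color, ∀ v ∈ U,
      G.Force U σ (fun ρ => (∃ i, G.color (ρ i) = c) ∨ G.WinsPlay σ ρ) v)
    {v : V} (hv : v ∈ U) : G.Force U σ (G.WinsPlay σ) v := by
  classical
  have : Nonempty V := ⟨v⟩
  have hcv : G.color v ∈ U.image G.color := Finset.mem_image_of_mem _ hv
  have hF : ∀ c : C, ∃ f, G.Valid U σ f ∧ (c ∈ U.image G.color → ∀ ρ, G.PlayIn U ρ →
      G.Consistent σ f ρ → (∃ i, G.color (ρ i) = c) ∨ G.WinsPlay σ ρ) := by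
    intro c
    by_cases hc : c ∈ U.image G.color
    · obtain ⟨f, hf, hw⟩ := exists_uniform (Z := (U : Set V)) hU (h c hc)
      exact ⟨f, hf, fun _ ρ hρ => hw ρ hρ (hρ.2 0)⟩
    · obtain ⟨f, hf, -⟩ := exists_uniform (Z := (U : Set V)) hU (h _ hcv)
      exact ⟨f, hf, fun hc' => absurd hc' hc⟩
  choose F hFv hFw using hF
  obtain ⟨g, hg⟩ : ∃ g : ℕ → U.image G.color, Function.Surjective g := by
    have : Nonempty (U.image G.color) := ⟨⟨_, hcv⟩⟩
    exact exists_surjective_nat _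
  -- The first component of the pairing takes every value at arbitrarily large indices, so every
  -- colour becomes current infinitely often.
  let cs : ℕ → C := fun j => g (Nat.unpair j).1
  have hcs : ∀ j, cs j ∈ U.image G.color := fun j => (g _).2
  have hcs' : ∀ c ∈ U.image G.color, ∀ N, ∃ j, N ≤ j ∧ cs j = c := by
    intro c hc N
    obtain ⟨a, ha⟩ := hg ⟨c, hc⟩
    exact ⟨Nat.pair a N, Nat.right_le_pair a N, by simp [cs, ha]⟩
  let upd := G.cycleUpd cs
  refine ⟨fun l => F (cs (l.foldl upd (0, [])).1) (l.foldl upd (0, [])).2, ?_, ?_⟩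
  · intro l x hx ho
    simp only [List.foldl_append, List.foldl_cons, List.foldl_nil]
    generalize l.foldl upd (0, []) = s
    simp only [upd, cycleUpd]
    split_ifs
    · simpa using hFv _ [] x hx ho
    · exact hFv _ _ x hx ho
  · intro ρ hρ h0 hc
    let S : ℕ → ℕ × List V := fun i => ((List.range (i + 1)).map ρ).foldl upd (0, [])
    have hS0 : S 0 = (0, [ρ 0]) := by simp [S, upd, cycleUpd]
    have hSs : ∀ i, S (i + 1) = upd (S i) (ρ (i + 1)) := by
      intro i
      simp only [S]
      rw [map_range_succ ρ (i + 1), List.foldl_append]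
      rfl
    have hcS : ∀ i, G.owner (ρ i) = σ → ρ (i + 1) = F (cs (S i).1) (S i).2 :=
      fun i hi => hc i hi
    let Hit : ℕ → Prop := fun i => ∃ x ∈ (S i).2, G.color x = cs (S i).1
    have hhit : ∀ i, Hit i → S (i + 1) = ((S i).1 + 1, [ρ (i + 1)]) := by
      intro i hi
      rw [hSs]
      exact if_pos hi
    have hnhit : ∀ i, ¬ Hit i → S (i + 1) = ((S i).1, (S i).2 ++ [ρ (i + 1)]) := by
      intro i hi
      rw [hSs]
      exact if_neg hi
    -- Here `t` is the time at which the phase that is current at time `i` began. The inequality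
    -- between the index and `t` holds because every phase lasts at least one step; it turns a large
    -- index into a late visit.
    have hinv : ∀ i, ∃ t, (S i).1 ≤ t ∧ t ≤ i ∧ ∀ a, t + a ≤ i →
        S (t + a) = ((S i).1, (List.range (a + 1)).map (fun b => ρ (t + b))) := by
      intro i
      induction i with
      | zero =>
        refine ⟨0, by simp [hS0], le_rfl, fun a ha => ?_⟩
        obtain rfl : a = 0 := by omega
        simp [hS0]
      | succ i ih =>
        obtain ⟨t, ht, hti, h⟩ := ih
        by_cases hi : Hit i
        · refine ⟨i + 1, by simp [hhit i hi]; omega, le_rfl, fun a ha => ?_⟩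
          obtain rfl : a = 0 := by omega
          simp [hhit i hi]
        · refine ⟨t, by simpa [hnhit i hi] using ht, by omega, fun a ha => ?_⟩
          have hS1 : (S (i + 1)).1 = (S i).1 := by simp [hnhit i hi]
          rcases Nat.lt_or_ge (t + a) (i + 1) with hlt | hge
          · rw [hS1]; exact h a (by omega)
          · obtain ⟨b, rfl⟩ : ∃ b, a = b + 1 := ⟨a - 1, by omega⟩
            obtain rfl : i = t + b := by omega
            have := h b le_rfl
            rw [hS1, map_range_succ, ← add_assoc, hnhit _ hi, this]
    by_cases hall : ∀ i, ∃ i', i ≤ i' ∧ Hit i'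
    · have hreach : ∀ j, ∃ i, (S i).1 = j ∧ Hit i := by
        have hfrom : ∀ i, ∃ i', (S i').1 = (S i).1 ∧ Hit i' := by
          intro i
          have hex := hall i
          obtain ⟨h1, h2⟩ := Nat.find_spec hex
          refine ⟨Nat.find hex, ?_, h2⟩
          have hmin : ∀ b, i ≤ b → b ≤ Nat.find hex → (S b).1 = (S i).1 := by
            intro b hb
            induction b, hb using Nat.le_induction with
            | base => intro _; rfl
            | succ b hb ih =>
              intro hb'
              have : ¬ Hit b := fun hh => Nat.find_min hex (m := b) (by omega) ⟨hb, hh⟩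
              rw [hnhit b this]
              exact ih (by omega)
          exact hmin _ h1 le_rfl
        intro j
        induction j with
        | zero =>
          obtain ⟨i', h1, h2⟩ := hfrom 0
          exact ⟨i', by simpa [hS0] using h1, h2⟩
        | succ j ih =>
          obtain ⟨i, h1, h2⟩ := ih
          obtain ⟨i', h3, h4⟩ := hfrom (i + 1)
          exact ⟨i', by rw [h3, hhit i h2, h1], h4⟩
      refine ⟨_, hσ, frequently_color_of_playIn hρ fun c hcU => ?_⟩
      rw [Filter.frequently_atTop]
      intro N
      obtain ⟨j, hj, rfl⟩ := hcs' c hcU N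
      obtain ⟨i, rfl, x, hx, hxc⟩ := hreach j
      obtain ⟨t, ht, hti, h⟩ := hinv i
      have := h (i - t) (by omega)
      rw [Nat.add_sub_cancel' hti] at this
      rw [this] at hx
      obtain ⟨b, -, rfl⟩ := List.mem_map.1 hx
      exact ⟨t + b, by omega, hxc⟩
    · push Not at hall
      obtain ⟨i, hi⟩ := hall
      obtain ⟨t, ht, hti, h⟩ := hinv i
      have hstay : ∀ a, S (t + a) = ((S i).1, (List.range (a + 1)).map (fun b => ρ (t + b))) := by
        intro a
        induction a with
        | zero => exact h 0 (by omega)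
        | succ a ih =>
          rcases Nat.lt_or_ge i (t + (a + 1)) with hlt | hge
          · rw [← add_assoc, hnhit _ (hi (t + a) (by omega)), ih, map_range_succ _ (a + 1)]
            simp [add_assoc]
          · exact h _ hge
      rcases hFw (cs (S i).1) (hcs _) _ (hρ.shift t) (fun a ha => by
        have := hcS (t + a) ha
        rw [hstay a] at this
        exact this) with ⟨a, ha⟩ | hw
      · exfalso
        -- The visit at time `t + a` may precede `i`; at the later time `t + (a + i)` it is still in
        -- the history, and there a hit is excluded.
        refine hi (t + (a + i)) (by omega) ⟨ρ (t + a), ?_, ?_⟩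
        · rw [hstay]
          exact List.mem_map.2 ⟨a, by simp, rfl⟩
        · rw [hstay]; exact ha
      · exact (G.winsPlay_shift σ ρ t).1 hw

end Cycle

end CMG

/-! ### Attractors, and the traps that they leave -/

namespace CMG

section Attractor

variable {V C : Type*} [DecidableEq V] {G : CMG V C} {U T : Finset V} {σ : Bool}

/-- One round of the computation of an attractor. -/
def attrStep (G : CMG V C) (U : Finset V) (σ : Bool) (W : Finset V) : Finset V :=
  W ∪ {u ∈ U | G.owner u = σ ∧ ∃ w ∈ W, (u, w) ∈ G.edges}
    ∪ {u ∈ U | G.owner u = !σ ∧ ∀ w ∈ U, (u, w) ∈ G.edges → w ∈ W}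

theorem attrIter_succ (i : ℕ) :
    G.attrIter U σ T (i + 1) = G.attrStep U σ (G.attrIter U σ T i) := rfl

theorem subset_attrStep (W : Finset V) : W ⊆ G.attrStep U σ W := by
  intro v hv; simp [attrStep, hv]

theorem attrStep_subset {W : Finset V} (h : W ⊆ U) : G.attrStep U σ W ⊆ U := by
  intro v hv
  simp only [attrStep, Finset.mem_union, Finset.mem_filter] at hv
  rcases hv with (hv | hv) | hv
  · exact h hv
  · exact hv.1
  · exact hv.1

theorem attrIter_subset (i : ℕ) : G.attrIter U σ T i ⊆ U := by
  induction i with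
  | zero => exact Finset.inter_subset_right
  | succ i ih => exact attrStep_subset ih

theorem attrIter_mono {i j : ℕ} (h : i ≤ j) : G.attrIter U σ T i ⊆ G.attrIter U σ T j := by
  induction j, h using Nat.le_induction with
  | base => exact subset_rfl
  | succ j _ ih => exact ih.trans (subset_attrStep _)

theorem mem_attr {v : V} : v ∈ G.attr U σ T ↔ ∃ i, v ∈ G.attrIter U σ T i := by
  simp only [attr, Finset.mem_filter]
  exact ⟨fun h => h.2, fun ⟨i, hi⟩ => ⟨attrIter_subset i hi, i, hi⟩⟩

theorem attr_subset : G.attr U σ T ⊆ U := by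
  intro v hv
  obtain ⟨i, hi⟩ := mem_attr.1 hv
  exact attrIter_subset i hi

theorem attrIter_subset_attr (i : ℕ) : G.attrIter U σ T i ⊆ G.attr U σ T :=
  fun _ hv => mem_attr.2 ⟨i, hv⟩

theorem subset_attr (h : T ⊆ U) : T ⊆ G.attr U σ T := by
  intro v hv
  exact mem_attr.2 ⟨0, by simp [attrIter, hv, h hv]⟩

/-- The attractor is a finite union of an increasing sequence, so one stage contains all of it. -/
theorem exists_attr_eq : ∃ i, G.attr U σ T = G.attrIter U σ T i := by
  have : ∀ A : Finset V, A ⊆ G.attr U σ T → ∃ i, A ⊆ G.attrIter U σ T i := by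
    intro A
    induction A using Finset.induction_on with
    | empty => intro _; exact ⟨0, by simp⟩
    | insert a A ha ih =>
      intro h
      obtain ⟨i, hi⟩ := ih ((Finset.subset_insert _ _).trans h)
      obtain ⟨j, hj⟩ := mem_attr.1 (h (Finset.mem_insert_self _ _))
      refine ⟨max i j, Finset.insert_subset (attrIter_mono (le_max_right _ _) hj)
        (hi.trans (attrIter_mono (le_max_left _ _)))⟩
  obtain ⟨i, hi⟩ := this _ subset_rfl
  exact ⟨i, hi.antisymm (attrIter_subset_attr i)⟩

theorem attrStep_attr : G.attrStep U σ (G.attr U σ T) = G.attr U σ T := by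
  obtain ⟨i, hi⟩ := exists_attr_eq (G := G) (U := U) (σ := σ) (T := T)
  refine (subset_attrStep _).antisymm' ?_
  rw [hi, ← attrIter_succ, ← hi]
  exact attrIter_subset_attr _

/-- This justifies the stopping criterion of the machine: a round without any change means that the
attractor is complete. -/
theorem attr_eq_of_attrStep_eq {i : ℕ}
    (h : G.attrStep U σ (G.attrIter U σ T i) = G.attrIter U σ T i) :
    G.attr U σ T = G.attrIter U σ T i := by
  have hj : ∀ j, G.attrIter U σ T (i + j) = G.attrIter U σ T i := by
    intro j
    induction j with
    | zero => rfl
    | succ j ih => rw [← add_assoc, attrIter_succ, ih, h]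
  refine (attrIter_subset_attr i).antisymm' ?_
  intro v hv
  obtain ⟨j, hv⟩ := mem_attr.1 hv
  rw [← hj j]
  exact attrIter_mono (by omega) hv

theorem mem_attr_of_edge {u w : V} (hu : u ∈ U) (ho : G.owner u = σ) (hw : w ∈ G.attr U σ T)
    (he : (u, w) ∈ G.edges) : u ∈ G.attr U σ T := by
  rw [← attrStep_attr]
  simp only [attrStep, Finset.mem_union, Finset.mem_filter]
  exact Or.inl (Or.inr ⟨hu, ho, w, hw, he⟩)

theorem mem_attr_of_forall {u : V} (hu : u ∈ U) (ho : G.owner u ≠ σ)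
    (h : ∀ w ∈ U, (u, w) ∈ G.edges → w ∈ G.attr U σ T) : u ∈ G.attr U σ T := by
  rw [← attrStep_attr]
  simp only [attrStep, Finset.mem_union, Finset.mem_filter]
  exact Or.inr ⟨hu, Bool.eq_not_of_ne ho, h⟩

/-- A position outside of the attractor has no edge into it if it belongs to `σ`, and has an edge
that avoids it otherwise; in both cases a successor remains. -/
theorem SubArena.sdiff_attr : G.SubArena U → G.SubArena (U \ G.attr U σ T) := by
  intro h u hu
  rw [Finset.mem_sdiff] at hu
  by_cases ho : G.owner u = σ
  · obtain ⟨w, hw, he⟩ := h u hu.1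
    exact ⟨w, Finset.mem_sdiff.2 ⟨hw, fun hwa => hu.2 (mem_attr_of_edge hu.1 ho hwa he)⟩, he⟩
  · by_contra hne
    push Not at hne
    refine hu.2 (mem_attr_of_forall hu.1 ho fun w hw he => ?_)
    by_contra hwa
    exact hne w (Finset.mem_sdiff.2 ⟨hw, hwa⟩) he

theorem Force.of_mem_attr (hU : G.SubArena U) {O : (ℕ → V) → Prop} (hO : TailClosed O)
    (hT : ∀ v ∈ T, G.Force U σ O v) {v : V} (hv : v ∈ G.attr U σ T) : G.Force U σ O v := by
  obtain ⟨i, hi⟩ := mem_attr.1 hv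
  clear hv
  induction i generalizing v with
  | zero => exact hT v (Finset.mem_inter.1 hi).1
  | succ i ih =>
    rw [attrIter_succ] at hi
    simp only [attrStep, Finset.mem_union, Finset.mem_filter] at hi
    rcases hi with (hi | ⟨-, ho, w, hw, he⟩) | ⟨-, ho, hw⟩
    · exact ih hi
    · exact Force.of_edge (Z := {w | w ∈ G.attrIter U σ T i}) hU hO (fun _ h => ih h)
        (fun _ => ⟨w, attrIter_subset i hw, hw, he⟩) (fun h => absurd ho h)
    · exact Force.of_edge (Z := {w | w ∈ G.attrIter U σ T i}) hU hO (fun _ h => ih h)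
        (fun h => by simp [h] at ho) (fun _ => hw)

/-- Player `σ` cannot move from the complement of his own attractor into it, so this complement is a
trap for him. -/
theorem Force.of_sdiff_attr (hU : G.SubArena U) {O : (ℕ → V) → Prop}
    {v : V} (hv : v ∈ U \ G.attr U σ T)
    (h : G.Force (U \ G.attr U σ T) (!σ) O v) : G.Force U (!σ) O v := by
  refine Force.of_trap Finset.sdiff_subset hU (fun u hu ho w hw he => ?_) hv h
  rw [Finset.mem_sdiff] at hu ⊢
  refine ⟨hw, fun hwa => hu.2 (mem_attr_of_edge hu.1 ?_ hwa he)⟩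
  cases h : G.owner u <;> cases σ <;> simp_all

end Attractor

/-! ### Winning regions of subarenas, and determinacy -/

section Winning

variable {V C : Type*} (G : CMG V C)

/-- In the game restricted to `U`, Player `σ` wins from `v`. -/
def Wins (U : Finset V) (σ : Bool) (v : V) : Prop := G.Force U σ (G.WinsPlay σ) v

variable {G}

theorem wins_univ [Fintype V] (σ : Bool) (v : V) :
    G.Wins Finset.univ σ v ↔ v ∈ G.winRegion σ := by
  simp [Wins, Force, winRegion, Valid, IsStrategy, PlayIn]

theorem subArena_univ [Fintype V] : G.SubArena Finset.univ := by
  intro u _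
  obtain ⟨v, hv⟩ := G.exists_edge u
  exact ⟨v, Finset.mem_univ _, hv⟩

theorem WinsPlay.not {σ : Bool} {ρ : ℕ → V} (h : G.WinsPlay σ ρ) : ¬ G.WinsPlay (!σ) ρ := by
  rintro ⟨S, hS, e⟩
  obtain ⟨S', hS', e'⟩ := h
  obtain rfl : S = S' := Finset.coe_injective (e.trans e'.symm)
  cases σ
  · exact G.disjoint S ⟨hS', hS⟩
  · exact G.disjoint S ⟨hS, hS'⟩

/-- Two winning strategies played against each other would produce a play won by both players, while
the winning conditions are disjoint. -/
theorem Wins.not {U : Finset V} {σ : Bool} {v : V} (hv : v ∈ U) (h : G.Wins U σ v) :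
    ¬ G.Wins U (!σ) v := by
  rintro ⟨f', hf', hw'⟩
  obtain ⟨f, hf, hw⟩ := h
  let nxt : List V → V := fun l => if G.owner (l.getLastD v) = σ then f l else f' l
  let H : ℕ → List V := fun i => Nat.rec [v] (fun _ l => l ++ [nxt l]) i
  have hHs : ∀ i, H (i + 1) = H i ++ [nxt (H i)] := fun i => rfl
  let ρ : ℕ → V := fun i => (H i).getLastD v
  have h0 : ρ 0 = v := rfl
  have hs : ∀ i, ρ (i + 1) = nxt (H i) := by intro i; simp [ρ, hHs]
  have hH : ∀ i, H i = (List.range (i + 1)).map ρ := by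
    intro i
    induction i with
    | zero => simp [h0]; rfl
    | succ i ih => rw [map_range_succ, ← ih, hHs, hs]
  have hs' : ∀ i, ρ (i + 1) = if G.owner (ρ i) = σ then f ((List.range (i + 1)).map ρ)
      else f' ((List.range (i + 1)).map ρ) := by
    intro i; rw [hs, ← hH]
  have key : ∀ i, ρ i ∈ U → (ρ i, ρ (i + 1)) ∈ G.edges ∧ ρ (i + 1) ∈ U := by
    intro i hi
    rw [hs', map_range_succ]
    split_ifs with ho
    · exact hf _ _ hi ho
    · exact hf' _ _ hi (by cases h : G.owner (ρ i) <;> cases σ <;> simp_all)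
  have hin : ∀ i, ρ i ∈ U := by
    intro i
    induction i with
    | zero => rwa [h0]
    | succ i ih => exact (key i ih).2
  have hρ : G.PlayIn U ρ := ⟨fun i => (key i (hin i)).1, hin⟩
  refine (hw ρ hρ h0 fun i hi => ?_).not (hw' ρ hρ h0 fun i hi => ?_)
  · rw [hs', if_pos hi]
  · rw [hs', if_neg (by simp [hi])]

variable [DecidableEq C] {U : Finset V}

theorem image_mem_F_favoured (U : Finset V) : U.image G.color ∈ G.F (G.favoured U) := by
  unfold favoured
  split_ifs with h
  · exact h
  · exact (G.cover _).resolve_left h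

variable [DecidableEq V]

theorem avoid_subset (c : C) : G.avoid U c ⊆ U := Finset.sdiff_subset

theorem SubArena.avoid (hU : G.SubArena U) (c : C) : G.SubArena (G.avoid U c) := hU.sdiff_attr

theorem color_ne_of_mem_avoid {c : C} {v : V} (hv : v ∈ G.avoid U c) : G.color v ≠ c := by
  intro h
  simp only [CMG.avoid, Finset.mem_sdiff] at hv
  exact hv.2 (subset_attr (Finset.filter_subset _ _) (by simp [hv.1, h]))

theorem avoid_ssubset {c : C} (hc : c ∈ U.image G.color) : G.avoid U c ⊂ U := by
  refine (avoid_subset c).ssubset_of_ne fun h => ?_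
  obtain ⟨v, hv, rfl⟩ := Finset.mem_image.1 hc
  rw [← h] at hv
  exact color_ne_of_mem_avoid hv rfl

theorem image_avoid_subset (c : C) :
    (G.avoid U c).image G.color ⊆ (U.image G.color).erase c := by
  intro d hd
  obtain ⟨v, hv, rfl⟩ := Finset.mem_image.1 hd
  exact Finset.mem_erase.2 ⟨color_ne_of_mem_avoid hv,
    Finset.mem_image_of_mem _ (avoid_subset c hv)⟩

/-- For each colour `c` the objective "see `c` or win" can be forced: inside the attractor to `c` by
attraction, and outside by the strategy for `avoid U c`, with a switch if the attractor is entered.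
Then `force_of_cycle` applies. -/
theorem wins_favoured_of_forall_avoid [Finite V] (hU : G.SubArena U)
    (h : ∀ c ∈ U.image G.color, ∀ v ∈ G.avoid U c, G.Wins (G.avoid U c) (G.favoured U) v)
    {v : V} (hv : v ∈ U) : G.Wins U (G.favoured U) v := by
  refine force_of_cycle hU (image_mem_F_favoured U) (fun c hc w hw => ?_) hv
  have hO : TailClosed (fun ρ : ℕ → V =>
      (∃ i, G.color (ρ i) = c) ∨ G.WinsPlay (G.favoured U) ρ) :=
    tailClosed_or (tailClosed_exists (fun v => G.color v = c)) (G.tailClosed_winsPlay _)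
  have hA : ∀ x ∈ G.attr U (G.favoured U) {v ∈ U | G.color v = c},
      G.Force U (G.favoured U) (fun ρ : ℕ → V =>
        (∃ i, G.color (ρ i) = c) ∨ G.WinsPlay (G.favoured U) ρ) x := by
    intro x hx
    refine Force.of_mem_attr hU hO (fun y hy => ?_) hx
    rw [Finset.mem_filter] at hy
    have : Nonempty V := ⟨y⟩
    -- The colour is already seen at the start, so any valid strategy will do; the empty `Z` merely
    -- provides one.
    obtain ⟨f, hf, -⟩ := exists_uniform (σ := G.favoured U) (O := fun _ => True) hU
      (Z := ∅) (by simp)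
    exact ⟨f, hf, fun ρ _ h0 _ => Or.inl ⟨0, by rw [h0, hy.2]⟩⟩
  by_cases hwA : w ∈ G.attr U (G.favoured U) {v ∈ U | G.color v = c}
  · exact hA w hwA
  · exact Force.of_switch hU hO hA ((h c hc w (by simp [avoid, hw, hwA])).mono fun _ => Or.inr)

section Opponent

variable {c : C} {Y : Finset V}

/-- The part `avoid U c` is a trap for the favoured player, so a win of the opponent there is a win
in `U`, and it extends to his attractor. -/
theorem wins_of_mem_attr_opponent (hU : G.SubArena U)
    (hY : ∀ v ∈ Y, v ∈ G.avoid U c ∧ G.Wins (G.avoid U c) (!G.favoured U) v) {v : V}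
    (hv : v ∈ G.attr U (!G.favoured U) Y) : G.Wins U (!G.favoured U) v :=
  Force.of_mem_attr hU (G.tailClosed_winsPlay _)
    (fun w hw => Force.of_sdiff_attr hU (hY w hw).1 (hY w hw).2) hv

/-- For the opponent, the play may still enter the attractor, where he switches to a winning
strategy. For the favoured player, the remaining part is a trap for the opponent. -/
theorem wins_of_wins_sdiff_attr (hU : G.SubArena U)
    (hY : ∀ v ∈ Y, v ∈ G.avoid U c ∧ G.Wins (G.avoid U c) (!G.favoured U) v) {v : V}
    (hv : v ∈ U \ G.attr U (!G.favoured U) Y) {τ : Bool}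
    (h : G.Wins (U \ G.attr U (!G.favoured U) Y) τ v) : G.Wins U τ v := by
  by_cases hτ : τ = !G.favoured U
  · subst hτ
    exact Force.of_switch hU (G.tailClosed_winsPlay _)
      (fun w hw => wins_of_mem_attr_opponent hU hY hw) h
  · obtain rfl : τ = !!G.favoured U := by
      cases τ <;> cases h : G.favoured U <;> simp_all
    exact Force.of_sdiff_attr hU hv h

end Opponent

open Classical in
/-- Determinacy. -/
theorem wins_or_wins [Finite V] (hU : G.SubArena U) {v : V} (hv : v ∈ U) (σ : Bool) :
    G.Wins U σ v ∨ G.Wins U (!σ) v := by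
  induction U using Finset.strongInduction generalizing v σ with
  | H U ih =>
    have key : ∃ τ, G.Wins U τ v := by
      -- These are the two ways in which SolveCMG can end: no colour gives the opponent anything, or
      -- some colour `c` exhibits a position `w` that he wins.
      by_cases hall : ∀ c ∈ U.image G.color, ∀ v ∈ G.avoid U c,
          G.Wins (G.avoid U c) (G.favoured U) v
      · exact ⟨_, wins_favoured_of_forall_avoid hU hall hv⟩
      · push Not at hall
        obtain ⟨c, hc, w, hw, hnw⟩ := hall
        let Y := {v ∈ G.avoid U c | G.Wins (G.avoid U c) (!G.favoured U) v}
        have hY : ∀ v ∈ Y, v ∈ G.avoid U c ∧ G.Wins (G.avoid U c) (!G.favoured U) v :=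
          fun v hv => Finset.mem_filter.1 hv
        have hwY : w ∈ Y := Finset.mem_filter.2
          ⟨hw, (ih _ (avoid_ssubset hc) (hU.avoid c) hw _).resolve_left hnw⟩
        have hwX : w ∈ G.attr U (!G.favoured U) Y :=
          subset_attr (fun x hx => avoid_subset c (hY x hx).1) hwY
        by_cases hvX : v ∈ G.attr U (!G.favoured U) Y
        · exact ⟨_, wins_of_mem_attr_opponent hU hY hvX⟩
        · have hvX' : v ∈ U \ G.attr U (!G.favoured U) Y := Finset.mem_sdiff.2 ⟨hv, hvX⟩
          have hlt : U \ G.attr U (!G.favoured U) Y ⊂ U :=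
            Finset.sdiff_ssubset attr_subset ⟨w, hwX⟩
          rcases ih _ hlt hU.sdiff_attr hvX' true with h | h
          · exact ⟨_, wins_of_wins_sdiff_attr hU hY hvX' h⟩
          · exact ⟨_, wins_of_wins_sdiff_attr hU hY hvX' h⟩
    obtain ⟨τ, hτ⟩ := key
    cases τ <;> cases σ <;> simp_all

theorem wins_not_iff [Finite V] (hU : G.SubArena U) {v : V} (hv : v ∈ U) (σ : Bool) :
    G.Wins U (!σ) v ↔ ¬ G.Wins U σ v :=
  ⟨fun h h' => h'.not hv h, fun h => (wins_or_wins hU hv σ).resolve_left h⟩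

/-- The missing direction follows from determinacy of the smaller game: if the player did not win
there, the opponent would, and this win would carry over to `U`. -/
theorem wins_sdiff_attr_iff [Finite V] (hU : G.SubArena U) {c : C} {Y : Finset V}
    (hY : ∀ v ∈ Y, v ∈ G.avoid U c ∧ G.Wins (G.avoid U c) (!G.favoured U) v) {v : V}
    (hv : v ∈ U \ G.attr U (!G.favoured U) Y) (τ : Bool) :
    G.Wins U τ v ↔ G.Wins (U \ G.attr U (!G.favoured U) Y) τ v := by
  refine ⟨fun h => ?_, wins_of_wins_sdiff_attr hU hY hv⟩
  by_contra hn
  have := wins_of_wins_sdiff_attr hU hY hv ((wins_not_iff hU.sdiff_attr hv τ).2 hn)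
  exact h.not (Finset.mem_sdiff.1 hv).1 this

end Winning

end CMG

/-! ### Falling factorials and the recurrence for the number of calls -/

theorem Nat.descFactorial_mono_right {n j k : ℕ} (hjk : j ≤ k) (hk : k ≤ n) :
    n.descFactorial j ≤ n.descFactorial k := by
  induction k, hjk using Nat.le_induction with
  | base => exact le_rfl
  | succ k _ ih =>
    rw [Nat.descFactorial_succ]
    exact (ih (by omega)).trans (Nat.le_mul_of_pos_left _ (by omega))

theorem Nat.descFactorial_mono {n n' j k : ℕ} (hn : n' ≤ n) (hjk : j ≤ k) (hk : k ≤ n) :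
    n'.descFactorial j ≤ n.descFactorial k :=
  (Nat.descFactorial_le j hn).trans (Nat.descFactorial_mono_right hjk hk)

/-- This is the shape of the recursion: one subproblem with a colour less for each of `k + 1`
colours, and one with all the colours, all of them with one position less. -/
theorem Nat.succ_descFactorial_succ_eq_add {n k : ℕ} (hk : k ≤ n) :
    (n + 1).descFactorial (k + 1)
      = (k + 1) * n.descFactorial k + n.descFactorial (k + 1) := by
  rw [Nat.succ_descFactorial_succ, Nat.descFactorial_succ, ← Nat.add_mul]
  congr 1
  omega

namespace CMG

/-- Bound for the number of recursive calls that the loop makes when `len` colours are still to be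
treated, for a set of `n` positions with `k` colours. -/
def callBound (n k len : ℕ) : ℕ :=
  if k ≤ 1 ∨ n ≤ 2 then len
  else len * ((n - 1) * (n - 1).descFactorial (k - 1) - 1)
    + ((n - 1) * (n - 1).descFactorial (min k (n - 1)) - 1)

/-- The slack `2` leaves one unit for the call itself and one unit for the subtractions in
`callBound`. It is attained at `n = k = 2`, which is why very small arenas are treated apart. The
minimum in `callBound` covers `k = n`, as `n - 1` positions have at most `n - 1` colours. -/
theorem callBound_add_two_le {n k : ℕ} (hn : 2 ≤ n) (hk : 1 ≤ k) (hkn : k ≤ n) :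
    callBound n k k + 2 ≤ n * n.descFactorial k := by
  unfold callBound
  obtain ⟨m, rfl⟩ : ∃ m, n = m + 1 := ⟨n - 1, by omega⟩
  obtain ⟨j, rfl⟩ : ∃ j, k = j + 1 := ⟨k - 1, by omega⟩
  simp only [Nat.add_sub_cancel]
  have hD : 0 < m.descFactorial j := Nat.descFactorial_pos.2 (by omega)
  split_ifs with h
  · rw [Nat.succ_descFactorial_succ]
    rcases Nat.eq_zero_or_pos j with rfl | hj
    · simp; nlinarith
    · obtain rfl : m = 1 := by omega
      obtain rfl : j = 1 := by omega
      decide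
  · push Not at h
    set D := m.descFactorial j
    have h1 : 1 ≤ m * D := Nat.mul_pos (by omega) hD
    rcases Nat.lt_or_ge j m with hj | hj
    · rw [min_eq_left (by omega), Nat.succ_descFactorial_succ_eq_add (by omega)]
      have hE : 0 < m.descFactorial (j + 1) := Nat.descFactorial_pos.2 (by omega)
      set E := m.descFactorial (j + 1)
      have h2 : 1 ≤ m * E := Nat.mul_pos (by omega) hE
      zify [h1, h2]
      zify at h hD hE
      nlinarith [mul_pos hD (show (0 : ℤ) < j + 1 by omega)]
    · have e : m = j := by omega
      have e' : m.descFactorial m = D := congrArg m.descFactorial e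
      rw [min_eq_right (by omega), Nat.succ_descFactorial_succ, ← e, e']
      zify [h1]
      zify at h hD
      nlinarith

/-! ### SolveCMG: correctness, termination, number of calls -/

section Runs

variable {V C : Type*} [DecidableEq V] [DecidableEq C] {G : CMG V C} {U : Finset V}

/-- `W` is the pair of winning regions of the game restricted to `U`. -/
def Solves (G : CMG V C) (U : Finset V) (W : Bool → Finset V) : Prop :=
  ∀ σ v, v ∈ W σ ↔ v ∈ U ∧ G.Wins U σ v

omit [DecidableEq V] in
theorem card_image_color_pos (h : U.Nonempty) : 1 ≤ (U.image G.color).card :=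
  Finset.card_pos.2 (h.image _)

omit [DecidableEq C] in
theorem SubArena.two_le_card (hU : G.SubArena U) (h : U.Nonempty) : 2 ≤ U.card := by
  obtain ⟨u, hu⟩ := h
  obtain ⟨w, hw, he⟩ := hU u hu
  have : u ≠ w := fun h => G.bipartite _ _ he (by rw [h])
  rw [← Finset.card_pair this]
  exact Finset.card_le_card (by simp [Finset.insert_subset_iff, hu, hw])

/-- What a single recursive call on `S` contributes, the call included. The empty arena makes no
call and lies outside the range of `callBound_add_two_le`; there `3 ≤ n` is needed. -/
theorem one_add_le_of_callBound {S : Finset V} (hS : G.SubArena S) {n j N : ℕ} (hn : 3 ≤ n)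
    (hSn : S.card ≤ n - 1) (hj : (S.image G.color).card ≤ j) (hjn : j ≤ n - 1)
    (hN : N ≤ callBound S.card (S.image G.color).card (S.image G.color).card) :
    1 + N ≤ (n - 1) * (n - 1).descFactorial j - 1 := by
  have hD : 0 < (n - 1).descFactorial j := Nat.descFactorial_pos.2 (by omega)
  rcases S.eq_empty_or_nonempty with rfl | hne
  · have : N = 0 := by simpa [callBound] using hN
    have : 2 ≤ (n - 1) * (n - 1).descFactorial j := by nlinarith [show 2 ≤ n - 1 by omega]
    omega
  · have h1 := callBound_add_two_le (hS.two_le_card hne) (card_image_color_pos (G := G) hne)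
      Finset.card_image_le
    have h2 := Nat.mul_le_mul hSn (Nat.descFactorial_mono hSn hj hjn)
    omega

theorem card_image_avoid_le {c : C} (hc : c ∈ U.image G.color) :
    ((G.avoid U c).image G.color).card ≤ (U.image G.color).card - 1 := by
  rw [← Finset.card_erase_of_mem hc]
  exact Finset.card_le_card (image_avoid_subset c)

/-- Either no colour would be left, or at most one position, while a nonempty subarena of a
bipartite game has two. -/
theorem avoid_eq_empty (hU : G.SubArena U) {c : C} (hc : c ∈ U.image G.color)
    (h : (U.image G.color).card ≤ 1 ∨ U.card ≤ 2) : G.avoid U c = ∅ := by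
  by_contra hne
  have hne := Finset.nonempty_iff_ne_empty.2 hne
  rcases h with h | h
  · have := card_image_color_pos (G := G) hne
    have := card_image_avoid_le hc
    omega
  · have := (hU.avoid c).two_le_card hne
    have := Finset.card_lt_card (avoid_ssubset hc)
    omega

/-- The loop invariant is `hdone`: the favoured player wins everywhere in the part that avoids a
colour already treated. When the list is empty, this is the hypothesis of
`wins_favoured_of_forall_avoid`. -/
theorem LoopRun.spec [Finite V] {order : Finset V → List C} (ho : G.IsLoopOrder order)
    {l : List C} {W : Bool → Finset V} {N : ℕ} (h : G.LoopRun order U l W N)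
    (hU : G.SubArena U) (hl : ∀ c ∈ l, c ∈ U.image G.color)
    (hdone : ∀ c ∈ U.image G.color, c ∉ l →
      ∀ v ∈ G.avoid U c, G.Wins (G.avoid U c) (G.favoured U) v) :
    G.Solves U W ∧ N ≤ callBound U.card (U.image G.color).card l.length := by
  have hlen : ∀ S : Finset V, (order S).length = (S.image G.color).card := by
    intro S
    rw [← List.toFinset_card_of_nodup (ho S).1]
    congr 1
    ext c
    rw [List.mem_toFinset, (ho S).2]
  induction h with
  | done V' =>
    refine ⟨fun σ v => ?_, Nat.zero_le _⟩
    have hw : ∀ v ∈ V', G.Wins V' (G.favoured V') v := fun v hv =>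
      wins_favoured_of_forall_avoid hU (fun c hc => hdone c hc (by simp)) hv
    dsimp only
    split_ifs with hσ
    · subst hσ
      exact ⟨fun h => ⟨h, hw v h⟩, fun h => h.1⟩
    · simp only [Finset.notMem_empty, false_iff, not_and]
      intro hv h
      rw [Bool.eq_not_of_ne hσ] at h
      exact (hw v hv).not hv h
  | next V' c l W' W N' N hsub heq hrest ih ih' =>
    have hc : c ∈ V'.image G.color := hl c (by simp)
    obtain ⟨h1, h2⟩ := ih (hU.avoid c) (fun d hd => ((ho _).2 d).1 hd)
      (fun d hd hd' => absurd (((ho _).2 d).2 hd) hd')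
    obtain ⟨h3, h4⟩ := ih' hU (fun d hd => hl d (by simp [hd])) fun d hd hdl v hv => by
      by_cases hdc : d = c
      · subst hdc
        exact ((h1 _ v).1 (heq ▸ hv)).2
      · exact hdone d hd (by simp [hdc, hdl]) v hv
    refine ⟨h3, ?_⟩
    rw [hlen] at h2
    unfold callBound at h4 ⊢
    have hS := Finset.card_lt_card (avoid_ssubset hc)
    have hk := Finset.card_image_le (s := V') (f := G.color)
    split_ifs at h4 ⊢ with hsm
    · rw [avoid_eq_empty hU hc hsm] at h2
      have : N' = 0 := by simpa [callBound] using h2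
      simp; omega
    · have := one_add_le_of_callBound (hU.avoid c) (n := V'.card)
        (j := (V'.image G.color).card - 1) (by omega) (by omega) (card_image_avoid_le hc)
        (by omega) h2
      rw [List.length_cons, Nat.succ_mul]
      omega
  | found V' c l X W' W'' N' N'' hsub hne hX hsub' ih ih' =>
    have hc : c ∈ V'.image G.color := hl c (by simp)
    obtain ⟨h1, h2⟩ := ih (hU.avoid c) (fun d hd => ((ho _).2 d).1 hd)
      (fun d hd hd' => absurd (((ho _).2 d).2 hd) hd')
    have hY : ∀ v ∈ W' (!G.favoured V'),
        v ∈ G.avoid V' c ∧ G.Wins (G.avoid V' c) (!G.favoured V') v :=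
      fun v hv => (h1 _ v).1 hv
    -- By determinacy, a position of the avoiding part that the favoured player does not win is won
    -- by the opponent; so the removed set `X` is nonempty.
    obtain ⟨w, hw⟩ : (W' (!G.favoured V')).Nonempty := by
      by_contra hemp
      rw [Finset.not_nonempty_iff_eq_empty] at hemp
      apply hne
      ext v
      rw [h1]
      refine ⟨fun h => h.1, fun h => ⟨h, (wins_or_wins (hU.avoid c) h _).resolve_right ?_⟩⟩
      intro hv
      simpa [hemp] using (h1 _ v).2 ⟨h, hv⟩
    have hwX : w ∈ X := by
      rw [hX]
      exact subset_attr (fun x hx => avoid_subset c (hY x hx).1) hw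
    have hXV : X ⊆ V' := by rw [hX]; exact attr_subset
    obtain ⟨h3, h4⟩ := ih' (by rw [hX]; exact hU.sdiff_attr) (fun d hd => ((ho _).2 d).1 hd)
      (fun d hd hd' => absurd (((ho _).2 d).2 hd) hd')
    have hfav : ∀ v, v ∈ W'' (G.favoured V') ↔ v ∈ V' ∧ G.Wins V' (G.favoured V') v := by
      intro v
      rw [h3]
      by_cases hvV : v ∈ V'
      swap
      · simp [hvV]
      by_cases hvX : v ∈ X
      · simp only [Finset.mem_sdiff, hvX, not_true_eq_false, and_false, false_and, hvV, true_and,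
          false_iff]
        intro h
        rw [hX] at hvX
        exact h.not hvV (wins_of_mem_attr_opponent hU hY hvX)
      · subst hX
        have := wins_sdiff_attr_iff hU hY (Finset.mem_sdiff.2 ⟨hvV, hvX⟩) (G.favoured V')
        simp [hvV, hvX, this]
    refine ⟨fun σ v => ?_, ?_⟩
    · dsimp only
      split_ifs with hσ
      · subst hσ; exact hfav v
      · rw [Finset.mem_sdiff, hfav, Bool.eq_not_of_ne hσ]
        by_cases hvV : v ∈ V'
        · simp [hvV, wins_not_iff hU hvV]
        · simp [hvV]
    · rw [hlen] at h2 h4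
      have hS := Finset.card_lt_card (avoid_ssubset hc)
      have hk := Finset.card_image_le (s := V') (f := G.color)
      have hXc : (V' \ X).card ≤ V'.card - 1 := by
        have := Finset.card_lt_card (Finset.sdiff_ssubset hXV ⟨w, hwX⟩)
        omega
      -- In a very small arena the avoiding part is empty and the test cannot succeed.
      by_cases hsm : (V'.image G.color).card ≤ 1 ∨ V'.card ≤ 2
      · have := (hY w hw).1
        simp [avoid_eq_empty hU hc hsm] at this
      · unfold callBound
        rw [if_neg hsm]
        have h5 := one_add_le_of_callBound (hU.avoid c) (n := V'.card)
          (j := (V'.image G.color).card - 1) (by omega) (by omega) (card_image_avoid_le hc)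
          (by omega) h2
        have h6 := one_add_le_of_callBound (S := V' \ X) (by rw [hX]; exact hU.sdiff_attr)
          (n := V'.card) (j := min (V'.image G.color).card (V'.card - 1)) (by omega) hXc
          (le_min (Finset.card_le_card (Finset.image_subset_image Finset.sdiff_subset))
            (Finset.card_image_le.trans hXc))
          (min_le_right _ _) h4
        rw [List.length_cons, Nat.succ_mul]
        omega

theorem SolveRun.spec [Finite V] {order : Finset V → List C} (ho : G.IsLoopOrder order)
    {W : Bool → Finset V} {N : ℕ} (h : G.SolveRun order U W N) (hU : G.SubArena U) :
    G.Solves U W ∧ N ≤ callBound U.card (U.image G.color).card (U.image G.color).card := by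
  have := LoopRun.spec ho h hU (fun d hd => ((ho _).2 d).1 hd)
      (fun d hd hd' => absurd (((ho _).2 d).2 hd) hd')
  rwa [← List.toFinset_card_of_nodup (ho U).1,
    show (order U).toFinset = U.image G.color by ext c; rw [List.mem_toFinset, (ho U).2]] at this

/-- Termination depends on correctness: the second call is on a smaller set only because the first
call has found a position that the opponent wins. -/
theorem exists_solveRun [Finite V] {order : Finset V → List C} (ho : G.IsLoopOrder order)
    (hU : G.SubArena U) : ∃ W N, G.SolveRun order U W N := by
  induction U using Finset.strongInduction with
  | H U ih =>
    have key : ∀ l : List C, (∀ c ∈ l, c ∈ U.image G.color) →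
        ∃ W N, G.LoopRun order U l W N := by
      intro l
      induction l with
      | nil => intro _; exact ⟨_, _, .done U⟩
      | cons c l ihl =>
        intro hl
        have hc : c ∈ U.image G.color := hl c (by simp)
        obtain ⟨W', N', h'⟩ := ih _ (avoid_ssubset hc) (hU.avoid c)
        by_cases heq : W' (G.favoured U) = G.avoid U c
        · obtain ⟨W, N, h⟩ := ihl fun d hd => hl d (by simp [hd])
          exact ⟨_, _, .next U c l W' W N' N h' heq h⟩
        · have h1 := (SolveRun.spec ho h' (hU.avoid c)).1
          obtain ⟨w, hw⟩ : (W' (!G.favoured U)).Nonempty := by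
            by_contra hemp
            rw [Finset.not_nonempty_iff_eq_empty] at hemp
            apply heq
            ext v
            rw [h1]
            refine ⟨fun h => h.1, fun h => ⟨h, (wins_or_wins (hU.avoid c) h _).resolve_right ?_⟩⟩
            intro hv
            simpa [hemp] using (h1 _ v).2 ⟨h, hv⟩
          have hlt : U \ G.attr U (!G.favoured U) (W' (!G.favoured U)) ⊂ U :=
            Finset.sdiff_ssubset attr_subset
              ⟨w, subset_attr (fun x hx => avoid_subset c ((h1 _ x).1 hx).1) hw⟩
          obtain ⟨W'', N'', h''⟩ := ih _ hlt hU.sdiff_attr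
          exact ⟨_, _, .found U c l _ W' W'' N' N'' h' heq rfl h''⟩
    exact key _ fun d hd => ((ho _).2 d).1 hd

theorem solveRun_univ [Fintype V] [Fintype C] {order : Finset V → List C}
    (hcard : Fintype.card C ≤ Fintype.card V) (ho : G.IsLoopOrder order) :
    (∃ W N, G.SolveRun order Finset.univ W N) ∧
      ∀ W N, G.SolveRun order Finset.univ W N →
        (∀ σ, (W σ : Set V) = G.winRegion σ) ∧
        N ≤ (Fintype.card C).factorial * (Fintype.card V).choose (Fintype.card C)
              * Fintype.card V := by
  refine ⟨exists_solveRun ho subArena_univ, fun W N h => ?_⟩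
  obtain ⟨h1, h2⟩ := SolveRun.spec ho h subArena_univ
  refine ⟨fun σ => ?_, ?_⟩
  · ext v
    simp [h1 σ v, wins_univ]
  -- The bound is proved for the number of colours that occur; monotonicity up to `Fintype.card C`
  -- uses `hcard`.
  · rw [← Nat.descFactorial_eq_factorial_mul_choose, mul_comm]
    rcases (Finset.univ : Finset V).eq_empty_or_nonempty with he | hne
    · rw [he] at h2
      have : N = 0 := by simpa [callBound] using h2
      omega
    · have h3 := callBound_add_two_le ((subArena_univ (G := G)).two_le_card hne)
        (card_image_color_pos (G := G) hne) Finset.card_image_le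
      have h4 := Nat.descFactorial_mono_right (n := Fintype.card V)
        (Finset.card_le_univ (Finset.univ.image G.color)) hcard
      rw [Finset.card_univ] at h2 h3
      have := Nat.mul_le_mul_left (Fintype.card V) h4
      omega

end Runs

end CMG

/-! ## Total correctness with time bounds for the random access machine -/

namespace RAM

/-- All registers and memory cells hold numbers smaller than `B`, and `1 < B`. -/
structure Bounded (B : ℕ) (s : State) : Prop where
  one_lt : 1 < B
  reg_lt : ∀ r, s.reg r < B
  mem_lt : ∀ a, s.mem a < B

theorem Expr.Fits.eval_lt {B : ℕ} {s : State} {e : Expr} (h : e.Fits B s) : e.eval s < B := by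
  induction e with
  | const a => exact h
  | reg r => exact h
  | mem e _ => exact h.2
  | add e₁ e₂ _ _ => exact h.2.2
  | sub e₁ e₂ ih _ => exact (Nat.sub_le _ _).trans_lt (ih h.1)
  | lt e₁ e₂ _ _ => obtain ⟨_, _, h⟩ := h; simp only [eval]; split_ifs <;> omega
  | eq e₁ e₂ _ _ => obtain ⟨_, _, h⟩ := h; simp only [eval]; split_ifs <;> omega

namespace Cmd

/-- The command makes no call and does not assign to the register `r`. -/
def keeps (r : ℕ) : Cmd → Bool
  | skip => true
  | assign r' _ => r' != r
  | store _ _ => true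
  | seq c₁ c₂ => c₁.keeps r && c₂.keeps r
  | cond _ c₁ c₂ => c₁.keeps r && c₂.keeps r
  | loop _ c => c.keeps r
  | call _ => false

/-- The command makes no call and does not assign to the registers below `b`. -/
def keepsBelow (b : ℕ) : Cmd → Bool
  | skip => true
  | assign r _ => b.ble r
  | store _ _ => true
  | seq c₁ c₂ => c₁.keepsBelow b && c₂.keepsBelow b
  | cond _ c₁ c₂ => c₁.keepsBelow b && c₂.keepsBelow b
  | loop _ c => c.keepsBelow b
  | call _ => false

theorem keeps_of_keepsBelow {b r : ℕ} (hr : r < b) {c : Cmd} (h : c.keepsBelow b = true) :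
    c.keeps r = true := by
  induction c <;> simp_all [keeps, keepsBelow]
  omega

/-- Weakest precondition of a command without loops and calls. -/
def wp (B : ℕ) : Cmd → (State → Prop) → State → Prop
  | skip, Q, s => Q s
  | assign r e, Q, s => e.Fits B s ∧ Q ⟨Function.update s.reg r (e.eval s), s.mem⟩
  | store a e, Q, s =>
    a.Fits B s ∧ e.Fits B s ∧ Q ⟨s.reg, Function.update s.mem (a.eval s) (e.eval s)⟩
  | seq c₁ c₂, Q, s => c₁.wp B (c₂.wp B Q) s
  | cond e c₁ c₂, Q, s =>
    e.Fits B s ∧ (e.eval s ≠ 0 → c₁.wp B Q s) ∧ (e.eval s = 0 → c₂.wp B Q s)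
  | loop _ _, _, _ => False
  | call _, _, _ => False

/-- An upper bound for the time of a command without loops and calls. -/
def maxTime : Cmd → ℕ
  | skip => 1
  | assign _ e => e.cost + 1
  | store a e => a.cost + e.cost + 1
  | seq c₁ c₂ => c₁.maxTime + c₂.maxTime
  | cond e c₁ c₂ => e.cost + 1 + max c₁.maxTime c₂.maxTime
  | loop _ _ => 0
  | call _ => 0

/-- `for v = 0, …, (value of register b) - 1 do c`. -/
def forTo (v b : ℕ) (c : Cmd) : Cmd :=
  seq (assign v (.const 0))
    (loop (.lt (.reg v) (.reg b)) (seq c (assign v (.add (.reg v) (.const 1)))))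

end Cmd

variable {procs : List Cmd} {B d : ℕ} {c c₁ c₂ : Cmd} {s s' : State} {t T T₁ T₂ : ℕ}
  {Q Q' : State → Prop}

/-- Every number written has passed a `Fits` check, so boundedness has to be verified only for the
initial state. -/
theorem Exec.bounded (h : Exec procs B d c s t s') (hs : Bounded B s) : Bounded B s' := by
  induction h with
  | skip => exact hs
  | assign d r e s he =>
    refine ⟨hs.1, fun r' => ?_, hs.3⟩
    simp only [Function.update_apply]
    split_ifs
    · exact he.eval_lt
    · exact hs.2 r'
  | store d a e s ha he =>
    refine ⟨hs.1, hs.2, fun b => ?_⟩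
    simp only [Function.update_apply]
    split_ifs
    · exact he.eval_lt
    · exact hs.3 b
  | seq _ _ _ _ _ _ _ _ _ _ ih ih' => exact ih' (ih hs)
  | cond_true _ _ _ _ _ _ _ _ _ _ ih => exact ih hs
  | cond_false _ _ _ _ _ _ _ _ _ _ ih => exact ih hs
  | loop_true _ _ _ _ _ _ _ _ _ _ _ _ ih ih' => exact ih' (ih hs)
  | loop_false => exact hs
  | call _ _ _ _ _ _ _ _ ih => exact ih hs

/-- The frame rule for registers. Since `Cmd.keeps` is decided by computation, applications
discharge it with `rfl`; a procedure call keeps nothing. -/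
theorem Exec.reg_eq (h : Exec procs B d c s t s') {r : ℕ} (hr : c.keeps r = true) :
    s'.reg r = s.reg r := by
  induction h with
  | skip => rfl
  | assign d r' e s he =>
    simp only [Cmd.keeps, bne_iff_ne] at hr
    exact Function.update_of_ne (Ne.symm hr) _ _
  | store => rfl
  | seq _ _ _ _ _ _ _ _ _ _ ih ih' =>
    simp only [Cmd.keeps, Bool.and_eq_true] at hr
    rw [ih' hr.2, ih hr.1]
  | cond_true _ _ _ _ _ _ _ _ _ _ ih =>
    simp only [Cmd.keeps, Bool.and_eq_true] at hr
    exact ih hr.1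
  | cond_false _ _ _ _ _ _ _ _ _ _ ih =>
    simp only [Cmd.keeps, Bool.and_eq_true] at hr
    exact ih hr.2
  | loop_true _ _ _ _ _ _ _ _ _ _ _ _ ih ih' =>
    rw [ih' hr, ih (by simpa [Cmd.keeps] using hr)]
  | loop_false => rfl
  | call => simp [Cmd.keeps] at hr

/-- Started in `s`, the command `c` ends within `T` steps in a state that satisfies `Q`. -/
def Ends (procs : List Cmd) (B d : ℕ) (c : Cmd) (s : State) (T : ℕ) (Q : State → Prop) : Prop :=
  ∃ t s', Exec procs B d c s t s' ∧ t ≤ T ∧ Q s'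

theorem Ends.mono (h : Ends procs B d c s T Q) (hQ : ∀ s', Q s' → Q' s') (hT : T ≤ T₁) :
    Ends procs B d c s T₁ Q' := by
  obtain ⟨t, s', h1, h2, h3⟩ := h
  exact ⟨t, s', h1, h2.trans hT, hQ _ h3⟩

/-- What holds after every command is added to the postcondition. -/
theorem Ends.frame (h : Ends procs B d c s T Q) (hs : Bounded B s)
    (hQ : ∀ s', Bounded B s' → (∀ r, c.keeps r = true → s'.reg r = s.reg r) → Q s' → Q' s')
    (hT : T ≤ T₁) : Ends procs B d c s T₁ Q' := by
  obtain ⟨t, s', h1, h2, h3⟩ := h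
  exact ⟨t, s', h1, h2.trans hT, hQ _ (h1.bounded hs) (fun r hr => h1.reg_eq hr) h3⟩

theorem Ends.seq (h₁ : Ends procs B d c₁ s T₁ Q') (hs : Bounded B s)
    (h₂ : ∀ s', Bounded B s' → (∀ r, c₁.keeps r = true → s'.reg r = s.reg r) → Q' s' →
      Ends procs B d c₂ s' T₂ Q) (hT : T₁ + T₂ ≤ T) :
    Ends procs B d (.seq c₁ c₂) s T Q := by
  obtain ⟨t, s', h1, h2, h3⟩ := h₁
  obtain ⟨t', s'', h4, h5, h6⟩ := h₂ s' (h1.bounded hs) (fun r hr => h1.reg_eq hr) h3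
  exact ⟨_, _, .seq _ _ _ _ _ _ _ _ h1 h4, by omega, h6⟩

theorem Ends.of_wp (h : c.wp B Q s) (hT : c.maxTime ≤ T) : Ends procs B d c s T Q := by
  suffices h' : Ends procs B d c s c.maxTime Q from h'.mono (fun _ h => h) hT
  clear hT
  induction c generalizing s Q with
  | skip => exact ⟨_, _, .skip _ _, le_rfl, h⟩
  | assign r e => exact ⟨_, _, .assign _ _ _ _ h.1, le_rfl, h.2⟩
  | store a e => exact ⟨_, _, .store _ _ _ _ h.1 h.2.1, le_rfl, h.2.2⟩
  | seq c₁ c₂ ih₁ ih₂ =>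
    obtain ⟨t, s', h1, h2, h3⟩ := ih₁ h
    obtain ⟨t', s'', h4, h5, h6⟩ := ih₂ h3
    exact ⟨_, _, .seq _ _ _ _ _ _ _ _ h1 h4, by simp only [Cmd.maxTime]; omega, h6⟩
  | cond e c₁ c₂ ih₁ ih₂ =>
    obtain ⟨he, h1, h2⟩ := h
    by_cases h0 : e.eval s = 0
    · obtain ⟨t, s', h3, h4, h5⟩ := ih₂ (h2 h0)
      exact ⟨_, _, .cond_false _ _ _ _ _ _ _ he h0 h3, by simp only [Cmd.maxTime]; omega, h5⟩
    · obtain ⟨t, s', h3, h4, h5⟩ := ih₁ (h1 h0)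
      exact ⟨_, _, .cond_true _ _ _ _ _ _ _ he h0 h3, by simp only [Cmd.maxTime]; omega, h5⟩
  | loop e c => exact h.elim
  | call i => exact h.elim

theorem Ends.assign_seq {r x : ℕ} {e : Expr} (hs : Bounded B s) (he : e.Fits B s)
    (hx : e.eval s = x)
    (h : ∀ s', Bounded B s' → s'.mem = s.mem → s'.reg r = x →
      (∀ i, i ≠ r → s'.reg i = s.reg i) → Ends procs B d c s' T₁ Q)
    (hT : e.cost + 1 + T₁ ≤ T) : Ends procs B d (.seq (.assign r e) c) s T Q :=
  (Ends.of_wp (c := .assign r e) (T := e.cost + 1)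
    (Q := fun s' => s'.mem = s.mem ∧ s'.reg r = x ∧ ∀ i, i ≠ r → s'.reg i = s.reg i)
    ⟨he, rfl, by simp [hx], fun _ hi => Function.update_of_ne hi _ _⟩ le_rfl).seq hs
    (fun s' hs' _ h' => h s' hs' h'.1 h'.2.1 h'.2.2) hT

theorem Ends.cond {e : Expr} (he : e.Fits B s)
    (h₁ : e.eval s ≠ 0 → Ends procs B d c₁ s T₁ Q) (h₂ : e.eval s = 0 → Ends procs B d c₂ s T₁ Q)
    (hT : e.cost + 1 + T₁ ≤ T) : Ends procs B d (.cond e c₁ c₂) s T Q := by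
  by_cases h0 : e.eval s = 0
  · obtain ⟨t, s', h3, h4, h5⟩ := h₂ h0
    exact ⟨_, _, .cond_false _ _ _ _ _ _ _ he h0 h3, by omega, h5⟩
  · obtain ⟨t, s', h3, h4, h5⟩ := h₁ h0
    exact ⟨_, _, .cond_true _ _ _ _ _ _ _ he h0 h3, by omega, h5⟩

theorem Ends.loop_true {e : Expr} (he : e.Fits B s) (h0 : e.eval s ≠ 0) (hs : Bounded B s)
    (h₁ : Ends procs B d c s T₁ Q')
    (h₂ : ∀ s', Bounded B s' → (∀ r, c.keeps r = true → s'.reg r = s.reg r) → Q' s' →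
      Ends procs B d (.loop e c) s' T₂ Q) (hT : e.cost + 1 + T₁ + T₂ ≤ T) :
    Ends procs B d (.loop e c) s T Q := by
  obtain ⟨t, s', h1, h2, h3⟩ := h₁
  obtain ⟨t', s'', h4, h5, h6⟩ := h₂ s' (h1.bounded hs) (fun r hr => h1.reg_eq hr) h3
  exact ⟨_, _, .loop_true _ _ _ _ _ _ _ _ he h0 h1 h4, by omega, h6⟩

theorem Ends.loop_false {e : Expr} (he : e.Fits B s) (h0 : e.eval s = 0) (hQ : Q s)
    (hT : e.cost + 1 ≤ T) : Ends procs B d (.loop e c) s T Q :=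
  ⟨_, _, .loop_false _ _ _ _ he h0, hT, hQ⟩

theorem Ends.call {i : ℕ} {body : Cmd} (hi : procs[i]? = some body)
    (h : Ends procs B d body s T Q) : Ends procs B (d + 1) (.call i) s (T + 1) Q := by
  obtain ⟨t, s', h1, h2, h3⟩ := h
  exact ⟨_, _, .call _ _ _ _ _ _ hi h1, by omega, h3⟩

/-- Rule for counting loops. The invariant speaks about the memory and one register `x`. -/
theorem Ends.forTo {v b x N : ℕ} (Inv : ℕ → (ℕ → ℕ) → ℕ → Prop) (hs : Bounded B s)
    (hb : s.reg b = N) (hk : c.keeps b = true) (hkv : c.keeps v = true) (hvb : v ≠ b)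
    (hvx : v ≠ x) (h0 : Inv 0 s.mem (s.reg x))
    (hstep : ∀ i < N, ∀ s', s'.reg v = i → Bounded B s' →
      (∀ r, c.keeps r = true → r ≠ v → s'.reg r = s.reg r) → Inv i s'.mem (s'.reg x) →
      Ends procs B d c s' T₁ (fun s'' => Inv (i + 1) s''.mem (s''.reg x)))
    (hQ : ∀ s', Bounded B s' → (∀ r, c.keeps r = true → r ≠ v → s'.reg r = s.reg r) →
      Inv N s'.mem (s'.reg x) → Q s')
    (hT : N * (T₁ + 8) + 6 ≤ T) : Ends procs B d (.forTo v b c) s T Q := by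
  have hNB : N < B := hb ▸ hs.2 b
  -- The test and the increment cost `4` each, hence `8` per round; the initial assignment costs `2`
  -- and the last test `4`, hence the summand `6`.
  have key : ∀ j i, i + j = N → ∀ s', s'.reg v = i → Bounded B s' →
      (∀ r, c.keeps r = true → r ≠ v → s'.reg r = s.reg r) → Inv i s'.mem (s'.reg x) →
      Ends procs B d
        (.loop (.lt (.reg v) (.reg b)) (.seq c (.assign v (.add (.reg v) (.const 1)))))
        s' (j * (T₁ + 8) + 4) Q := by
    intro j
    induction j with
    | zero =>
      intro i hi s' hv hs' hr hinv
      obtain rfl : i = N := by omega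
      have hb' : s'.reg b = i := by rw [hr b hk hvb.symm, hb]
      refine Ends.loop_false ⟨hs'.2 _, hs'.2 _, hs.1⟩ ?_ (hQ s' hs' hr hinv) ?_
      · simp [Expr.eval, hv, hb']
      · simp [Expr.cost]
    | succ j ih =>
      intro i hi s' hv hs' hr hinv
      have hb' : s'.reg b = N := by rw [hr b hk hvb.symm, hb]
      refine Ends.loop_true (Q' := fun s' => s'.reg v = i + 1 ∧ Bounded B s' ∧
          (∀ r, c.keeps r = true → r ≠ v → s'.reg r = s.reg r) ∧ Inv (i + 1) s'.mem (s'.reg x))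
        (T₁ := T₁ + 4) (T₂ := j * (T₁ + 8) + 4) ⟨hs'.2 _, hs'.2 _, hs.1⟩ ?_ hs' ?_ ?_ ?_
      · simp [Expr.eval, hv, hb']; omega
      · refine (hstep i (by omega) s' hv hs' hr hinv).seq hs' (T₂ := 4) ?_ le_rfl
        intro s'' hs'' hr'' hinv'
        have hv'' : s''.reg v = i := by rw [hr'' v hkv, hv]
        refine Ends.of_wp (c := .assign v (.add (.reg v) (.const 1)))
          ⟨⟨hs''.2 _, hs.1, by simp [Expr.eval, hv'']; omega⟩, ?_⟩
          (by simp [Cmd.maxTime, Expr.cost])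
        refine ⟨by simp [Expr.eval, hv''], ⟨hs.1, fun r => ?_, hs''.3⟩, fun r hr1 hr2 => ?_, ?_⟩
        · simp only [Function.update_apply, Expr.eval]
          split_ifs
          · omega
          · exact hs''.2 r
        · simp only [Function.update_of_ne hr2]
          rw [hr'' r hr1, hr r hr1 hr2]
        · simpa only [Function.update_of_ne hvx.symm] using hinv'
      · intro s'' hs'' _ ⟨h1, h2, h3, h4⟩
        exact ih (i + 1) (by omega) s'' h1 h2 h3 h4
      · simp only [Expr.cost]; rw [Nat.succ_mul]; omega
  refine Ends.seq (Q' := fun s' => s'.reg v = 0 ∧ (∀ r, r ≠ v → s'.reg r = s.reg r) ∧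
    s'.mem = s.mem) (T₁ := 2) (T₂ := N * (T₁ + 8) + 4) (Ends.of_wp ⟨?_, ?_⟩ ?_) hs ?_ (by omega)
  · simp only [Expr.Fits]; omega
  · exact ⟨by simp [Expr.eval], fun r hr => Function.update_of_ne hr _ _, rfl⟩
  · simp [Cmd.maxTime, Expr.cost]
  · intro s' hs' _ ⟨h1, h2, h3⟩
    refine key N 0 (by omega) s' h1 hs' (fun r _ hr => h2 r hr) ?_
    rw [h3, h2 x hvx.symm]
    exact h0

/-- Rule for loops that treat the cells of an array one after the other: the loop turns the array
`f` at the address `a₀` into `g`. The invariant `J` speaks about the register `x`. -/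
theorem Ends.forArray {v b x N a₀ : ℕ} {f g : Fin N → ℕ} (J : ℕ → ℕ → Prop) (hs : Bounded B s)
    (hb : s.reg b = N) (hk : c.keeps b = true) (hkv : c.keeps v = true) (hvb : v ≠ b)
    (hvx : v ≠ x) (h0 : J 0 (s.reg x)) (hf : ∀ i : Fin N, s.mem (a₀ + i) = f i)
    (hstep : ∀ i : Fin N, ∀ s' : State, s'.reg v = i → Bounded B s' →
      (∀ r, c.keeps r = true → r ≠ v → s'.reg r = s.reg r) → s'.mem (a₀ + i) = f i →
      (∀ a, a < a₀ ∨ a₀ + N ≤ a → s'.mem a = s.mem a) → J i (s'.reg x) →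
      Ends procs B d c s' T₁ (fun s'' => s''.mem (a₀ + i) = g i ∧
        (∀ a, a ≠ a₀ + i → s''.mem a = s'.mem a) ∧ J (i + 1) (s''.reg x)))
    (hQ : ∀ s', Bounded B s' → (∀ r, c.keeps r = true → r ≠ v → s'.reg r = s.reg r) →
      (∀ i : Fin N, s'.mem (a₀ + i) = g i) →
      (∀ a, a < a₀ ∨ a₀ + N ≤ a → s'.mem a = s.mem a) → J N (s'.reg x) → Q s')
    (hT : N * (T₁ + 8) + 6 ≤ T) : Ends procs B d (.forTo v b c) s T Q := by
  refine Ends.forTo (x := x) (T₁ := T₁)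
    (fun i mem y => (∀ j : Fin N, mem (a₀ + j) = if (j : ℕ) < i then g j else f j) ∧
      (∀ a, a < a₀ ∨ a₀ + N ≤ a → mem a = s.mem a) ∧ J i y) hs hb hk hkv hvb hvx
    ⟨by simpa using hf, fun _ _ => rfl, h0⟩ ?_ ?_ hT
  · rintro i hi s' hv hs' hr ⟨h1, h2, h3⟩
    refine (hstep ⟨i, hi⟩ s' hv hs' hr (by rw [h1]; simp) h2 h3).mono ?_ le_rfl
    rintro s'' ⟨h4, h5, h6⟩
    refine ⟨fun j => ?_, fun a ha => ?_, h6⟩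
    · by_cases hj : (j : ℕ) = i
      · obtain rfl : j = ⟨i, hi⟩ := Fin.ext hj
        rw [h4, if_pos (by simp)]
      · rw [h5 _ (by simp; exact hj), h1]
        by_cases hlt : (j : ℕ) < i
        · rw [if_pos hlt, if_pos (by omega)]
        · rw [if_neg hlt, if_neg (by omega)]
    · rw [h5 _ (by simp; omega), h2 a ha]
  · rintro s' hs' hr ⟨h1, h2, h3⟩
    exact hQ s' hs' hr (fun i => by rw [h1, if_pos i.2]) h2 h3

end RAM

/-! ## The program -/

namespace RAM

infixr:60 " ;; " => Cmd.seq

namespace Prog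

open RAM.Expr

/-- First pass of an attractor round, for one edge: the source is marked with `3` if it is not yet
in the attractor and the edge leads into the attractor (for the positions of the attracting player)
or to a position outside of it (for the other positions). -/
def markEdge : Cmd :=
  .assign 12 (mem (add (reg 4) (add (reg 10) (reg 10)))) ;;
  .assign 13 (mem (add (add (reg 4) (const 1)) (add (reg 10) (reg 10)))) ;;
  .cond (eq (mem (add (reg 18) (reg 12))) (const 1))
    (.assign 11 (mem (add (reg 18) (reg 13))) ;;
      .cond (eq (mem (add (const 3) (reg 12))) (reg 15))
        (.cond (eq (reg 11) (const 2)) (.store (add (reg 18) (reg 12)) (const 3)) .skip)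
        (.cond (add (eq (reg 11) (const 1)) (eq (reg 11) (const 3)))
          (.store (add (reg 18) (reg 12)) (const 3)) .skip))
    .skip

/-- Second pass of an attractor round, for one position. -/
def updatePosition : Cmd :=
  .assign 11 (mem (add (reg 18) (reg 10))) ;;
  .cond (eq (mem (add (const 3) (reg 10))) (reg 15))
    (.cond (eq (reg 11) (const 3))
      (.store (add (reg 18) (reg 10)) (const 2) ;; .assign 14 (const 1)) .skip)
    (.cond (eq (reg 11) (const 1))
      (.store (add (reg 18) (reg 10)) (const 2) ;; .assign 14 (const 1))
      (.cond (eq (reg 11) (const 3)) (.store (add (reg 18) (reg 10)) (const 1)) .skip))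

/-- One round of the attractor computation. -/
def attrRound : Cmd :=
  .assign 14 (const 0) ;; .forTo 10 2 markEdge ;; .forTo 10 0 updatePosition

/-- The attractor of the player in register 15, in the array at the address in register 18: at the
start the target has the value `2` and the rest of the arena `1`. -/
def attractor : Cmd := .assign 14 (const 1) ;; .loop (reg 14) attrRound

/-- Marks the colour of a position and adds its weight to the mask of the colours. -/
def addColor : Cmd :=
  .cond (eq (mem (add (reg 9) (reg 10))) (const 1))
    (.assign 11 (mem (add (reg 3) (reg 10))) ;;
      .cond (mem (add (add (reg 9) (reg 0)) (reg 11))) .skip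
        (.store (add (add (reg 9) (reg 0)) (reg 11)) (const 1) ;;
          .assign 16 (add (reg 16) (mem (add (reg 5) (reg 11))))))
    .skip

/-- Computes the occurring colours and the favoured player, and starts the loop over the
colours. -/
def setup : Cmd :=
  .forTo 10 1 (.store (add (add (reg 9) (reg 0)) (reg 10)) (const 0)) ;;
  .assign 16 (const 0) ;;
  .forTo 10 0 addColor ;;
  .store (add (reg 9) (reg 7)) (const 0) ;;
  .store (add (add (reg 9) (const 1)) (reg 7)) (sub (const 1) (mem (add (reg 6) (reg 16))))

/-- The target of the first attractor, at one position. -/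
def targetColor : Cmd :=
  .cond (eq (mem (add (reg 9) (reg 10))) (const 1))
    (.store (add (reg 18) (reg 10))
      (add (const 1) (eq (mem (add (reg 3) (reg 10))) (reg 17))))
    (.store (add (reg 18) (reg 10)) (const 0))

/-- Removes a position of the attractor. -/
def removeAttr : Cmd :=
  .cond (eq (mem (add (reg 18) (reg 10))) (const 2))
    (.store (add (reg 18) (reg 10)) (const 0)) .skip

/-- The target of the second attractor, at one position. -/
def targetLost : Cmd :=
  .cond (eq (mem (add (reg 9) (reg 10))) (const 1))
    (.cond (eq (add (mem (add (reg 18) (reg 10))) (reg 15)) (const 3))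
      (.store (add (reg 18) (reg 10)) (const 2) ;; .assign 14 (const 1))
      (.store (add (reg 18) (reg 10)) (const 1)))
    (.store (add (reg 18) (reg 10)) (const 0))

/-- Records the winner of a position in the second attractor. -/
def recordAttr : Cmd :=
  .cond (eq (mem (add (reg 18) (reg 10))) (const 2))
    (.store (add (reg 9) (reg 10)) (add (const 2) (reg 15))) .skip

/-- Records the winner of a position of which the winner is not yet known. -/
def recordRest : Cmd :=
  .cond (eq (mem (add (reg 9) (reg 10))) (const 1))
    (.store (add (reg 9) (reg 10)) (add (const 2) (reg 15))) .skip

/-- Goes on to the next colour. -/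
def nextColor : Cmd :=
  .store (add (reg 9) (reg 7)) (add (mem (add (reg 9) (reg 7))) (const 1))

/-- The call for the positions from which the opponent can avoid the colour in register 17. -/
def callAvoid : Cmd :=
  .assign 15 (mem (add (add (reg 9) (const 1)) (reg 7))) ;;
  .assign 18 (add (reg 9) (reg 8)) ;;
  .forTo 10 0 targetColor ;;
  attractor ;;
  .forTo 10 0 removeAttr ;;
  .assign 9 (reg 18) ;;
  .call 0 ;;
  .assign 9 (sub (reg 9) (reg 8)) ;;
  .assign 18 (add (reg 9) (reg 8)) ;;
  .assign 15 (mem (add (add (reg 9) (const 1)) (reg 7))) ;;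
  .assign 14 (const 0) ;;
  .forTo 10 0 targetLost

/-- The opponent wins somewhere. -/
def found : Cmd :=
  .assign 15 (sub (const 1) (reg 15)) ;;
  attractor ;;
  .forTo 10 0 recordAttr ;;
  setup

/-- The body of the loop over the colours. -/
def treatColor : Cmd :=
  .assign 17 (mem (add (reg 9) (reg 7))) ;;
  .cond (mem (add (add (reg 9) (reg 0)) (reg 17)))
    (callAvoid ;; .cond (reg 14) found nextColor)
    nextColor

/-- The loop over the colours. -/
def colorLoop : Cmd := .loop (lt (mem (add (reg 9) (reg 7))) (reg 1)) treatColor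

/-- Solves the subgame in the frame at the address in register 9. -/
def solve : Cmd :=
  setup ;; colorLoop ;;
  .assign 15 (mem (add (add (reg 9) (const 1)) (reg 7))) ;;
  .forTo 10 0 recordRest

end Prog

end RAM

/-! ### Layout of tables and constant registers -/

namespace CMG

open RAM

variable {n k : ℕ} {G : CMG (Fin n) (Fin k)}

/-- The number that represents a set of colours. -/
def mask (S : Finset (Fin k)) : ℕ := ∑ c ∈ S, 2 ^ (c : ℕ)

/-- The part of the memory that holds the input and the tables, the latter from the address `p`
on. -/
structure Tables (L : G.Listing) (p : ℕ) (mem : ℕ → ℕ) : Prop where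
  le : 3 + 2 * n + 2 * L.edges.length ≤ p
  owner : ∀ v : Fin n, mem (3 + v) = (G.owner v).toNat
  color : ∀ v : Fin n, mem (3 + n + v) = G.color v
  src : ∀ (i : ℕ) (h : i < L.edges.length), mem (3 + 2 * n + (i + i)) = (L.edges[i]).1
  tgt : ∀ (i : ℕ) (h : i < L.edges.length), mem (3 + 2 * n + 1 + (i + i)) = (L.edges[i]).2
  weight : ∀ c : Fin k, mem (p + c) = 2 ^ (c : ℕ)
  fav : ∀ S : Finset (Fin k), mem (p + k + mask S) = if S ∈ G.F false then 1 else 0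

/-- The registers that keep their values throughout the recursion. -/
structure Consts (L : G.Listing) (p : ℕ) (reg : ℕ → ℕ) : Prop where
  r0 : reg 0 = n
  r1 : reg 1 = k
  r2 : reg 2 = L.edges.length
  r3 : reg 3 = 3 + n
  r4 : reg 4 = 3 + 2 * n
  r5 : reg 5 = p
  r6 : reg 6 = p + k
  r7 : reg 7 = 2 * n
  r8 : reg 8 = 2 * n + 2

theorem Consts.of_eq {L : G.Listing} {p : ℕ} {r r' : ℕ → ℕ} (h : Consts L p r)
    (he : ∀ i < 9, r' i = r i) : Consts L p r' := by
  obtain ⟨h0, h1, h2, h3, h4, h5, h6, h7, h8⟩ := h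
  constructor <;> rw [he _ (by norm_num)] <;> assumption

theorem mask_lt (S : Finset (Fin k)) : mask S < 2 ^ k := by
  have h1 : mask S ≤ mask (Finset.univ : Finset (Fin k)) :=
    Finset.sum_le_sum_of_subset (Finset.subset_univ S)
  have h2 : mask (Finset.univ : Finset (Fin k)) = 2 ^ k - 1 := by
    rw [mask, Fin.sum_univ_eq_sum_range (fun i => 2 ^ i), Nat.geomSum_eq (le_refl 2)]
    simp
  have := Nat.one_le_two_pow (n := k)
  omega

/-- Uniqueness of binary expansions; it makes the table of favoured players well defined. -/
theorem mask_injective : Function.Injective (mask (k := k)) := by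
  intro S S' h
  have : ∀ S : Finset (Fin k), mask S = ∑ i ∈ S.map Fin.valEmbedding, 2 ^ i := by
    intro S; simp [mask]
  rw [this, this] at h
  exact Finset.map_injective _ (Finset.geomSum_injective (le_refl 2) h)

theorem Tables.of_eq {L : G.Listing} {p : ℕ} {m m' : ℕ → ℕ} (h : Tables L p m)
    (he : ∀ a < p + k + 2 ^ k, m' a = m a) : Tables L p m' := by
  obtain ⟨hle, h0, h1, h2, h3, h4, h5⟩ := h
  have hpos : 0 < 2 ^ k := Nat.two_pow_pos k
  refine ⟨hle, fun v => ?_, fun v => ?_, fun i hi => ?_, fun i hi => ?_, fun c => ?_, fun S => ?_⟩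
  · rw [he _ (by omega), h0]
  · rw [he _ (by omega), h1]
  · rw [he _ (by omega), h2]
  · rw [he _ (by omega), h3]
  · rw [he _ (by omega), h4]
  · rw [he _ (by have := mask_lt S; omega), h5]

end CMG

/-! ### The attractor computation -/

namespace CMG

open RAM

variable {n k : ℕ} {G : CMG (Fin n) (Fin k)} {L : G.Listing} {p B d : ℕ} {procs : List Cmd}
  {s : State}

/-- The array during an attractor round: `W` is the attractor found so far, in the arena `U`, and
`P` contains the marked positions. -/
def stVal (U W P : Finset (Fin n)) (v : Fin n) : ℕ :=
  if v ∈ W then 2 else if v ∈ U then (if v ∈ P then 3 else 1) else 0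

open Classical in
/-- The positions marked by the edges in the list `l`. -/
noncomputable def marks (G : CMG (Fin n) (Fin k)) (U : Finset (Fin n)) (σ : Bool)
    (W : Finset (Fin n)) (l : List (Fin n × Fin n)) : Finset (Fin n) :=
  {v | ∃ w, (v, w) ∈ l ∧ if G.owner v = σ then w ∈ W else w ∈ U ∧ w ∉ W}

theorem mem_marks_append {U W : Finset (Fin n)} {σ : Bool} {l : List (Fin n × Fin n)}
    {u w v : Fin n} : v ∈ marks G U σ W (l ++ [(u, w)]) ↔ v ∈ marks G U σ W l ∨
      (v = u ∧ if G.owner u = σ then w ∈ W else w ∈ U ∧ w ∉ W) := by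
  simp only [marks, Finset.mem_filter, Finset.mem_univ, true_and, List.mem_append,
    List.mem_singleton, Prod.mk.injEq]
  constructor
  · rintro ⟨x, hx | ⟨rfl, rfl⟩, h⟩
    · exact Or.inl ⟨x, hx, h⟩
    · exact Or.inr ⟨rfl, h⟩
  · rintro (⟨x, hx, h⟩ | ⟨rfl, h⟩)
    · exact ⟨x, Or.inl hx, h⟩
    · exact ⟨w, Or.inr ⟨rfl, rfl⟩, h⟩

theorem toNat_inj {a b : Bool} : a.toNat = b.toNat ↔ a = b := by
  cases a <;> cases b <;> simp

/-- The mark has opposite meanings for the two players: for the attracting player it records an edge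
into the attractor, for the other one an edge that escapes from it. -/
theorem markEdge_spec (hs : Bounded B s) (hc : Consts L p s.reg) (ht : Tables L p s.mem)
    {ch i : ℕ} {σ : Bool} (h18 : s.reg 18 = ch) (h15 : s.reg 15 = σ.toNat) (h10 : s.reg 10 = i)
    (hi : i < L.edges.length) (hB : ch + n < B) (hpB : p + 4 < B)
    {U W : Finset (Fin n)}
    (ha : ∀ v : Fin n, s.mem (ch + v) = stVal U W (marks G U σ W (L.edges.take i)) v) :
    Ends procs B d Prog.markEdge s 60 (fun s' =>
      (∀ v : Fin n, s'.mem (ch + v) = stVal U W (marks G U σ W (L.edges.take (i + 1))) v) ∧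
      ∀ a, a < ch ∨ ch + n ≤ a → s'.mem a = s.mem a) := by
  refine Ends.of_wp ?_ (by decide)
  have hle := ht.le
  obtain ⟨u, w, he⟩ : ∃ u w, L.edges[i] = (u, w) := ⟨_, _, rfl⟩
  have hu := ht.src i hi
  have hw := ht.tgt i hi
  rw [he] at hu hw
  have hou := ht.owner u
  have hau := ha u
  have haw := ha w
  have htk : L.edges.take (i + 1) = L.edges.take i ++ [(u, w)] := by
    rw [List.take_add_one]; simp [he, hi]
  rw [htk]
  have hu' := u.2
  have hw' := w.2
  have hlt : ∀ v, stVal U W (marks G U σ W (L.edges.take i)) v < B := by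
    intro v; unfold stVal; split_ifs <;> omega
  have hA : (if G.owner u = σ then w ∈ W else w ∈ U ∧ w ∉ W) →
      stVal U W (marks G U σ W (L.edges.take i)) u = 1 → ∀ v : Fin n,
      (if (v : ℕ) = u then 3 else s.mem (ch + v))
        = stVal U W (marks G U σ W (L.edges.take i ++ [(u, w)])) v := by
    intro hg h1 v
    by_cases hv : v = u
    · subst hv
      simp only [stVal] at h1 ⊢
      simp only [mem_marks_append, hg]
      split_ifs at h1 <;> simp_all
    · simp only [Fin.val_inj, hv, if_false, ha, stVal, mem_marks_append, false_and, or_false]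
  have hN : ¬ ((if G.owner u = σ then w ∈ W else w ∈ U ∧ w ∉ W) ∧
      stVal U W (marks G U σ W (L.edges.take i)) u = 1) → ∀ v : Fin n,
      s.mem (ch + v) = stVal U W (marks G U σ W (L.edges.take i ++ [(u, w)])) v := by
    intro hg v
    rw [ha]
    by_cases hv : v = u
    · subst hv
      simp only [stVal, mem_marks_append] at hg ⊢
      split_ifs at hg ⊢ <;> simp_all
    · simp only [stVal, mem_marks_append, hv, false_and, or_false]
  have hw2 : stVal U W (marks G U σ W (L.edges.take i)) w = 2 ↔ w ∈ W := by
    unfold stVal; split_ifs <;> simp_all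
  -- A target with the value `3` has been marked in this pass but is still outside of the attractor;
  -- hence the two admissible values.
  have hw13 : (stVal U W (marks G U σ W (L.edges.take i)) w = 1 ∨
      stVal U W (marks G U σ W (L.edges.take i)) w = 3) ↔ (w ∈ U ∧ w ∉ W) := by
    unfold stVal; split_ifs <;> simp_all
  simp only [Prog.markEdge, Cmd.wp, Expr.eval, Expr.Fits, Function.update_apply, hc.r4, h10, h18,
    h15, hu]
  have hσ : σ.toNat < B := by rw [← h15]; exact hs.reg_lt _
  have hou' : (G.owner u).toNat < B := by rw [← hou]; exact hs.mem_lt _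
  have hout : ∀ a, a < ch ∨ ch + n ≤ a → a = ch + ↑u → 3 = s.mem a := fun a ha h => by omega
  have hul := hlt u
  have hwl := hlt w
  simp [hw, hau, haw, hou, hs.one_lt]
  refine ⟨by omega, by omega, by omega, fun h1 => ⟨by omega, by omega, fun ho => ⟨by omega,
    fun h2 => ⟨by omega, by omega, hA ?_ h1, hout⟩, fun h2 => hN ?_⟩, fun ho => ⟨⟨hwl, by omega,
    ?_⟩, fun h2 => ⟨by omega, by omega, hA ?_ h1, hout⟩, fun h2 h3 => hN ?_⟩⟩, fun h1 => hN ?_⟩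
  · rw [if_pos (toNat_inj.1 ho)]; exact hw2.1 h2
  · rw [if_pos (toNat_inj.1 ho)]; exact fun h => h2 (hw2.2 h.1)
  · split_ifs <;> omega
  · rw [if_neg fun h => ho (toNat_inj.2 h)]; exact hw13.1 (or_iff_not_imp_left.2 h2)
  · rw [if_neg fun h => ho (toNat_inj.2 h)]; exact fun h => (hw13.2 h.1).elim h2 h3
  · exact fun h => h1 h.2

/-- Once all edges have been inspected, an attracting position joins if it is marked, and any other
position if it is not. -/
theorem mem_attrStep_iff {U W : Finset (Fin n)} {σ : Bool} {v : Fin n} (hv : v ∈ U)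
    (hvW : v ∉ W) :
    v ∈ G.attrStep U σ W ↔
      (G.owner v = σ ∧ v ∈ marks G U σ W L.edges ∨
        G.owner v ≠ σ ∧ v ∉ marks G U σ W L.edges) := by
  simp only [attrStep, marks, Finset.mem_union, Finset.mem_filter, Finset.mem_univ, true_and, hv,
    hvW, false_or, L.mem_edges]
  by_cases ho : G.owner v = σ
  · have : ¬ G.owner v = !σ := by simp [ho]
    simp only [ho, if_true, true_and, ne_eq, not_true_eq_false, false_and, or_false]
    simp [and_comm]
  · have : G.owner v = !σ := Bool.eq_not_of_ne ho
    simp only [ho, if_false, false_and, ne_eq, not_false_eq_true, true_and, false_or]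
    simp only [this, true_and]
    push Not
    exact ⟨fun h w hw hwU => h w hwU hw, fun h w hwU hw => h w hw hwU⟩

/-- The case table behind `updatePosition`: which cell values after the first pass turn into which
values after the second. -/
theorem stVal_attrStep {U W : Finset (Fin n)} (hWU : W ⊆ U) {σ : Bool} (v : Fin n) {x : ℕ}
    (hx : x = stVal U W (marks G U σ W L.edges) v) :
    (v ∈ G.attrStep U σ W → v ∉ W → stVal U (G.attrStep U σ W) ∅ v = 2) ∧
    (G.owner v = σ → (x = 3 ↔ v ∈ G.attrStep U σ W ∧ v ∉ W)) ∧
    (G.owner v ≠ σ → (x = 1 ↔ v ∈ G.attrStep U σ W ∧ v ∉ W)) ∧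
    (G.owner v = σ → x ≠ 3 → x = stVal U (G.attrStep U σ W) ∅ v) ∧
    (G.owner v ≠ σ → x = 3 → stVal U (G.attrStep U σ W) ∅ v = 1) ∧
    (G.owner v ≠ σ → x ≠ 1 → x ≠ 3 → x = stVal U (G.attrStep U σ W) ∅ v) := by
  have hstep := mem_attrStep_iff (G := G) (L := L) (U := U) (W := W) (σ := σ) (v := v)
  have h1 : v ∈ W → v ∈ G.attrStep U σ W := fun h => subset_attrStep W h
  have h2 : v ∈ G.attrStep U σ W → v ∈ U := fun h => attrStep_subset hWU h
  subst hx
  simp only [stVal, Finset.notMem_empty, if_false]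
  clear hWU
  by_cases ho : G.owner v = σ <;> by_cases hW : v ∈ W <;> by_cases hU : v ∈ U <;>
    by_cases hM : v ∈ marks G U σ W L.edges <;> simp_all

theorem updatePosition_spec (hs : Bounded B s) (ht : Tables L p s.mem)
    {ch : ℕ} {v : Fin n} {σ : Bool} (h18 : s.reg 18 = ch) (h15 : s.reg 15 = σ.toNat)
    (h10 : s.reg 10 = v) (hB : ch + n < B) (hpB : p + 4 < B)
    {U W : Finset (Fin n)} (hWU : W ⊆ U)
    (ha : s.mem (ch + v) = stVal U W (marks G U σ W L.edges) v) :
    Ends procs B d Prog.updatePosition s 40 (fun s' =>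
      s'.mem (ch + v) = stVal U (G.attrStep U σ W) ∅ v ∧
      (∀ a, a ≠ ch + v → s'.mem a = s.mem a) ∧
      ((v ∈ G.attrStep U σ W ∧ v ∉ W ∧ s'.reg 14 = 1) ∨
        ((v ∈ G.attrStep U σ W → v ∈ W) ∧ s'.reg 14 = s.reg 14))) := by
  refine Ends.of_wp ?_ (by decide)
  have hle := ht.le
  have hov := ht.owner v
  have hv := v.2
  obtain ⟨e1, e2, e3, e4, e5, e6⟩ := stVal_attrStep hWU v ha
  have hlt := hs.mem_lt (ch + v)
  have hσ : σ.toNat < B := by rw [← h15]; exact hs.reg_lt _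
  have hov' : (G.owner v).toNat < B := by rw [← hov]; exact hs.mem_lt _
  have hne : ∀ (x a : ℕ), ¬ a = ch + v → a = ch + v → x = s.mem a :=
    fun _ _ h h' => absurd h' h
  clear ha
  simp only [Prog.updatePosition, Cmd.wp, Expr.eval, Expr.Fits, Function.update_apply, h10,
    h18, h15]
  simp [hov, hs.one_lt, toNat_inj]
  refine ⟨by omega, by omega, fun ho => ⟨by omega, fun h3 => ⟨by omega, by omega, ?_, hne 2, ?_⟩,
    fun h3 => ⟨e4 ho h3, ?_⟩⟩, fun ho => ⟨by omega, fun h1 => ⟨by omega, by omega, ?_, hne 2, ?_⟩,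
    fun h1 => ⟨by omega, fun h3 => ⟨by omega, (e5 ho h3).symm, hne 1, ?_⟩,
      fun h3 => ⟨e6 ho h1 h3, ?_⟩⟩⟩⟩
  · exact (e1 ((e2 ho).1 h3).1 ((e2 ho).1 h3).2).symm
  · exact Or.inl ((e2 ho).1 h3)
  · exact fun h => Or.inr (by_contra fun h' => h3 ((e2 ho).2 ⟨h, h'⟩))
  · exact (e1 ((e3 ho).1 h1).1 ((e3 ho).1 h1).2).symm
  · exact Or.inl ((e3 ho).1 h1)
  · exact fun h => Or.inr (by_contra fun h' => h1 ((e3 ho).2 ⟨h, h'⟩))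
  · exact fun h => Or.inr (by_contra fun h' => h1 ((e3 ho).2 ⟨h, h'⟩))

/-- Every position has an outgoing edge. Thus passes over positions or colours are absorbed into a
multiple of the number of edges. -/
theorem Listing.le_length_edges (L : G.Listing) : n ≤ L.edges.length := by
  have : (Finset.univ : Finset (Fin n)) ⊆ (L.edges.map Prod.fst).toFinset := by
    intro v _
    obtain ⟨w, hw⟩ := G.exists_edge v
    rw [List.mem_toFinset, List.mem_map]
    exact ⟨(v, w), (L.mem_edges _).2 hw, rfl⟩
  have h1 := Finset.card_le_card this
  have h2 := (L.edges.map Prod.fst).toFinset_card_le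
  simpa using h1.trans h2

theorem attrRound_spec (hs : Bounded B s) (hc : Consts L p s.reg) (ht : Tables L p s.mem)
    {ch : ℕ} {σ : Bool} (h18 : s.reg 18 = ch) (h15 : s.reg 15 = σ.toNat)
    (hp : p + k + 2 ^ k ≤ ch) (hB : ch + n < B) (hpB : p + 4 < B) (hn : 0 < n)
    {U W : Finset (Fin n)} (hWU : W ⊆ U) (ha : ∀ v : Fin n, s.mem (ch + v) = stVal U W ∅ v) :
    Ends procs B d Prog.attrRound s (140 * L.edges.length) (fun s' =>
      (∀ v : Fin n, s'.mem (ch + v) = stVal U (G.attrStep U σ W) ∅ v) ∧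
      (∀ a, a < ch ∨ ch + n ≤ a → s'.mem a = s.mem a) ∧
      (s'.reg 14 = 1 ∧ G.attrStep U σ W ≠ W ∨ s'.reg 14 = 0 ∧ G.attrStep U σ W = W)) := by
  have hnm := L.le_length_edges
  refine Ends.seq (Q' := fun s' => s'.mem = s.mem ∧ s'.reg 14 = 0) (T₁ := 2)
    (T₂ := 138 * L.edges.length) (Ends.of_wp ?_ (by decide)) hs ?_ (by omega)
  · simp [Cmd.wp, Expr.Fits, Expr.eval]; omega
  rintro s₁ hs₁ hk₁ ⟨hm₁, h14⟩
  have hc₁ : Consts L p s₁.reg := hc.of_eq fun i hi => hk₁ i (Cmd.keeps_of_keepsBelow hi rfl)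
  have e18 : s₁.reg 18 = ch := (hk₁ 18 rfl).trans h18
  have e15 : s₁.reg 15 = σ.toNat := (hk₁ 15 rfl).trans h15
  refine Ends.seq (T₁ := 68 * L.edges.length + 6) (T₂ := 48 * n + 6)
    (Q' := fun s' => (∀ v : Fin n, s'.mem (ch + v) = stVal U W (marks G U σ W L.edges) v) ∧
      (∀ a, a < ch ∨ ch + n ≤ a → s'.mem a = s.mem a))
    (Ends.forTo (x := 14) (T₁ := 60) (fun i mem _ =>
      (∀ v : Fin n, mem (ch + v) = stVal U W (marks G U σ W (L.edges.take i)) v) ∧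
      (∀ a, a < ch ∨ ch + n ≤ a → mem a = s.mem a)) hs₁ hc₁.r2 rfl rfl (by decide) (by decide)
      ?_ ?_ ?_ (by omega)) hs₁ ?_ (by omega)
  · rw [hm₁]
    refine ⟨fun v => ?_, fun _ _ => rfl⟩
    rw [ha]
    simp [stVal, marks]
  · rintro i hi s' h10 hs' hk' ⟨h1, h2⟩
    refine (markEdge_spec hs' (hc₁.of_eq fun i hi => hk' i (Cmd.keeps_of_keepsBelow hi rfl)
      (by omega)) (ht.of_eq fun a ha => h2 a (by omega)) ((hk' 18 rfl (by decide)).trans e18)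
      ((hk' 15 rfl (by decide)).trans e15) h10 hi hB hpB h1).mono ?_ le_rfl
    rintro s'' ⟨h3, h4⟩
    exact ⟨h3, fun a ha => (h4 a ha).trans (h2 a ha)⟩
  · rintro s' _ _ ⟨h1, h2⟩
    exact ⟨by simpa using h1, h2⟩
  rintro s₂ hs₂ hk₂ ⟨h1, h2⟩
  have hc₂ : Consts L p s₂.reg := hc₁.of_eq fun i hi => hk₂ i (Cmd.keeps_of_keepsBelow hi rfl)
  refine Ends.forArray (x := 14) (T₁ := 40) (g := stVal U (G.attrStep U σ W) ∅)
    -- Register 14 tells whether one of the first `i` positions is new in the attractor.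
    (fun i y => y = 1 ∧ G.attrStep U σ W ≠ W ∨
      y = 0 ∧ ∀ v : Fin n, (v : ℕ) < i → v ∈ G.attrStep U σ W → v ∈ W)
    hs₂ hc₂.r0 rfl rfl (by decide) (by decide) ?_ h1 ?_ ?_ (by omega)
  · exact Or.inr ⟨(hk₂ 14 rfl).trans h14, by simp⟩
  · rintro v s' h10 hs' hk' hf hm' hJ
    refine (updatePosition_spec hs' (ht.of_eq fun a ha => (hm' a (by omega)).trans (h2 a (by omega)))
      ((hk' 18 rfl (by decide)).trans ((hk₂ 18 rfl).trans e18))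
      ((hk' 15 rfl (by decide)).trans ((hk₂ 15 rfl).trans e15)) h10 hB hpB hWU hf).mono ?_ le_rfl
    rintro s'' ⟨h3, h4, h5⟩
    refine ⟨h3, h4, ?_⟩
    rcases h5 with ⟨h5, h6, h7⟩ | ⟨h5, h7⟩
    · exact Or.inl ⟨h7, fun h => h6 (h ▸ h5)⟩
    · rw [h7]
      refine hJ.imp id fun h => ⟨h.1, fun u hu => ?_⟩
      rcases Nat.lt_succ_iff_lt_or_eq.1 hu with hu | hu
      · exact h.2 u hu
      · rw [Fin.ext hu]; exact h5
  · rintro s' _ _ h3 h4 hJ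
    refine ⟨h3, fun a ha => (h4 a ha).trans (h2 a ha), hJ.imp id fun h => ⟨h.1, ?_⟩⟩
    exact (subset_attrStep W).antisymm' fun v hv => h.2 v v.2 hv

/-- Every round but the last adds a position, so there are at most `(G.attr U σ A).card + 1` rounds.
This crude count suffices, since the attracted positions pay for it later. -/
theorem attractor_spec (hs : Bounded B s) (hc : Consts L p s.reg) (ht : Tables L p s.mem)
    {ch : ℕ} {σ : Bool} (h18 : s.reg 18 = ch) (h15 : s.reg 15 = σ.toNat)
    (hp : p + k + 2 ^ k ≤ ch) (hB : ch + n < B) (hpB : p + 4 < B) (hn : 0 < n)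
    {U A : Finset (Fin n)} (hAU : A ⊆ U) (ha : ∀ v : Fin n, s.mem (ch + v) = stVal U A ∅ v) :
    Ends procs B d Prog.attractor s (150 * L.edges.length * ((G.attr U σ A).card + 1))
      (fun s' => (∀ v : Fin n, s'.mem (ch + v) = stVal U (G.attr U σ A) ∅ v) ∧
        ∀ a, a < ch ∨ ch + n ≤ a → s'.mem a = s.mem a) := by
  have hnm := L.le_length_edges
  -- `j` bounds the number of positions still to be found. For `j = 0` the attractor is complete,
  -- and one more round is spent on noticing this.
  have key : ∀ j i, (G.attr U σ A).card ≤ (G.attrIter U σ A i).card + j → ∀ s', Bounded B s' →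
      Consts L p s'.reg → s'.reg 18 = ch → s'.reg 15 = σ.toNat → s'.reg 14 = 1 →
      (∀ v : Fin n, s'.mem (ch + v) = stVal U (G.attrIter U σ A i) ∅ v) →
      (∀ a, a < ch ∨ ch + n ≤ a → s'.mem a = s.mem a) →
      Ends procs B d (.loop (.reg 14) Prog.attrRound) s'
        ((2 + 140 * L.edges.length) * (j + 1) + 2)
        (fun s' => (∀ v : Fin n, s'.mem (ch + v) = stVal U (G.attr U σ A) ∅ v) ∧
          ∀ a, a < ch ∨ ch + n ≤ a → s'.mem a = s.mem a) := by
    intro j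
    induction j with
    | zero =>
      intro i hi s' hs' hc' e18 e15 e14 h1 h2
      have heq : G.attr U σ A = G.attrIter U σ A i :=
        (Finset.eq_of_subset_of_card_le (attrIter_subset_attr i) hi).symm
      have heq' : G.attrStep U σ (G.attrIter U σ A i) = G.attrIter U σ A i := by
        rw [← heq, attrStep_attr]
      refine Ends.loop_true (T₁ := 140 * L.edges.length) (T₂ := 2) (hs'.reg_lt _)
        (by simp [Expr.eval, e14]) hs' (attrRound_spec hs' hc' (ht.of_eq fun a ha => h2 a (by omega))
          e18 e15 hp hB hpB hn (attrIter_subset i) h1) ?_ (by simp only [Expr.cost]; omega)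
      rintro s'' hs'' - ⟨h3, h4, h5⟩
      rcases h5 with ⟨-, h5⟩ | ⟨h5, -⟩
      · exact absurd heq' h5
      · refine Ends.loop_false (hs''.reg_lt _) (by simp [Expr.eval, h5]) ⟨?_, ?_⟩ (by decide)
        · rw [heq, ← heq']; rw [heq'] at h3 ⊢; exact h3
        · exact fun a ha => (h4 a ha).trans (h2 a ha)
    | succ j ih =>
      intro i hi s' hs' hc' e18 e15 e14 h1 h2
      refine Ends.loop_true (T₁ := 140 * L.edges.length)
        (T₂ := (2 + 140 * L.edges.length) * (j + 1) + 2) (hs'.reg_lt _)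
        (by simp [Expr.eval, e14]) hs' (attrRound_spec hs' hc' (ht.of_eq fun a ha => h2 a (by omega))
          e18 e15 hp hB hpB hn (attrIter_subset i) h1) ?_
        (by simp only [Expr.cost]; rw [Nat.mul_succ _ (j + 1)]; omega)
      rintro s'' hs'' hk'' ⟨h3, h4, h5⟩
      rcases h5 with ⟨h5, h6⟩ | ⟨h5, h6⟩
      · refine ih (i + 1) ?_ s'' hs'' (hc'.of_eq fun i hi => hk'' i
          (Cmd.keeps_of_keepsBelow hi rfl)) ((hk'' 18 rfl).trans e18) ((hk'' 15 rfl).trans e15) h5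
          h3 fun a ha => (h4 a ha).trans (h2 a ha)
        have := Finset.card_lt_card ((subset_attrStep (G := G) (U := U) (σ := σ)
          (G.attrIter U σ A i)).ssubset_of_ne h6.symm)
        rw [attrIter_succ]
        omega
      · refine Ends.loop_false (hs''.reg_lt _) (by simp [Expr.eval, h5]) ⟨?_, ?_⟩
          (by simp only [Expr.cost]; omega)
        · rw [attr_eq_of_attrStep_eq h6]; rw [h6] at h3; exact h3
        · exact fun a ha => (h4 a ha).trans (h2 a ha)
  refine Ends.seq (Q' := fun s' => s'.mem = s.mem ∧ s'.reg 14 = 1) (T₁ := 2)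
    (T₂ := (2 + 140 * L.edges.length) * ((G.attr U σ A).card + 1) + 2)
    (Ends.of_wp ?_ (by decide)) hs ?_ (by nlinarith)
  · simp [Cmd.wp, Expr.Fits, Expr.eval]; omega
  rintro s₁ hs₁ hk₁ ⟨hm₁, h14⟩
  refine key _ 0 (by omega) s₁ hs₁ (hc.of_eq fun i hi => hk₁ i (Cmd.keeps_of_keepsBelow hi rfl))
    ((hk₁ 18 rfl).trans h18) ((hk₁ 15 rfl).trans h15) h14 ?_ (fun a _ => by rw [hm₁])
  rw [hm₁]
  simpa [attrIter, Finset.inter_eq_left.2 hAU] using ha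

end CMG

/-! ### Occurring colours and the favoured player -/

namespace CMG

open RAM

variable {n k : ℕ} {G : CMG (Fin n) (Fin k)} {L : G.Listing} {p B d : ℕ} {procs : List Cmd}
  {s : State}

/-- The cells in a frame at the address `a₀` that store, for the arena `U`, the occurring colours,
the number of the next colour to be treated, and the favoured player. -/
structure LoopCells (G : CMG (Fin n) (Fin k)) (a₀ : ℕ) (U : Finset (Fin n)) (j : ℕ)
    (mem : ℕ → ℕ) : Prop where
  occurs : ∀ c : Fin k, mem (a₀ + n + c) = if c ∈ U.image G.color then 1 else 0
  next : mem (a₀ + 2 * n) = j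
  fav : mem (a₀ + 1 + 2 * n) = (G.favoured U).toNat

theorem mask_insert {S : Finset (Fin k)} {c : Fin k} (h : c ∉ S) :
    mask (insert c S) = mask S + 2 ^ (c : ℕ) := by
  rw [mask, Finset.sum_insert h, add_comm]; rfl

/-- The weight of a colour is added only when the colour is met for the first time, so the sum
remains the mask of a set. -/
theorem addColor_spec (hs : Bounded B s) (hc : Consts L p s.reg) (ht : Tables L p s.mem)
    {a₀ : ℕ} (h9 : s.reg 9 = a₀) {v : Fin n} (h10 : s.reg 10 = v) {x : ℕ}
    (hx : s.mem (a₀ + v) = x) {S : Finset (Fin k)} (h16 : s.reg 16 = mask S)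
    (hS : ∀ c : Fin k, s.mem (a₀ + n + c) = if c ∈ S then 1 else 0)
    (hp : p + k + 2 ^ k ≤ a₀)
    (hB : a₀ + 2 * n + 2 < B) (hkn : k ≤ n) :
    Ends procs B d Prog.addColor s 40 (fun s' =>
      s'.reg 16 = mask (if x = 1 then insert (G.color v) S else S) ∧
      (∀ c : Fin k, s'.mem (a₀ + n + c)
        = if c ∈ (if x = 1 then insert (G.color v) S else S) then 1 else 0) ∧
      ∀ a, a < a₀ + n ∨ a₀ + n + k ≤ a → s'.mem a = s.mem a) := by
  refine Ends.of_wp ?_ (by decide)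
  have hle := ht.le
  have hcv := ht.color v
  have hwt := ht.weight (G.color v)
  have hSv := hS (G.color v)
  have hv := v.2
  have hcl := (G.color v).2
  have hxB : x < B := hx ▸ hs.mem_lt _
  have hmk := mask_lt S
  have hpw : 2 ^ (G.color v : ℕ) < B := hwt ▸ hs.mem_lt _
  simp only [Prog.addColor, Cmd.wp, Expr.eval, Expr.Fits, Function.update_apply, h9, h10, h16,
    hc.r0, hc.r3, hc.r5, hx]
  simp [hcv, hSv, hwt, hs.one_lt]
  refine ⟨by omega, ?_, ?_⟩
  · intro h1
    simp only [h1, if_true]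
    refine ⟨by omega, ⟨by omega, by split_ifs <;> omega⟩, ?_, ?_⟩
    · intro hin
      rw [Finset.insert_eq_of_mem hin]
      simpa using hS
    · intro hin
      have hmk' := mask_lt (insert (G.color v) S)
      rw [mask_insert hin] at hmk' ⊢
      rw [if_neg (by omega)]
      refine ⟨by omega, by omega, rfl, fun c => ?_, fun a ha h => by omega⟩
      simp only [Fin.val_inj, Finset.mem_insert, hS]
      by_cases hcc : c = G.color v <;> simp [hcc]
  · intro h1
    simp only [h1, if_false]
    simpa using hS

/-- Only cells with the value `1` count as the arena. Hence the same command serves at the beginning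
of a call and, once `X` has been recorded as decided, for the restart on `U \ X`. -/
theorem setup_spec (hs : Bounded B s) (hc : Consts L p s.reg) (ht : Tables L p s.mem)
    {a₀ : ℕ} (h9 : s.reg 9 = a₀) {D : Fin n → ℕ} (hD : ∀ v : Fin n, s.mem (a₀ + v) = D v)
    {U : Finset (Fin n)} (hU : ∀ v, D v = 1 ↔ v ∈ U)
    (hp : p + k + 2 ^ k ≤ a₀) (hB : a₀ + 2 * n + 2 < B) (hkn : k ≤ n) (hn : 0 < n) :
    Ends procs B d Prog.setup s (110 * L.edges.length) (fun s' =>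
      LoopCells G a₀ U 0 s'.mem ∧
        ∀ a, a < a₀ + n ∨ a₀ + 2 * n + 2 ≤ a → s'.mem a = s.mem a) := by
  have hnm := L.le_length_edges
  refine Ends.seq (T₁ := 16 * k + 6) (T₂ := 48 * n + 40)
    (Q' := fun s' => (∀ c : Fin k, s'.mem (a₀ + n + c) = 0) ∧
      ∀ a, a < a₀ + n ∨ a₀ + n + k ≤ a → s'.mem a = s.mem a)
    (Ends.forArray (x := 14) (T₁ := 8) (fun _ _ => True) hs hc.r1 rfl rfl (by decide) (by decide)
      trivial (f := fun c : Fin k => s.mem (a₀ + n + c)) (g := fun _ => 0) (fun _ => rfl) ?_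
      (fun s' _ _ h h' _ => ⟨h, h'⟩) (by omega)) hs ?_ (by omega)
  · rintro c s' h10 hs' hk' - - -
    refine Ends.of_wp ?_ (by decide)
    have e9 : s'.reg 9 = a₀ := (hk' 9 rfl (by decide)).trans h9
    have e0 : s'.reg 0 = n := (hk' 0 rfl (by decide)).trans hc.r0
    have := c.2
    simp [Cmd.wp, Expr.Fits, Expr.eval, Function.update_apply, h10, e9, e0]
    exact ⟨by omega, by omega, fun a h h' => absurd h' h⟩
  rintro s₁ hs₁ hk₁ ⟨hz₁, hm₁⟩
  have hc₁ : Consts L p s₁.reg := hc.of_eq fun i hi => hk₁ i (Cmd.keeps_of_keepsBelow hi rfl)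
  have e9 : s₁.reg 9 = a₀ := (hk₁ 9 rfl).trans h9
  refine Ends.seq (T₁ := 2) (T₂ := 48 * n + 38) (Q' := fun s' => s'.mem = s₁.mem ∧ s'.reg 16 = 0)
    (Ends.of_wp (by simp [Cmd.wp, Expr.Fits, Expr.eval]; omega) (by decide)) hs₁ ?_ (by omega)
  rintro s₂ hs₂ hk₂ ⟨hm₂, h16⟩
  have hc₂ : Consts L p s₂.reg := hc₁.of_eq fun i hi => hk₂ i (Cmd.keeps_of_keepsBelow hi rfl)
  have e9 : s₂.reg 9 = a₀ := (hk₂ 9 rfl).trans e9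
  have hstep : ∀ (i : ℕ) (hi : i < n), {v ∈ U | v.val < i + 1}.image G.color =
      if D ⟨i, hi⟩ = 1 then insert (G.color ⟨i, hi⟩) ({v ∈ U | v.val < i}.image G.color)
      else {v ∈ U | v.val < i}.image G.color := by
    intro i hi
    have : {v ∈ U | v.val < i + 1} = if D ⟨i, hi⟩ = 1 then
        insert ⟨i, hi⟩ {v ∈ U | v.val < i} else {v ∈ U | v.val < i} := by
      ext v
      by_cases hv : v = ⟨i, hi⟩
      · subst hv; simp only [hU]; split_ifs with h <;> simp [h]
      · have : (v : ℕ) ≠ i := fun h => hv (Fin.ext h)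
        have : v.val ≤ i ↔ v.val < i := by omega
        split_ifs <;> simp [hv, this]
    rw [this]
    split_ifs
    · rw [Finset.image_insert]
    · rfl
  refine Ends.seq (T₁ := 48 * n + 6) (T₂ := 32)
    (Q' := fun s' => s'.reg 16 = mask (U.image G.color) ∧
      (∀ c : Fin k, s'.mem (a₀ + n + c) = if c ∈ U.image G.color then 1 else 0) ∧
      ∀ a, a < a₀ + n ∨ a₀ + n + k ≤ a → s'.mem a = s.mem a)
    (Ends.forTo (x := 16) (T₁ := 40) (fun i mem y =>
      y = mask ({v ∈ U | v.val < i}.image G.color) ∧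
      (∀ c : Fin k, mem (a₀ + n + c)
        = if c ∈ {v ∈ U | v.val < i}.image G.color then 1 else 0) ∧
      ∀ a, a < a₀ + n ∨ a₀ + n + k ≤ a → mem a = s.mem a) hs₂ hc₂.r0 rfl rfl (by decide)
      (by decide) ?_ ?_ ?_ (by omega)) hs₂ ?_ (by omega)
  · rw [hm₂]
    refine ⟨by rw [h16]; simp [mask], fun c => by simp [hz₁], hm₁⟩
  · rintro i hi s' h10 hs' hk' ⟨h1, h2, h3⟩
    refine (addColor_spec hs' (hc₂.of_eq fun i hi => hk' i (Cmd.keeps_of_keepsBelow hi rfl)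
      (by omega)) (ht.of_eq fun a ha => h3 a (by omega)) ((hk' 9 rfl (by decide)).trans e9)
      (v := ⟨i, hi⟩) h10 ((h3 _ (by simp; omega)).trans (hD ⟨i, hi⟩)) h1 h2 hp hB hkn).mono ?_
      le_rfl
    rintro s'' ⟨h4, h5, h6⟩
    rw [hstep i hi]
    exact ⟨h4, h5, fun a ha => (h6 a ha).trans (h3 a ha)⟩
  · rintro s' - - ⟨h1, h2, h3⟩
    have : {v ∈ U | v.val < n} = U := Finset.filter_true_of_mem fun v _ => v.2
    rw [this] at h1 h2
    exact ⟨h1, h2, h3⟩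
  rintro s₃ hs₃ hk₃ ⟨h16, hpr, hm₃⟩
  have hc₃ : Consts L p s₃.reg := hc₂.of_eq fun i hi => hk₃ i (Cmd.keeps_of_keepsBelow hi rfl)
  have e9 : s₃.reg 9 = a₀ := (hk₃ 9 rfl).trans e9
  refine Ends.of_wp ?_ (by decide)
  have hle := ht.le
  have hmk := mask_lt (U.image G.color)
  have hfav := (ht.of_eq (m' := s₃.mem) fun a ha => hm₃ a (by omega)).fav (U.image G.color)
  have h2k : 0 < 2 ^ k := Nat.two_pow_pos k
  simp only [Cmd.wp, Expr.Fits, Expr.eval, e9, hc₃.r7, hc₃.r6, h16]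
  refine ⟨by omega, by omega, by omega, ⟨by omega, by omega, ?_⟩, ⟨fun c => ?_, ?_, ?_⟩, ?_⟩
  · rw [Function.update_of_ne (by omega), hfav]
    split_ifs <;> omega
  · have := c.2
    rw [Function.update_of_ne (by omega), Function.update_of_ne (by omega), hpr]
  · rw [Function.update_of_ne (by omega), Function.update_self]
  · rw [Function.update_self, Function.update_of_ne (by omega), hfav]
    unfold favoured
    split_ifs <;> rfl
  · intro a ha
    rw [Function.update_of_ne (by omega), Function.update_of_ne (by omega), hm₃ a (by omega)]

end CMG

/-! ### Time accounting, and the treatment of a colour up to its test -/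

namespace CMG

open RAM

/-- The term `n - n'` stands for an attractor computation that removes `n - n'` positions. Apart
from the first one, each removed position lowers the factor `n'` below `n - 1`, which saves more
than the unit it costs. -/
theorem units_le {n n' κ' j : ℕ} (hn : n' < n) (hκ : κ' ≤ j) (hj : j ≤ n - 1) :
    (n - n') + 8 * n' * n'.descFactorial κ' + 1
      ≤ 8 * (n - 1) * (n - 1).descFactorial j + 2 := by
  have h1 : n'.descFactorial κ' ≤ (n - 1).descFactorial j :=
    Nat.descFactorial_mono (by omega) hκ hj
  have h2 : 0 < (n - 1).descFactorial j := Nat.descFactorial_pos.2 hj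
  obtain ⟨a, rfl⟩ : ∃ a, n = n' + 1 + a := ⟨n - (n' + 1), by omega⟩
  have e : n' + 1 + a - 1 = n' + a := by omega
  rw [e] at h1 h2 ⊢
  set E := (n' + a).descFactorial j
  have h3 := Nat.mul_le_mul_left (8 * n') h1
  have : n' + 1 + a - n' = a + 1 := by omega
  rw [this]
  nlinarith

/-- Units of time of the loop over the colours, when `r` occurring colours are still to be treated,
for a set of `n` positions with `κ` colours. -/
def loopUnits (n κ r : ℕ) : ℕ :=
  if n = 0 then 0
  else r * (8 * (n - 1) * (n - 1).descFactorial (κ - 1) + 2)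
    + (8 * (n - 1) * (n - 1).descFactorial (min κ (n - 1)) + 2)

theorem loopUnits_le {n κ : ℕ} (h : n ≠ 0 → 1 ≤ κ) (hκ : κ ≤ n) :
    loopUnits n κ κ ≤ 8 * n * n.descFactorial κ := by
  unfold loopUnits
  split_ifs with h0
  · exact Nat.zero_le _
  obtain ⟨m, rfl⟩ : ∃ m, n = m + 1 := ⟨n - 1, by omega⟩
  obtain ⟨j, rfl⟩ : ∃ j, κ = j + 1 := ⟨κ - 1, by have := h h0; omega⟩
  simp only [Nat.add_sub_cancel]
  have hD : 0 < m.descFactorial j := Nat.descFactorial_pos.2 (by omega)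
  rcases Nat.lt_or_ge j m with hj | hj
  · rw [min_eq_left (by omega), Nat.succ_descFactorial_succ_eq_add (by omega)]
    have hE : 0 < m.descFactorial (j + 1) := Nat.descFactorial_pos.2 (by omega)
    nlinarith
  -- When all positions have different colours, the min in `loopUnits` is active, and `m ≤
  -- m.factorial` absorbs the linear terms.
  · obtain rfl : m = j := by omega
    rw [min_eq_right (by omega), Nat.succ_descFactorial_succ, Nat.descFactorial_self]
    have h1 := Nat.self_le_factorial m
    have h2 := Nat.factorial_pos m
    nlinarith

variable {n k : ℕ} {G : CMG (Fin n) (Fin k)} {L : G.Listing} {p B d : ℕ} {procs : List Cmd}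
  {s : State} {U : Finset (Fin n)}

open Classical in
/-- The winner of the game restricted to `U`, as a number. -/
noncomputable def winVal (G : CMG (Fin n) (Fin k)) (U : Finset (Fin n)) (v : Fin n) : ℕ :=
  if G.Wins U true v then 1 else 0

theorem winVal_eq_iff (hU : G.SubArena U) {v : Fin n} (hv : v ∈ U) (σ : Bool) :
    winVal G U v = σ.toNat ↔ G.Wins U σ v := by
  have := wins_not_iff hU hv true
  unfold winVal
  cases σ
  · simp only [Bool.not_true] at this
    rw [this]; split_ifs <;> simp_all
  · split_ifs <;> simp_all

/-- A state during the loop over the colours. The frame of the arena `U` is at the address `a₀`,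
and `j` is the next colour to be treated. -/
structure AtLoop (L : G.Listing) (p B a₀ : ℕ) (D : Fin n → ℕ) (U : Finset (Fin n)) (j : ℕ)
    (s : State) : Prop where
  bounded : Bounded B s
  consts : Consts L p s.reg
  tables : Tables L p s.mem
  r9 : s.reg 9 = a₀
  arr : ∀ v : Fin n, s.mem (a₀ + v) = D v
  eq_one : ∀ v, D v = 1 ↔ v ∈ U
  cells : LoopCells G a₀ U j s.mem

/-- The command `c` solves the game restricted to `U` within `T` steps. -/
def SolvesIn (procs : List Cmd) (B d : ℕ) (L : G.Listing) (p : ℕ) (c : Cmd) (U : Finset (Fin n))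
    (T : ℕ) : Prop :=
  ∀ (s : State) (a₀ : ℕ) (D : Fin n → ℕ), Bounded B s → Consts L p s.reg → Tables L p s.mem →
    s.reg 9 = a₀ → p + k + 2 ^ k ≤ a₀ →
    a₀ + ((U.image G.color).card + 1) * (2 * n + 2) < B →
    (∀ v : Fin n, s.mem (a₀ + v) = D v) → (∀ v, D v = 1 ↔ v ∈ U) →
    Ends procs B d c s T (fun s' => s'.reg 9 = a₀ ∧ Consts L p s'.reg ∧
      (∀ v : Fin n, s'.mem (a₀ + v) = if v ∈ U then 2 + winVal G U v else D v) ∧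
      ∀ a < a₀, s'.mem a = s.mem a)

theorem nextColor_spec {a₀ j : ℕ} {D : Fin n → ℕ} (h : AtLoop L p B a₀ D U j s)
    (hp : p + k + 2 ^ k ≤ a₀) (hB : a₀ + 2 * n + 2 < B) (hjB : j + 1 < B) (hkn : k ≤ n) :
    Ends procs B d Prog.nextColor s 12 (fun s' => AtLoop L p B a₀ D U (j + 1) s' ∧
      ∀ a < a₀, s'.mem a = s.mem a) := by
  refine Ends.frame (Q := fun s' => s'.mem (a₀ + 2 * n) = j + 1 ∧
    ∀ a, a ≠ a₀ + 2 * n → s'.mem a = s.mem a) (Ends.of_wp ?_ le_rfl) h.bounded ?_ (by decide)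
  · have := h.cells.next
    have := hB
    simp only [Prog.nextColor, Cmd.wp, Expr.Fits, Expr.eval, h.r9, h.consts.r7, h.cells.next]
    exact ⟨by omega, by omega, by simp, fun a ha => Function.update_of_ne ha _ _⟩
  · rintro s' hs' hk' ⟨h1, h2⟩
    have hlt : ∀ a < a₀, s'.mem a = s.mem a := fun a ha => h2 a (by omega)
    refine ⟨⟨hs', h.consts.of_eq fun i hi => hk' i (Cmd.keeps_of_keepsBelow hi rfl),
      h.tables.of_eq fun a ha => hlt a (by omega), (hk' 9 rfl).trans h.r9, fun v => ?_, h.eq_one,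
      ⟨fun c => ?_, h1, ?_⟩⟩, hlt⟩
    · rw [h2 _ (by omega), h.arr]
    · rw [h2 _ (by omega), h.cells.occurs]
    · rw [h2 _ (by omega), h.cells.fav]

open Classical in
/-- The positions that the opponent of the favoured player wins when he avoids the colour `c`. -/
noncomputable def lost (G : CMG (Fin n) (Fin k)) (U : Finset (Fin n)) (c : Fin k) :
    Finset (Fin n) :=
  {v ∈ G.avoid U c | G.Wins (G.avoid U c) (!G.favoured U) v}

theorem mem_lost {c : Fin k} {v : Fin n} :
    v ∈ lost G U c ↔ v ∈ G.avoid U c ∧ G.Wins (G.avoid U c) (!G.favoured U) v := by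
  classical
  simp [lost]

theorem lost_subset {c : Fin k} : lost G U c ⊆ U :=
  fun _ hv => avoid_subset c (mem_lost.1 hv).1

theorem target_spec {a₀ ch : ℕ} {D : Fin n → ℕ} (hs : Bounded B s) (hc : Consts L p s.reg)
    (ht : Tables L p s.mem) (h9 : s.reg 9 = a₀) (h18 : s.reg 18 = ch)
    (hD : ∀ v : Fin n, s.mem (a₀ + v) = D v) (hU : ∀ v, D v = 1 ↔ v ∈ U) {c : Fin k}
    (h17 : s.reg 17 = c) (hp : p + k + 2 ^ k ≤ a₀) (hch : a₀ + n ≤ ch) (hB : ch + n + 2 < B) :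
    Ends procs B d (.forTo 10 0 Prog.targetColor) s (30 * n + 6) (fun s' =>
      (∀ v : Fin n, s'.mem (ch + v) = stVal U {v ∈ U | G.color v = c} ∅ v) ∧
      ∀ a, a < ch ∨ ch + n ≤ a → s'.mem a = s.mem a) := by
  refine Ends.forArray (x := 14) (T₁ := 22) (fun _ _ => True) hs hc.r0 rfl rfl (by decide)
    (by decide) trivial (f := fun v : Fin n => s.mem (ch + v)) (fun _ => rfl) ?_
    (fun s' _ _ h h' _ => ⟨h, h'⟩) (by omega)
  rintro v s' h10 hs' hk' - hm' -
  have hv := v.2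
  have hle := ht.le
  have h2k := Nat.two_pow_pos k
  have e9 : s'.reg 9 = a₀ := (hk' 9 rfl (by decide)).trans h9
  have e18 : s'.reg 18 = ch := (hk' 18 rfl (by decide)).trans h18
  have e17 : s'.reg 17 = c := (hk' 17 rfl (by decide)).trans h17
  have e3 : s'.reg 3 = 3 + n := (hk' 3 rfl (by decide)).trans hc.r3
  have hDv : s'.mem (a₀ + v) = D v := (hm' _ (by omega)).trans (hD v)
  have hcv : s'.mem (3 + n + v) = G.color v := (hm' _ (by omega)).trans (ht.color v)
  have hDB : D v < B := hDv ▸ hs'.mem_lt _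
  have hcB : (G.color v : ℕ) < B := hcv ▸ hs'.mem_lt _
  have hcB' : (c : ℕ) < B := e17 ▸ hs'.reg_lt _
  refine Ends.of_wp ?_ (by decide)
  simp only [Prog.targetColor, Cmd.wp, Expr.Fits, Expr.eval, e9, e18, e17, e3, h10, hDv, hcv,
    Function.update_apply]
  simp [hs.one_lt, hU]
  refine ⟨by omega, fun h => ⟨by omega, ⟨by omega, by split_ifs <;> omega⟩, ?_, ?_⟩,
    fun h => ⟨by omega, by omega, ?_, ?_⟩⟩
  · simp only [stVal, Finset.mem_filter, Finset.notMem_empty, h, true_and, Fin.val_inj]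
    split_ifs <;> simp_all
  · exact fun a h h' => absurd h' h
  · simp [stVal, h]
  · exact fun a h h' => absurd h' h

theorem removeAttr_spec {ch : ℕ} {A : Finset (Fin n)} (hs : Bounded B s) (hc : Consts L p s.reg)
    (h18 : s.reg 18 = ch) (ha : ∀ v : Fin n, s.mem (ch + v) = stVal U A ∅ v)
    (hB : ch + n + 2 < B) :
    Ends procs B d (.forTo 10 0 Prog.removeAttr) s (30 * n + 6) (fun s' =>
      (∀ v : Fin n, s'.mem (ch + v) = if v ∈ U \ A then 1 else 0) ∧
      ∀ a, a < ch ∨ ch + n ≤ a → s'.mem a = s.mem a) := by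
  refine Ends.forArray (x := 14) (T₁ := 22) (fun _ _ => True) hs hc.r0 rfl rfl (by decide)
    (by decide) trivial ha ?_ (fun s' _ _ h h' _ => ⟨h, h'⟩) (by omega)
  rintro v s' h10 hs' hk' hf - -
  have hv := v.2
  have e18 : s'.reg 18 = ch := (hk' 18 rfl (by decide)).trans h18
  have hDB := hf ▸ hs'.mem_lt _
  refine Ends.of_wp ?_ (by decide)
  simp only [Prog.removeAttr, Cmd.wp, Expr.Fits, Expr.eval, e18, h10, hf, Function.update_apply]
  simp [hs.one_lt]
  refine ⟨by omega, fun h => ⟨by omega, by omega, ?_, ?_⟩, fun h => ?_⟩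
  · simp only [stVal, Finset.notMem_empty, if_false] at h
    split_ifs at h ⊢ <;> simp_all
  · exact fun a h h' => absurd h' h
  · simp only [stVal, Finset.notMem_empty, if_false] at h ⊢
    split_ifs at h ⊢ <;> simp_all

/-- On the solved part a cell holds `2` plus the winner. Adding the favoured player gives `3`
exactly when the winner is his opponent, and cells with `0` never reach `3`. -/
theorem targetLost_spec (hUa : G.SubArena U) {a₀ ch : ℕ} {D : Fin n → ℕ} (hs : Bounded B s)
    (hc : Consts L p s.reg)
    (h9 : s.reg 9 = a₀) (h18 : s.reg 18 = ch) (h15 : s.reg 15 = (G.favoured U).toNat)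
    (h14 : s.reg 14 = 0)
    (hD : ∀ v : Fin n, s.mem (a₀ + v) = D v) (hU : ∀ v, D v = 1 ↔ v ∈ U) {c : Fin k}
    (ha : ∀ v : Fin n, s.mem (ch + v)
      = if v ∈ G.avoid U c then 2 + winVal G (G.avoid U c) v else 0)
    (hch : a₀ + n ≤ ch) (hB : ch + n < B) (hB4 : 4 < B) :
    Ends procs B d (.forTo 10 0 Prog.targetLost) s (40 * n + 6) (fun s' =>
      (∀ v : Fin n, s'.mem (ch + v) = stVal U (lost G U c) ∅ v) ∧
      (∀ a, a < ch ∨ ch + n ≤ a → s'.mem a = s.mem a) ∧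
      (s'.reg 14 = 1 ∧ (lost G U c).Nonempty ∨ s'.reg 14 = 0 ∧ lost G U c = ∅)) := by
  refine Ends.forArray (x := 14) (T₁ := 32) (g := stVal U (lost G U c) ∅)
    (fun i y => y = 1 ∧ (lost G U c).Nonempty ∨
      y = 0 ∧ ∀ v : Fin n, v.val < i → v ∉ lost G U c) hs hc.r0 rfl rfl (by decide)
    (by decide) (Or.inr ⟨h14, by simp⟩) ha ?_
    (fun s' _ _ h h' hJ => ⟨h, h', hJ.imp id fun h => ⟨h.1, ?_⟩⟩) (by omega)
  swap
  · exact Finset.eq_empty_of_forall_notMem fun v => h.2 v v.2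
  rintro v s' h10 hs' hk' hf hm' hJ
  have hv := v.2
  have e9 : s'.reg 9 = a₀ := (hk' 9 rfl (by decide)).trans h9
  have e18 : s'.reg 18 = ch := (hk' 18 rfl (by decide)).trans h18
  have e15 : s'.reg 15 = (G.favoured U).toNat := (hk' 15 rfl (by decide)).trans h15
  have hDv : s'.mem (a₀ + v) = D v := (hm' _ (by omega)).trans (hD v)
  have hDB : D v < B := hDv ▸ hs'.mem_lt _
  have hxB := hf ▸ hs'.mem_lt (ch + v)
  have hσ : (G.favoured U).toNat ≤ 1 := Bool.toNat_le _
  have hw1 : winVal G (G.avoid U c) v ≤ 1 := by unfold winVal; split_ifs <;> omega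
  have hlost : v ∈ lost G U c ↔
      (if v ∈ G.avoid U c then 2 + winVal G (G.avoid U c) v else 0) + (G.favoured U).toNat = 3 := by
    rw [mem_lost]
    by_cases hvS : v ∈ G.avoid U c
    · rw [← winVal_eq_iff (hUa.avoid c) hvS]
      simp only [hvS, true_and, if_true]
      cases G.favoured U <;> simp <;> omega
    · simp only [hvS, false_and, if_false, false_iff]; omega
  have hlU : v ∈ lost G U c → v ∈ U := fun h => lost_subset h
  have hJs : v ∉ lost G U c → (s'.reg 14 = 1 ∧ (lost G U c).Nonempty ∨
      s'.reg 14 = 0 ∧ ∀ u ≤ v, u ∉ lost G U c) := fun h =>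
    hJ.imp id fun h' => ⟨h'.1, fun u hu => by
      rcases hu.lt_or_eq with hu | hu
      · exact h'.2 u hu
      · rw [hu]; exact h⟩
  refine Ends.of_wp ?_ (by decide)
  simp only [Prog.targetLost, Cmd.wp, Expr.Fits, Expr.eval, e9, e18, e15, h10, hDv, hf,
    Function.update_apply]
  have hx : (if v ∈ G.avoid U c then 2 + winVal G (G.avoid U c) v else 0) ≤ 3 := by
    split_ifs <;> omega
  generalize (if v ∈ G.avoid U c then 2 + winVal G (G.avoid U c) v else 0) = x at *
  simp [hs.one_lt, hU]
  refine ⟨by omega, fun h => ⟨by omega, fun h3 => ⟨by omega, by omega, ?_, ?_, ?_⟩,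
    fun h3 => ⟨by omega, ?_, ?_, ?_⟩⟩, fun h => ⟨by omega, by omega, ?_, ?_, ?_⟩⟩
  · simp [stVal, hlost.2 h3]
  · exact fun a h h' => absurd h' h
  · exact ⟨v, hlost.2 h3⟩
  · simp [stVal, mt hlost.1 h3, h]
  · exact fun a h h' => absurd h' h
  · exact hJs (mt hlost.1 h3)
  · simp [stVal, mt hlU h, h]
  · exact fun a h h' => absurd h' h
  · exact hJs (mt hlU h)

theorem AtLoop.of_eq {a₀ j : ℕ} {D : Fin n → ℕ} (h : AtLoop L p B a₀ D U j s) {s' : State}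
    (hs' : Bounded B s') (hc : Consts L p s'.reg) (h9 : s'.reg 9 = a₀)
    (hp : p + k + 2 ^ k ≤ a₀) (hkn : k ≤ n) (hm : ∀ a < a₀ + (2 * n + 2), s'.mem a = s.mem a) :
    AtLoop L p B a₀ D U j s' := by
  refine ⟨hs', hc, h.tables.of_eq fun a ha => hm a (by omega), h9, fun v => ?_, h.eq_one,
    ⟨fun c => ?_, ?_, ?_⟩⟩
  · rw [hm _ (by omega), h.arr]
  · rw [hm _ (by omega), h.cells.occurs]
  · rw [hm _ (by omega), h.cells.next]
  · rw [hm _ (by omega), h.cells.fav]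

theorem Consts.of_ne {r r' : ℕ → ℕ} (h : Consts L p r) {i : ℕ} (hi : 9 ≤ i)
    (he : ∀ j, j ≠ i → r' j = r j) : Consts L p r' :=
  h.of_eq fun j hj => he j (by omega)

/-- The attractor to the colour, the recursive call in the next frame, and the evaluation of its
answer. The size of the attractor equals the number of positions that the callee loses, which is the
form needed for `units_le`. -/
theorem callAvoid_spec (hUa : G.SubArena U) {a₀ j Tc : ℕ} {D : Fin n → ℕ} {c : Fin k}
    (h : AtLoop L p B a₀ D U j s) (hcU : c ∈ U.image G.color) (h17 : s.reg 17 = c)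
    (hcall : SolvesIn procs B d L p (.call 0) (G.avoid U c) Tc)
    (hp : p + k + 2 ^ k ≤ a₀) (hB : a₀ + ((U.image G.color).card + 1) * (2 * n + 2) < B)
    (hn : 0 < n) (hkn : k ≤ n) :
    Ends procs B d Prog.callAvoid s
      (150 * L.edges.length * ((U.card - (G.avoid U c).card) + 1) + 200 * L.edges.length + Tc)
      (fun s' => AtLoop L p B a₀ D U j s' ∧ s'.reg 15 = (G.favoured U).toNat ∧
        s'.reg 18 = a₀ + (2 * n + 2) ∧
        (∀ v : Fin n, s'.mem (a₀ + (2 * n + 2) + v) = stVal U (lost G U c) ∅ v) ∧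
        (∀ a < a₀, s'.mem a = s.mem a) ∧
        (s'.reg 14 = 1 ∧ (lost G U c).Nonempty ∨ s'.reg 14 = 0 ∧ lost G U c = ∅)) := by
  have hnm := L.le_length_edges
  have hκ : 1 ≤ (U.image G.color).card := Finset.card_pos.2 ⟨c, hcU⟩
  have hκ' := card_image_avoid_le hcU
  set κ := (U.image G.color).card
  have hB2 : a₀ + (2 * n + 2) + (2 * n + 2) < B := by nlinarith
  -- The callee starts one frame higher but has at least one colour less, so it fits into the same
  -- memory.
  have hB3 : a₀ + (2 * n + 2) + (((G.avoid U c).image G.color).card + 1) * (2 * n + 2) < B := by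
    have := Nat.mul_le_mul_right (2 * n + 2) (show ((G.avoid U c).image G.color).card + 2 ≤ κ + 1
      by omega)
    rw [show ((G.avoid U c).image G.color).card + 2
      = (((G.avoid U c).image G.color).card + 1) + 1 from rfl, Nat.succ_mul] at this
    omega
  have h2k := Nat.two_pow_pos k
  have hle := h.tables.le
  have hfB : (G.favoured U).toNat < B := h.cells.fav ▸ h.bounded.mem_lt _
  have hcardA : (G.attr U (G.favoured U) {v ∈ U | G.color v = c}).card
      = U.card - (G.avoid U c).card := by
    have h1 := Finset.card_sdiff_of_subset
      (attr_subset (G := G) (U := U) (σ := G.favoured U) (T := {v ∈ U | G.color v = c}))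
    have h2 := Finset.card_le_card
      (attr_subset (G := G) (U := U) (σ := G.favoured U) (T := {v ∈ U | G.color v = c}))
    rw [avoid, h1]; omega
  rw [← hcardA]
  set A := G.attr U (G.favoured U) {v ∈ U | G.color v = c} with hA
  refine Ends.assign_seq (x := (G.favoured U).toNat)
    (T₁ := 150 * L.edges.length * (A.card + 1) + 200 * L.edges.length + Tc - 7) h.bounded ?_ ?_ ?_ ?_
  · simp only [Expr.Fits, Expr.eval, h.r9, h.consts.r7, h.cells.fav]; omega
  · simp only [Expr.eval, h.r9, h.consts.r7, h.cells.fav]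
  swap
  · simp only [Expr.cost]; omega
  intro s₁ hs₁ hm₁ h15 hr₁
  have hc₁ := h.consts.of_ne (by decide) hr₁
  have e9 : s₁.reg 9 = a₀ := (hr₁ 9 (by decide)).trans h.r9
  have e17 : s₁.reg 17 = c := (hr₁ 17 (by decide)).trans h17
  refine Ends.assign_seq (x := a₀ + (2 * n + 2))
    (T₁ := 150 * L.edges.length * (A.card + 1) + 200 * L.edges.length + Tc - 11) hs₁ ?_ ?_ ?_ ?_
  · simp only [Expr.Fits, Expr.eval, e9, hc₁.r8]; omega
  · simp only [Expr.eval, e9, hc₁.r8]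
  swap
  · simp only [Expr.cost]; omega
  intro s₂ hs₂ hm₂ e18 hr₂
  have hc₂ := hc₁.of_ne (by decide) hr₂
  replace e9 : s₂.reg 9 = a₀ := (hr₂ 9 (by decide)).trans e9
  replace e17 : s₂.reg 17 = c := (hr₂ 17 (by decide)).trans e17
  replace h15 : s₂.reg 15 = (G.favoured U).toNat := (hr₂ 15 (by decide)).trans h15
  have hmm : s₂.mem = s.mem := hm₂.trans hm₁
  clear hm₁ hr₁ hr₂ hm₂ hs₁ hc₁ s₁
  refine Ends.seq (T₂ := 150 * L.edges.length * (A.card + 1) + 160 * L.edges.length + Tc - 11)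
    (target_spec hs₂ hc₂ (by rw [hmm]; exact h.tables) e9 e18 (by rw [hmm]; exact h.arr) h.eq_one
      e17 hp (by omega) (by omega)) hs₂ ?_ (by omega)
  rintro s₃ hs₃ hk₃ ⟨ha₃, hm₃⟩
  rw [hmm] at hm₃
  have hc₃ : Consts L p s₃.reg := hc₂.of_eq fun i hi => hk₃ i (Cmd.keeps_of_keepsBelow hi rfl)
  replace e9 : s₃.reg 9 = a₀ := (hk₃ 9 rfl).trans e9
  replace e18 : s₃.reg 18 = _ := (hk₃ 18 rfl).trans e18
  replace h15 : s₃.reg 15 = _ := (hk₃ 15 rfl).trans h15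
  refine Ends.seq (T₂ := 160 * L.edges.length + Tc - 11)
    (attractor_spec hs₃ hc₃ (h.tables.of_eq fun a ha => hm₃ a (by omega)) e18 h15 (by omega)
      (by omega) (by omega) hn (Finset.filter_subset _ _) ha₃) hs₃ ?_ (by rw [← hA]; omega)
  rintro s₄ hs₄ hk₄ ⟨ha₄, hm₄⟩
  have hc₄ : Consts L p s₄.reg := hc₃.of_eq fun i hi => hk₄ i (Cmd.keeps_of_keepsBelow hi rfl)
  replace e9 : s₄.reg 9 = a₀ := (hk₄ 9 rfl).trans e9
  replace e18 : s₄.reg 18 = _ := (hk₄ 18 rfl).trans e18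
  refine Ends.seq (T₂ := 120 * L.edges.length + Tc - 11)
    (removeAttr_spec hs₄ hc₄ e18 ha₄ (by omega)) hs₄ ?_ (by omega)
  rintro s₅ hs₅ hk₅ ⟨ha₅, hm₅⟩
  have hc₅ : Consts L p s₅.reg := hc₄.of_eq fun i hi => hk₅ i (Cmd.keeps_of_keepsBelow hi rfl)
  replace e9 : s₅.reg 9 = a₀ := (hk₅ 9 rfl).trans e9
  replace e18 : s₅.reg 18 = _ := (hk₅ 18 rfl).trans e18
  have hlow : ∀ a < a₀ + (2 * n + 2), s₅.mem a = s.mem a := fun a ha =>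
    (hm₅ a (by omega)).trans ((hm₄ a (by omega)).trans (hm₃ a (by omega)))
  refine Ends.assign_seq (x := a₀ + (2 * n + 2)) (T₁ := 110 * L.edges.length + Tc - 11) hs₅
    (hs₅.reg_lt _) e18 ?_ (by simp only [Expr.cost]; omega)
  intro s₆ hs₆ hm₆ h9 hr₆
  have hc₆ := hc₅.of_ne (by decide) hr₆
  refine Ends.seq (T₂ := 110 * L.edges.length - 11) (hcall s₆ _ _ hs₆ hc₆ (h.tables.of_eq fun a ha =>
    by rw [hm₆]; exact hlow a (by omega)) h9 (by omega) hB3 (by rw [hm₆]; exact ha₅)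
    (fun v => by rw [ite_eq_left_iff]; simp [avoid])) hs₆ ?_ (by omega)
  -- Only the frame pointer and the constants are known to survive the call. Registers 15 and 18 are
  -- restored from them and from the frame, whose cells lie below the area used by the callee.
  rintro s₇ hs₇ - ⟨e9, hc₇, ha₇, hm₇⟩
  rw [hm₆] at hm₇
  refine Ends.assign_seq (x := a₀) (T₁ := 100 * L.edges.length - 11) hs₇
    ⟨hs₇.reg_lt _, hs₇.reg_lt _⟩ ?_ ?_ (by simp only [Expr.cost]; omega)
  · simp only [Expr.eval, e9, hc₇.r8]; omega
  intro s₈ hs₈ hm₈ e9 hr₈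
  have hc₈ := hc₇.of_ne (by decide) hr₈
  refine Ends.assign_seq (x := a₀ + (2 * n + 2)) (T₁ := 90 * L.edges.length - 11) hs₈ ?_ ?_ ?_
    (by simp only [Expr.cost]; omega)
  · simp only [Expr.Fits, Expr.eval, e9, hc₈.r8]; omega
  · simp only [Expr.eval, e9, hc₈.r8]
  intro s₉ hs₉ hm₉ e18 hr₉
  have hc₉ := hc₈.of_ne (by decide) hr₉
  replace e9 : s₉.reg 9 = a₀ := (hr₉ 9 (by decide)).trans e9
  have hmm : ∀ a < a₀ + (2 * n + 2), s₉.mem a = s.mem a := fun a ha => by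
    rw [hm₉, hm₈, hm₇ a ha, hlow a ha]
  have hfv : s₉.mem (a₀ + 1 + 2 * n) = (G.favoured U).toNat := by
    rw [hmm _ (by omega), h.cells.fav]
  refine Ends.assign_seq (x := (G.favoured U).toNat) (T₁ := 80 * L.edges.length - 11) hs₉ ?_ ?_ ?_
    (by simp only [Expr.cost]; omega)
  · simp only [Expr.Fits, Expr.eval, e9, hc₉.r7, hfv]; omega
  · simp only [Expr.eval, e9, hc₉.r7, hfv]
  intro s' hs' hm' h15 hr'
  refine Ends.assign_seq (x := 0) (T₁ := 70 * L.edges.length - 11) hs'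
    (by simp only [Expr.Fits]; omega) rfl ?_ (by simp only [Expr.cost]; omega)
  intro t ht hmt h14 hrt
  have hct := (hc₉.of_ne (by decide) hr').of_ne (by decide) hrt
  have f9 : t.reg 9 = a₀ := by rw [hrt 9 (by decide), hr' 9 (by decide), e9]
  have f18 : t.reg 18 = a₀ + (2 * n + 2) := by rw [hrt 18 (by decide), hr' 18 (by decide), e18]
  have f15 : t.reg 15 = (G.favoured U).toNat := by rw [hrt 15 (by decide), h15]
  have hmt' : t.mem = s₉.mem := hmt.trans hm'
  refine (targetLost_spec (c := c) hUa ht hct f9 f18 f15 h14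
    (fun v => by rw [hmt', hmm _ (by omega), h.arr]) h.eq_one (fun v => ?_) (by omega)
    (by omega) (by omega)).frame ht ?_ (by omega)
  · rw [hmt', hm₉, hm₈, ha₇]
    split_ifs with h1 h2 <;> first | rfl | exact absurd h2 h1
  · rintro z hz hkz ⟨h1, h2, h3⟩
    have hlow' : ∀ a < a₀ + (2 * n + 2), z.mem a = s.mem a := fun a ha => by
      rw [h2 a (by omega), hmt', hmm a ha]
    refine ⟨h.of_eq hz (hct.of_eq fun i hi => hkz i (Cmd.keeps_of_keepsBelow hi rfl))
      ((hkz 9 rfl).trans f9) hp hkn hlow', (hkz 15 rfl).trans f15, (hkz 18 rfl).trans f18, h1,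
      fun a ha => hlow' a (by omega), h3⟩

end CMG

/-! ### Restart after a win of the opponent, and the whole procedure -/

namespace CMG

open RAM

variable {n k : ℕ} {G : CMG (Fin n) (Fin k)} {L : G.Listing} {p B d : ℕ} {procs : List Cmd}
  {s : State} {U : Finset (Fin n)}

theorem recordAttr_spec {a₀ ch : ℕ} {D : Fin n → ℕ} {X : Finset (Fin n)} {τ : Bool}
    (hs : Bounded B s) (hc : Consts L p s.reg) (h9 : s.reg 9 = a₀) (h18 : s.reg 18 = ch)
    (h15 : s.reg 15 = τ.toNat) (hD : ∀ v : Fin n, s.mem (a₀ + v) = D v)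
    (ha : ∀ v : Fin n, s.mem (ch + v) = stVal U X ∅ v)
    (hch : a₀ + n ≤ ch) (hB : ch + n < B) (hB4 : 4 < B) :
    Ends procs B d (.forTo 10 0 Prog.recordAttr) s (30 * n + 6) (fun s' =>
      (∀ v : Fin n, s'.mem (a₀ + v) = if v ∈ X then 2 + τ.toNat else D v) ∧
      ∀ a, a < a₀ ∨ a₀ + n ≤ a → s'.mem a = s.mem a) := by
  refine Ends.forArray (x := 14) (T₁ := 22) (fun _ _ => True) hs hc.r0 rfl rfl (by decide)
    (by decide) trivial hD ?_ (fun s' _ _ h h' _ => ⟨h, h'⟩) (by omega)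
  rintro v s' h10 hs' hk' hf hm' -
  have hv := v.2
  have e9 : s'.reg 9 = a₀ := (hk' 9 rfl (by decide)).trans h9
  have e18 : s'.reg 18 = ch := (hk' 18 rfl (by decide)).trans h18
  have e15 : s'.reg 15 = τ.toNat := (hk' 15 rfl (by decide)).trans h15
  have hav : s'.mem (ch + v) = stVal U X ∅ v := (hm' _ (by omega)).trans (ha v)
  have hXB : stVal U X ∅ v < B := hav ▸ hs'.mem_lt _
  have hτ := Bool.toNat_le τ
  have hX : stVal U X ∅ v = 2 ↔ v ∈ X := by
    simp only [stVal, Finset.notMem_empty, if_false]; split_ifs <;> simp_all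
  refine Ends.of_wp ?_ (by decide)
  simp only [Prog.recordAttr, Cmd.wp, Expr.Fits, Expr.eval, e9, e18, e15, h10, hav,
    Function.update_apply]
  simp [hs.one_lt, hX]
  refine ⟨by omega, fun h => ⟨by omega, by omega, by simp [h], fun a h h' => absurd h' h⟩,
    fun h => by simp [h, hf]⟩

theorem recordRest_spec {a₀ : ℕ} {D : Fin n → ℕ} {τ : Bool}
    (hs : Bounded B s) (hc : Consts L p s.reg) (h9 : s.reg 9 = a₀)
    (h15 : s.reg 15 = τ.toNat) (hD : ∀ v : Fin n, s.mem (a₀ + v) = D v)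
    (hB : a₀ + n < B) (hB4 : 4 < B) :
    Ends procs B d (.forTo 10 0 Prog.recordRest) s (30 * n + 6) (fun s' =>
      (∀ v : Fin n, s'.mem (a₀ + v) = if D v = 1 then 2 + τ.toNat else D v) ∧
      ∀ a, a < a₀ ∨ a₀ + n ≤ a → s'.mem a = s.mem a) := by
  refine Ends.forArray (x := 14) (T₁ := 22) (fun _ _ => True) hs hc.r0 rfl rfl (by decide)
    (by decide) trivial hD ?_ (fun s' _ _ h h' _ => ⟨h, h'⟩) (by omega)
  rintro v s' h10 hs' hk' hf hm' -
  have hv := v.2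
  have e9 : s'.reg 9 = a₀ := (hk' 9 rfl (by decide)).trans h9
  have e15 : s'.reg 15 = τ.toNat := (hk' 15 rfl (by decide)).trans h15
  have hDB : D v < B := hf ▸ hs'.mem_lt _
  have hτ := Bool.toNat_le τ
  refine Ends.of_wp ?_ (by decide)
  simp only [Prog.recordRest, Cmd.wp, Expr.Fits, Expr.eval, e9, e15, h10, hf,
    Function.update_apply]
  simp [hs.one_lt]
  refine ⟨by omega, fun h => ⟨by omega, by omega, by simp [h], fun a h h' => absurd h' h⟩,
    fun h => by simp [h]⟩

/-- This prepares the second recursive call without making one: decided cells hold `2` or `3`, so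
the cells with the value `1` now form `U \ X`, and the loop starts again at colour `0` in the same
frame. -/
theorem found_spec {a₀ j : ℕ} {D : Fin n → ℕ} {Y : Finset (Fin n)} (hY : Y ⊆ U)
    (h : AtLoop L p B a₀ D U j s) (h15 : s.reg 15 = (G.favoured U).toNat)
    (h18 : s.reg 18 = a₀ + (2 * n + 2))
    (ha : ∀ v : Fin n, s.mem (a₀ + (2 * n + 2) + v) = stVal U Y ∅ v)
    (hp : p + k + 2 ^ k ≤ a₀) (hB : a₀ + (2 * n + 2) + (2 * n + 2) < B)
    (hn : 0 < n) (hkn : k ≤ n) :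
    Ends procs B d Prog.found s
      (150 * L.edges.length * ((G.attr U (!G.favoured U) Y).card + 1) + 160 * L.edges.length)
      (fun s' => AtLoop L p B a₀
          (fun v => if v ∈ G.attr U (!G.favoured U) Y then 2 + (!G.favoured U).toNat else D v)
          (U \ G.attr U (!G.favoured U) Y) 0 s' ∧
        ∀ a < a₀, s'.mem a = s.mem a) := by
  have hnm := L.le_length_edges
  have h2k := Nat.two_pow_pos k
  have hle := h.tables.le
  set X := G.attr U (!G.favoured U) Y with hX
  refine Ends.assign_seq (x := (!G.favoured U).toNat)
    (T₁ := 150 * L.edges.length * (X.card + 1) + 156 * L.edges.length) h.bounded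
    ⟨by simp only [Expr.Fits]; omega, h.bounded.reg_lt _⟩ ?_ ?_ ?_
  · simp only [Expr.eval, h15]; cases G.favoured U <;> rfl
  swap
  · simp only [Expr.cost]; omega
  intro s₁ hs₁ hm₁ e15 hr₁
  have hc₁ := h.consts.of_ne (by decide) hr₁
  have e9 : s₁.reg 9 = a₀ := (hr₁ 9 (by decide)).trans h.r9
  have e18 : s₁.reg 18 = a₀ + (2 * n + 2) := (hr₁ 18 (by decide)).trans h18
  refine Ends.seq (T₂ := 156 * L.edges.length)
    (attractor_spec hs₁ hc₁ (by rw [hm₁]; exact h.tables) e18 e15 (by omega) (by omega) (by omega)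
      hn hY (by rw [hm₁]; exact ha)) hs₁ ?_ (by rw [hX])
  rintro s₂ hs₂ hk₂ ⟨ha₂, hm₂⟩
  rw [hm₁] at hm₂
  have hc₂ : Consts L p s₂.reg := hc₁.of_eq fun i hi => hk₂ i (Cmd.keeps_of_keepsBelow hi rfl)
  replace e9 : s₂.reg 9 = a₀ := (hk₂ 9 rfl).trans e9
  replace e18 : s₂.reg 18 = _ := (hk₂ 18 rfl).trans e18
  replace e15 : s₂.reg 15 = _ := (hk₂ 15 rfl).trans e15
  refine Ends.seq (T₂ := 110 * L.edges.length)
    (recordAttr_spec hs₂ hc₂ e9 e18 e15 (D := D) (fun v => by rw [hm₂ _ (by omega), h.arr]) ha₂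
      (by omega) (by omega) (by omega)) hs₂ ?_ (by omega)
  rintro s₃ hs₃ hk₃ ⟨ha₃, hm₃⟩
  have hc₃ : Consts L p s₃.reg := hc₂.of_eq fun i hi => hk₃ i (Cmd.keeps_of_keepsBelow hi rfl)
  replace e9 : s₃.reg 9 = a₀ := (hk₃ 9 rfl).trans e9
  have hlow : ∀ a < a₀, s₃.mem a = s.mem a := fun a ha => by
    rw [hm₃ a (by omega), hm₂ a (by omega)]
  have hD' : ∀ v, (if v ∈ X then 2 + (!G.favoured U).toNat else D v) = 1 ↔ v ∈ U \ X := by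
    intro v
    rw [Finset.mem_sdiff]
    by_cases hv : v ∈ X
    · simp only [hv, if_true, not_true_eq_false, and_false, iff_false]; omega
    · simp [hv, h.eq_one]
  refine (setup_spec hs₃ hc₃ (h.tables.of_eq fun a ha => hlow a (by omega)) e9 ha₃ hD' hp
    (by omega) hkn hn).frame hs₃ ?_ le_rfl
  rintro s₄ hs₄ hk₄ ⟨hcells, hm₄⟩
  have hlow' : ∀ a < a₀, s₄.mem a = s.mem a := fun a ha => by
    rw [hm₄ a (by omega), hlow a ha]
  exact ⟨⟨hs₄, hc₃.of_eq fun i hi => hk₄ i (Cmd.keeps_of_keepsBelow hi rfl),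
    h.tables.of_eq fun a ha => hlow' a (by omega), (hk₄ 9 rfl).trans e9,
    fun v => by rw [hm₄ _ (by omega), ha₃], hD', hcells⟩, hlow'⟩

/-- The state `s'` after the loop over the colours that was started in `s`: the positions outside
of `U'` have been decided, and Player `τ` wins from the positions of `U'`. -/
def AfterLoop (L : G.Listing) (p a₀ : ℕ) (D : Fin n → ℕ) (U : Finset (Fin n)) (s s' : State) :
    Prop :=
  s'.reg 9 = a₀ ∧ Consts L p s'.reg ∧ (∀ a < a₀, s'.mem a = s.mem a) ∧
    ∃ (τ : Bool) (U' : Finset (Fin n)), U' ⊆ U ∧ s'.mem (a₀ + 1 + 2 * n) = τ.toNat ∧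
      (∀ v : Fin n, s'.mem (a₀ + v)
        = if v ∈ U' then 1 else if v ∈ U then 2 + winVal G U v else D v) ∧
      ∀ v ∈ U', winVal G U v = τ.toNat

/-- The time of a call that solves the game restricted to `U`. -/
def callTime (L : G.Listing) (U : Finset (Fin n)) : ℕ :=
  1000 * L.edges.length
    * (8 * U.card * U.card.descFactorial (U.image G.color).card + 1)

/-- The number of occurring colours that are still to be treated. -/
def remaining (G : CMG (Fin n) (Fin k)) (U : Finset (Fin n)) (j : ℕ) : ℕ :=
  {c ∈ U.image G.color | j ≤ c.val}.card

/-- The loop over the colours works for the arena `U`. -/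
def LoopWorks (B : ℕ) (L : G.Listing) (p : ℕ) (U : Finset (Fin n)) : Prop :=
  ∀ (d : ℕ) (s : State) (a₀ : ℕ) (D : Fin n → ℕ) (j : ℕ), (U.image G.color).card ≤ d →
    AtLoop L p B a₀ D U j s → p + k + 2 ^ k ≤ a₀ →
    a₀ + ((U.image G.color).card + 1) * (2 * n + 2) < B → j ≤ k →
    (∀ c ∈ U.image G.color, c.val < j →
      ∀ v ∈ G.avoid U c, G.Wins (G.avoid U c) (G.favoured U) v) →
    Ends [Prog.solve] B d Prog.colorLoop s
      (1000 * L.edges.length * loopUnits U.card (U.image G.color).card (remaining G U j)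
        + 60 * (k - j) + 10)
      (AfterLoop L p a₀ D U s)

/-- After the loop, all undecided positions are won by the player who is favoured last. The bound is
`callTime L U - 1` because the call instruction itself takes one step. -/
theorem solve_spec (hloop : LoopWorks B L p U) (hn : 0 < n) (hkn : k ≤ n)
    (hd : (U.image G.color).card ≤ d) :
    SolvesIn [Prog.solve] B d L p Prog.solve U (callTime L U - 1) := by
  intro s a₀ D hs hc ht h9 hp hB hD hU
  have hnm := L.le_length_edges
  have h2k := Nat.two_pow_pos k
  have hle := ht.le
  have hB2 : a₀ + (2 * n + 2) < B := by nlinarith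
  have htime := Nat.mul_le_mul_left (1000 * L.edges.length) (loopUnits_le
    (n := U.card) (κ := (U.image G.color).card)
    (fun h => card_image_color_pos (Finset.card_pos.1 (by omega))) Finset.card_image_le)
  have hrem : remaining G U 0 = (U.image G.color).card := by simp [remaining]
  unfold callTime
  rw [Nat.mul_add]
  set W := 1000 * L.edges.length *
    (8 * U.card * U.card.descFactorial (U.image G.color).card)
  refine Ends.seq (T₂ := W + 200 * L.edges.length) (setup_spec hs hc ht h9 hD hU hp (by omega) hkn hn)
    hs ?_ (by omega)
  rintro s₁ hs₁ hk₁ ⟨hcells, hm₁⟩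
  have hat : AtLoop L p B a₀ D U 0 s₁ :=
    ⟨hs₁, hc.of_eq fun i hi => hk₁ i (Cmd.keeps_of_keepsBelow hi rfl),
      ht.of_eq fun a ha => hm₁ a (by omega), (hk₁ 9 rfl).trans h9,
      fun v => by rw [hm₁ _ (by omega), hD], hU, hcells⟩
  refine Ends.seq (T₂ := 100 * L.edges.length)
    (hloop d s₁ a₀ D 0 hd hat hp hB (Nat.zero_le _) (by simp)) hs₁ ?_ (by rw [hrem]; omega)
  rintro s₂ hs₂ - ⟨e9, hc₂, hm₂, τ, U', hU', hτ, ha₂, hwin⟩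
  have hτ1 := Bool.toNat_le τ
  refine Ends.assign_seq (x := τ.toNat) (T₁ := 60 * L.edges.length) hs₂ ?_ ?_ ?_
    (by simp only [Expr.cost]; omega)
  · simp only [Expr.Fits, Expr.eval, e9, hc₂.r7, hτ]; omega
  · simp only [Expr.eval, e9, hc₂.r7, hτ]
  intro s₃ hs₃ hm₃ e15 hr₃
  have hc₃ := hc₂.of_ne (by decide) hr₃
  replace e9 : s₃.reg 9 = a₀ := (hr₃ 9 (by decide)).trans e9
  refine (recordRest_spec hs₃ hc₃ e9 e15 (fun v => by rw [hm₃, ha₂]) (by omega) (by omega)).frame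
    hs₃ ?_ (by omega)
  rintro s₄ hs₄ hk₄ ⟨ha₄, hm₄⟩
  refine ⟨(hk₄ 9 rfl).trans e9, hc₃.of_eq fun i hi => hk₄ i (Cmd.keeps_of_keepsBelow hi rfl),
    fun v => ?_, fun a ha => by rw [hm₄ a (by omega), hm₃, hm₂ a ha, hm₁ a (by omega)]⟩
  rw [ha₄]
  by_cases hv : v ∈ U'
  · simp [hv, hU' hv, hwin v hv]
  · by_cases hvU : v ∈ U
    · simp only [hv, hvU, if_true, if_false, ite_eq_right_iff]; omega
    · have := (hU v).not.2 hvU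
      simp [hv, hvU, this]

theorem call_spec (hloop : LoopWorks B L p U) (hn : 0 < n) (hkn : k ≤ n)
    (hd : (U.image G.color).card ≤ d) :
    SolvesIn [Prog.solve] B (d + 1) L p (.call 0) U (callTime L U) := by
  intro s a₀ D hs hc ht h9 hp hB hD hU
  have hnm := L.le_length_edges
  have hpos : 1 ≤ callTime L U := Nat.mul_pos (by omega) (by omega)
  exact (Ends.call rfl (solve_spec hloop hn hkn hd s a₀ D hs hc ht h9 hp hB hD hU)).mono
    (fun _ h => h) (by omega)

end CMG

/-! ### The loop over the colours -/

namespace CMG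

open RAM

variable {n k : ℕ} {G : CMG (Fin n) (Fin k)} {L : G.Listing} {p B d : ℕ} {procs : List Cmd}
  {s : State} {U : Finset (Fin n)}

theorem loopUnits_succ {n κ r : ℕ} (hn : n ≠ 0) :
    loopUnits n κ (r + 1)
      = (8 * (n - 1) * (n - 1).descFactorial (κ - 1) + 2) + loopUnits n κ r := by
  simp only [loopUnits, hn, if_false]
  ring

theorem le_loopUnits {n κ r : ℕ} (hn : n ≠ 0) :
    8 * (n - 1) * (n - 1).descFactorial (min κ (n - 1)) + 2 ≤ loopUnits n κ r := by
  simp only [loopUnits, hn, if_false]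
  omega

theorem remaining_eq_of_notMem {c : Fin k} (hc : c ∉ U.image G.color) :
    remaining G U c = remaining G U (c + 1) := by
  refine congrArg Finset.card (Finset.filter_congr fun c' hc' => ?_)
  have : c'.val ≠ c.val := fun h => hc (Fin.ext h ▸ hc')
  omega

theorem remaining_eq_of_mem {c : Fin k} (hc : c ∈ U.image G.color) :
    remaining G U c = remaining G U (c + 1) + 1 := by
  unfold remaining
  rw [← Finset.card_insert_of_notMem (a := c) (by simp)]
  congr 1
  ext c'
  simp only [Finset.mem_filter, Finset.mem_insert, Fin.ext_iff]
  constructor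
  · rintro ⟨h1, h2⟩
    by_cases h : c'.val = c.val
    · exact Or.inl h
    · exact Or.inr ⟨h1, by omega⟩
  · rintro (h | ⟨h1, h2⟩)
    · exact ⟨Fin.ext h ▸ hc, h.ge⟩
    · exact ⟨h1, by omega⟩

theorem remaining_le (j : ℕ) : remaining G U j ≤ (U.image G.color).card :=
  Finset.card_filter_le _ _

theorem loopUnits_mono {n κ r r' : ℕ} (h : r ≤ r') : loopUnits n κ r ≤ loopUnits n κ r' := by
  unfold loopUnits
  split_ifs
  · exact le_rfl
  · gcongr

theorem AfterLoop.trans {a₀ : ℕ} {D : Fin n → ℕ} {s₁ s₂ : State}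
    (h : AfterLoop L p a₀ D U s₁ s₂) (hm : ∀ a < a₀, s₁.mem a = s.mem a) :
    AfterLoop L p a₀ D U s s₂ := by
  obtain ⟨h1, h2, h3, h4⟩ := h
  exact ⟨h1, h2, fun a ha => (h3 a ha).trans (hm a ha), h4⟩

/-- The final state of the restarted loop is also a final state for `U`: the positions of the
attractor carry the right winner, and winners outside of it do not change. -/
theorem AfterLoop.of_sdiff_attr (hU : G.SubArena U) {a₀ : ℕ} {D : Fin n → ℕ} {c : Fin k}
    {s₂ : State}
    (h : AfterLoop L p a₀
      (fun v => if v ∈ G.attr U (!G.favoured U) (lost G U c) then 2 + (!G.favoured U).toNat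
        else D v) (U \ G.attr U (!G.favoured U) (lost G U c)) s s₂) :
    AfterLoop L p a₀ D U s s₂ := by
  have hY : ∀ v ∈ lost G U c,
      v ∈ G.avoid U c ∧ G.Wins (G.avoid U c) (!G.favoured U) v := fun v hv => mem_lost.1 hv
  have hX := attr_subset (G := G) (U := U) (σ := !G.favoured U) (T := lost G U c)
  have hw : ∀ v ∈ U \ G.attr U (!G.favoured U) (lost G U c),
      winVal G (U \ G.attr U (!G.favoured U) (lost G U c)) v = winVal G U v := fun v hv => by
    unfold winVal
    rw [wins_sdiff_attr_iff hU hY hv]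
  have hx : ∀ v ∈ G.attr U (!G.favoured U) (lost G U c),
      winVal G U v = (!G.favoured U).toNat := fun v hv =>
    (winVal_eq_iff hU (hX hv) _).2 (wins_of_mem_attr_opponent hU hY hv)
  generalize G.attr U (!G.favoured U) (lost G U c) = X at *
  obtain ⟨h1, h2, h3, τ, U', hU', hτ, ha, hwin⟩ := h
  refine ⟨h1, h2, h3, τ, U', hU'.trans Finset.sdiff_subset, hτ, fun v => ?_, fun v hv => ?_⟩
  · rw [ha]
    by_cases hv' : v ∈ U'
    · simp [hv']
    by_cases hv : v ∈ X
    · simp [hv', hv, hX hv, hx v hv]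
    · by_cases hvU : v ∈ U
      · simp [hv', hv, hvU, hw v (Finset.mem_sdiff.2 ⟨hvU, hv⟩)]
      · simp [hv', hv, hvU]
  · rw [← hw v (hU' hv), hwin v hv]

theorem treatColor_spec {a₀ T : ℕ} {D : Fin n → ℕ} {c : Fin k} {Q : State → Prop}
    (h : AtLoop L p B a₀ D U c s) (hB : a₀ + 2 * n + 2 < B) (hkn : k ≤ n)
    (hmem : c ∈ U.image G.color → ∀ s', AtLoop L p B a₀ D U c s' → s'.reg 17 = c →
      s'.mem = s.mem → Ends procs B d (Prog.callAvoid ;; .cond (.reg 14) Prog.found Prog.nextColor)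
        s' T Q)
    (hnot : c ∉ U.image G.color → ∀ s', AtLoop L p B a₀ D U c s' →
      s'.mem = s.mem → Ends procs B d Prog.nextColor s' T Q) :
    Ends procs B d Prog.treatColor s (T + 12) Q := by
  have hc2 := c.2
  have hcB : (c : ℕ) < B := by omega
  refine Ends.assign_seq (x := c) (T₁ := T + 7) h.bounded ?_ ?_ ?_
    (by simp only [Expr.cost]; omega)
  · simp only [Expr.Fits, Expr.eval, h.r9, h.consts.r7, h.cells.next]; omega
  · simp only [Expr.eval, h.r9, h.consts.r7, h.cells.next]
  intro s₁ hs₁ hm₁ h17 hr₁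
  have hat : AtLoop L p B a₀ D U c s₁ := ⟨hs₁, h.consts.of_ne (by decide) hr₁,
    by rw [hm₁]; exact h.tables, (hr₁ 9 (by decide)).trans h.r9, by rw [hm₁]; exact h.arr, h.eq_one,
    by rw [hm₁]; exact h.cells⟩
  have hev : (Expr.mem (.add (.add (.reg 9) (.reg 0)) (.reg 17))).eval s₁
      = if c ∈ U.image G.color then 1 else 0 := by
    simp only [Expr.eval, hat.r9, hat.consts.r0, h17, hat.cells.occurs]
  refine Ends.cond (T₁ := T) ?_ ?_ ?_ (by simp only [Expr.cost]; omega)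
  · have := hat.cells.occurs c
    have h1 := hs₁.mem_lt (a₀ + n + c)
    simp only [Expr.Fits, Expr.eval, hat.r9, hat.consts.r0, h17]
    omega
  · intro h0
    rw [hev] at h0
    exact hmem (by by_contra hc; simp [hc] at h0) s₁ hat h17 hm₁
  · intro h0
    rw [hev] at h0
    exact hnot (by intro hc; simp [hc] at h0) s₁ hat hm₁

/-- Strong induction on the arena, and inside it induction on the number of colours left. A colour
without effect is handled by the inner hypothesis; the recursive call and the restart on `U \ X` by
the outer one. -/
theorem loopWorks (hU : G.SubArena U) (hn : 0 < n) (hkn : k ≤ n) : LoopWorks B L p U := by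
  induction U using Finset.strongInduction with
  | H U ih =>
    intro d s a₀ D j hd hat hp hB hj hdone
    obtain ⟨i, hi⟩ : ∃ i, k = j + i := ⟨k - j, by omega⟩
    have hnm := L.le_length_edges
    have hB2 : a₀ + (2 * n + 2) < B := by nlinarith
    induction i generalizing j s with
    | zero =>
      obtain rfl : j = k := by omega
      refine Ends.loop_false ?_ ?_ ?_ (by simp only [Expr.cost]; omega)
      · have := hat.bounded.one_lt
        simp only [Expr.Fits, Expr.eval, hat.r9, hat.consts.r1, hat.consts.r7, hat.cells.next]
        omega
      · simp only [Expr.eval, hat.r9, hat.consts.r1, hat.consts.r7, hat.cells.next]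
        simp
      · refine ⟨hat.r9, hat.consts, fun _ _ => rfl, G.favoured U, U, subset_rfl, hat.cells.fav,
          fun v => ?_, fun v hv => (winVal_eq_iff hU hv _).2
            (wins_favoured_of_forall_avoid hU (fun c hc => hdone c hc c.2) hv)⟩
        rw [hat.arr]
        by_cases hv : v ∈ U
        · simp [hv, (hat.eq_one v).2 hv]
        · simp [hv]
    | succ i ihi =>
      have hjk : j < k := by omega
      obtain ⟨c, rfl⟩ : ∃ c : Fin k, c.val = j := ⟨⟨j, hjk⟩, rfl⟩
      have hfit : (Expr.lt (.mem (.add (.reg 9) (.reg 7))) (.reg 1)).Fits B s := by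
        have := hat.bounded.one_lt
        simp only [Expr.Fits, Expr.eval, hat.r9, hat.consts.r1, hat.consts.r7, hat.cells.next]
        omega
      have hev : (Expr.lt (.mem (.add (.reg 9) (.reg 7))) (.reg 1)).eval s ≠ 0 := by
        simp only [Expr.eval, hat.r9, hat.consts.r1, hat.consts.r7, hat.cells.next]
        simp
      by_cases hcU : c ∈ U.image G.color
      swap
      · refine Ends.loop_true (T₁ := 24)
          (T₂ := 1000 * L.edges.length
            * loopUnits U.card (U.image G.color).card (remaining G U (c + 1))
            + 60 * (k - (c + 1)) + 10) hfit hev hat.bounded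
          (Q' := fun s' => AtLoop L p B a₀ D U (c + 1) s' ∧ ∀ a < a₀, s'.mem a = s.mem a)
          (treatColor_spec (T := 12) hat hB2 hkn (fun h => absurd h hcU) fun _ s' hs' hm =>
            (nextColor_spec hs' hp hB2 (by omega) hkn).mono
              (fun _ h => by rw [hm] at h; exact h) le_rfl) ?_ ?_
        · rintro s' - - ⟨hs', hm⟩
          refine (ihi s' (c + 1) hs' hjk (fun c' hc' hlt => hdone c' hc' ?_) (by omega)).mono
            (fun _ h => h.trans hm) le_rfl
          have : c'.val ≠ c.val := fun h => hcU (Fin.ext h ▸ hc')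
          omega
        · rw [remaining_eq_of_notMem hcU]
          simp only [Expr.cost]
          omega
      have hss := avoid_ssubset hcU
      have hκ : 1 ≤ (U.image G.color).card := Finset.card_pos.2 ⟨c, hcU⟩
      have hκ' := card_image_avoid_le hcU
      have hUn : U.card ≤ n := by simpa using Finset.card_le_univ U
      have hκU : (U.image G.color).card ≤ U.card := Finset.card_image_le
      have hlt := Finset.card_lt_card hss
      -- The occurring colour `c` provides the level of nesting that the call consumes, and the
      -- callee does not contain `c`.
      obtain ⟨d, rfl⟩ : ∃ d', d = d' + 1 := ⟨d - 1, by omega⟩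
      have hcall := call_spec (ih _ hss (hU.avoid c)) hn hkn
        (show ((G.avoid U c).image G.color).card ≤ d by omega)
      -- The whole treatment of a colour fits into the unit share that `loopUnits` reserves for each
      -- occurring colour.
      have hcost : 150 * L.edges.length * ((U.card - (G.avoid U c).card) + 1)
          + 200 * L.edges.length + callTime L (G.avoid U c) + 50
          ≤ 1000 * L.edges.length
            * (8 * (U.card - 1) * (U.card - 1).descFactorial ((U.image G.color).card - 1) + 2) := by
        have h1 := units_le hlt hκ' (by omega)
        have h2 := Nat.mul_le_mul_left (1000 * L.edges.length) h1
        obtain ⟨a, ha⟩ : ∃ a, U.card - (G.avoid U c).card = a + 1 :=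
          ⟨U.card - (G.avoid U c).card - 1, by omega⟩
        rw [ha] at h2 ⊢
        unfold callTime
        generalize 8 * (G.avoid U c).card
          * (G.avoid U c).card.descFactorial ((G.avoid U c).image G.color).card = x at *
        refine le_trans ?_ h2
        nlinarith [Nat.zero_le (L.edges.length * a)]
      rw [remaining_eq_of_mem hcU, loopUnits_succ (by omega), Nat.mul_add]
      have hB3 : a₀ + (2 * n + 2) + (2 * n + 2) < B := by nlinarith
      by_cases hlost : lost G U c = ∅
      · refine Ends.loop_true (T₁ := 150 * L.edges.length * ((U.card - (G.avoid U c).card) + 1)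
              + 200 * L.edges.length + callTime L (G.avoid U c) + 14 + 12)
          (T₂ := 1000 * L.edges.length
            * loopUnits U.card (U.image G.color).card (remaining G U (c + 1))
            + 60 * (k - (c + 1)) + 10) hfit hev hat.bounded
          (Q' := fun s' => AtLoop L p B a₀ D U (c + 1) s' ∧ ∀ a < a₀, s'.mem a = s.mem a)
          (treatColor_spec hat hB2 hkn (fun _ s₁ hs₁ h17 hm₁ => ?_) fun h => absurd hcU h) ?_ ?_
        · refine Ends.seq (T₂ := 14) (callAvoid_spec hU hs₁ hcU h17 hcall hp hB hn hkn) hs₁.bounded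
            ?_ le_rfl
          rintro s₂ hs₂ - ⟨h1, h2, h3, h4, h5, h6⟩
          have h14 : s₂.reg 14 = 0 := by
            rcases h6 with h6 | h6
            · exact absurd hlost h6.2.ne_empty
            · exact h6.1
          refine Ends.cond (T₁ := 12) (hs₂.reg_lt 14) (fun h0 => absurd h14 h0) (fun _ => ?_)
            (by simp only [Expr.cost]; omega)
          refine (nextColor_spec h1 hp hB2 (by omega) hkn).mono (fun s₃ h => ⟨h.1, fun a ha => ?_⟩)
            le_rfl
          rw [h.2 a ha, h5 a ha, hm₁]
        · rintro s' - - ⟨hs', hm⟩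
          refine (ihi s' (c + 1) hs' hjk (fun c' hc' hlt => ?_) (by omega)).mono
            (fun _ h => h.trans hm) le_rfl
          by_cases h : c'.val = c.val
          · obtain rfl := Fin.ext h
            intro v hv
            refine (wins_or_wins (hU.avoid c') hv (G.favoured U)).resolve_right fun hw => ?_
            have := mem_lost.2 ⟨hv, hw⟩
            simp [hlost] at this
          · exact hdone c' hc' (by omega)
        · simp only [Expr.cost]
          omega
      · have hY : lost G U c ⊆ U := lost_subset
        have hX := attr_subset (G := G) (U := U) (σ := !G.favoured U) (T := lost G U c)
        have hXne : (G.attr U (!G.favoured U) (lost G U c)).Nonempty :=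
          (Finset.nonempty_iff_ne_empty.2 hlost).mono (subset_attr hY)
        have hss' : U \ G.attr U (!G.favoured U) (lost G U c) ⊂ U :=
          Finset.sdiff_ssubset hX hXne
        have hcard := Finset.card_sdiff_of_subset hX
        have hle := Finset.card_le_card hX
        have hlt' := Finset.card_lt_card hss'
        have hκ'' : ((U \ G.attr U (!G.favoured U) (lost G U c)).image G.color).card
            ≤ (U.image G.color).card :=
          Finset.card_le_card (Finset.image_subset_image Finset.sdiff_subset)
        have hκn : ((U \ G.attr U (!G.favoured U) (lost G U c)).image G.color).card
            ≤ (U \ G.attr U (!G.favoured U) (lost G U c)).card := Finset.card_image_le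
        -- The remaining iterations of the present loop are a complete loop for `U \ X`, in the same
        -- frame and at the same depth of calls.
        have hloop := ih _ hss' hU.sdiff_attr
        have hcost' : 150 * L.edges.length * ((G.attr U (!G.favoured U) (lost G U c)).card + 1)
            + 160 * L.edges.length
            + (1000 * L.edges.length * loopUnits (U \ G.attr U (!G.favoured U) (lost G U c)).card
              ((U \ G.attr U (!G.favoured U) (lost G U c)).image G.color).card
              (remaining G (U \ G.attr U (!G.favoured U) (lost G U c)) 0) + 60 * (k - 0) + 10)
            ≤ 1000 * L.edges.length
              * loopUnits U.card (U.image G.color).card (remaining G U (c + 1)) := by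
          -- The restart is paid by the last summand of `loopUnits`, which is reserved once and does
          -- not depend on the number of colours left.
          have h1 := units_le (j := min (U.image G.color).card (U.card - 1)) hlt'
            (show ((U \ G.attr U (!G.favoured U) (lost G U c)).image G.color).card ≤ _ by omega)
            (by omega)
          have h2 := (h1.trans (le_loopUnits (κ := (U.image G.color).card)
            (r := remaining G U (c + 1)) (by omega)))
          have h3 := (loopUnits_mono (remaining_le (G := G)
            (U := U \ G.attr U (!G.favoured U) (lost G U c)) 0)).trans (loopUnits_le
              (fun h => card_image_color_pos (Finset.card_pos.1 (by omega))) hκn)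
          have h4 := Nat.mul_le_mul_left (1000 * L.edges.length)
            ((Nat.add_le_add_right (Nat.add_le_add_left h3 _) _).trans h2)
          have hx : U.card - (U \ G.attr U (!G.favoured U) (lost G U c)).card
            = (G.attr U (!G.favoured U) (lost G U c)).card := by omega
          rw [hx] at h4
          have hx1 := Finset.card_pos.2 hXne
          generalize (G.attr U (!G.favoured U) (lost G U c)).card = x at *
          generalize loopUnits (U \ G.attr U (!G.favoured U) (lost G U c)).card _ _ = y at *
          refine le_trans ?_ h4
          obtain ⟨x, rfl⟩ : ∃ x', x = x' + 1 := ⟨x - 1, by omega⟩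
          have e : 1000 * L.edges.length * (x + 1 + y + 1) = 1000 * L.edges.length * y
              + 1000 * (L.edges.length * x) + 2000 * L.edges.length := by ring
          have e' : 150 * L.edges.length * (x + 1 + 1)
              = 150 * (L.edges.length * x) + 300 * L.edges.length := by ring
          omega
        set X := G.attr U (!G.favoured U) (lost G U c) with hXdef
        refine Ends.loop_true (T₁ := 150 * L.edges.length * ((U.card - (G.avoid U c).card) + 1)
              + 200 * L.edges.length + callTime L (G.avoid U c)
              + (150 * L.edges.length * (X.card + 1) + 160 * L.edges.length + 2) + 12)
          (T₂ := 1000 * L.edges.length * loopUnits (U \ X).card ((U \ X).image G.color).card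
              (remaining G (U \ X) 0) + 60 * (k - 0) + 10) hfit hev hat.bounded
          (Q' := fun s' => AtLoop L p B a₀
            (fun v => if v ∈ X then 2 + (!G.favoured U).toNat else D v) (U \ X) 0 s' ∧
              ∀ a < a₀, s'.mem a = s.mem a)
          (treatColor_spec hat hB2 hkn (fun _ s₁ hs₁ h17 hm₁ => ?_) fun h => absurd hcU h) ?_ ?_
        · refine Ends.seq (callAvoid_spec hU hs₁ hcU h17 hcall hp hB hn hkn) hs₁.bounded
            ?_ le_rfl
          rintro s₂ hs₂ - ⟨h1, h2, h3, h4, h5, h6⟩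
          have h14 : s₂.reg 14 = 1 := by
            rcases h6 with h6 | h6
            · exact h6.1
            · exact absurd h6.2 hlost
          refine Ends.cond (T₁ := 150 * L.edges.length * (X.card + 1) + 160 * L.edges.length)
            (hs₂.reg_lt 14) (fun _ => ?_) (fun h0 => absurd (h14.symm.trans h0) one_ne_zero)
            (by simp only [Expr.cost]; omega)
          refine (found_spec hY h1 h2 h3 h4 hp hB3 hn hkn).mono
            (fun s₃ h => ⟨h.1, fun a ha => ?_⟩) le_rfl
          rw [h.2 a ha, h5 a ha, hm₁]
        · rintro s' - - ⟨hs', hm⟩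
          refine (hloop (d + 1) s' a₀ _ 0 (hκ''.trans hd) hs' hp ?_ (Nat.zero_le _)
            (by simp)).mono (fun _ h => (AfterLoop.of_sdiff_attr hU h).trans hm) le_rfl
          have := Nat.mul_le_mul_right (2 * n + 2) (Nat.add_le_add_right hκ'' 1)
          omega
        · simp only [Expr.cost]
          omega

end CMG

/-! ## The input -/

theorem List.flatMap_eq_take_append {α β : Type*} (f : α → List β) (xs : List α) {i : ℕ}
    (h : i < xs.length) :
    xs.flatMap f = (xs.take i).flatMap f ++ f xs[i] ++ (xs.drop (i + 1)).flatMap f := by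
  conv_lhs => rw [← List.take_append_drop i xs, List.drop_eq_getElem_cons h, List.flatMap_append,
    List.flatMap_cons]
  rw [List.append_assoc]

theorem List.getD_append_append {α : Type*} (pre mid post : List α) {j : ℕ}
    (hj : j < mid.length) (x : α) : (pre ++ mid ++ post).getD (pre.length + j) x = mid[j] := by
  simp [List.getD_eq_getElem?_getD, List.append_assoc, List.getElem?_append_right,
    List.getElem?_append_left, hj]

theorem List.length_flatMap_pair {α β : Type*} (f g : α → β) (l : List α) :
    (l.flatMap fun x => [f x, g x]).length = 2 * l.length := by
  induction l with
  | nil => rfl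
  | cons x l ih => rw [List.flatMap_cons, List.length_append, ih]; simp; omega

namespace CMG

variable {n k : ℕ} {G : CMG (Fin n) (Fin k)} {L : G.Listing}

/-- The part of the input that describes one set of colours. -/
def setCode (S : List (Fin k)) : List ℕ := S.length :: S.map Fin.val

namespace Listing

theorem encode_zero : L.encode.getD 0 0 = n := by simp [encode]

theorem encode_one : L.encode.getD 1 0 = k := by simp [encode]

theorem encode_two : L.encode.getD 2 0 = L.edges.length := by simp [encode]

theorem encode_owner (v : Fin n) : L.encode.getD (3 + v) 0 = (G.owner v).toNat := by
  have := List.getD_append_append [n, k, L.edges.length]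
    (List.ofFn fun v => (G.owner v).toNat) (List.ofFn (fun v => (G.color v : ℕ))
    ++ L.edges.flatMap (fun e => [(e.1 : ℕ), (e.2 : ℕ)])
    ++ [false, true].flatMap (fun σ =>
        (L.wins σ).length :: (L.wins σ).flatMap (fun S => S.length :: S.map Fin.val)))
    (j := v) (by simp) 0
  simpa [encode, add_comm] using this

theorem encode_color (v : Fin n) : L.encode.getD (3 + n + v) 0 = G.color v := by
  have := List.getD_append_append ([n, k, L.edges.length]
    ++ List.ofFn fun v => (G.owner v).toNat) (List.ofFn (fun v => (G.color v : ℕ)))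
    (L.edges.flatMap (fun e => [(e.1 : ℕ), (e.2 : ℕ)])
    ++ [false, true].flatMap (fun σ =>
        (L.wins σ).length :: (L.wins σ).flatMap (fun S => S.length :: S.map Fin.val)))
    (j := v) (by simp) 0
  rw [show 3 + n = ([n, k, L.edges.length] ++ List.ofFn fun v => (G.owner v).toNat).length by
    simp; omega]
  simpa only [encode, List.append_assoc, List.getElem_ofFn] using this

theorem encode_edge {i j : ℕ} (h : i < L.edges.length) (hj : j < 2) :
    L.encode.getD (3 + 2 * n + 2 * i + j) 0
      = [((L.edges[i]).1 : ℕ), ((L.edges[i]).2 : ℕ)][j] := by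
  have := List.getD_append_append ([n, k, L.edges.length]
    ++ List.ofFn (fun v => (G.owner v).toNat) ++ List.ofFn (fun v => (G.color v : ℕ))
    ++ (L.edges.take i).flatMap (fun e => [(e.1 : ℕ), (e.2 : ℕ)]))
    [((L.edges[i]).1 : ℕ), ((L.edges[i]).2 : ℕ)]
    ((L.edges.drop (i + 1)).flatMap (fun e => [(e.1 : ℕ), (e.2 : ℕ)])
    ++ [false, true].flatMap (fun σ =>
        (L.wins σ).length :: (L.wins σ).flatMap (fun S => S.length :: S.map Fin.val)))
    (j := j) (by simpa using hj) 0
  rw [← this, encode, List.flatMap_eq_take_append _ L.edges h]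
  congr 1
  · simp only [List.append_assoc]
  · simp only [List.length_append, List.length_flatMap_pair, List.length_ofFn, List.length_take,
      List.length_cons, List.length_nil]
    omega

/-- The address of the first member of the winning condition of Player 0 after the first `i`. -/
def setAddr (L : G.Listing) (i : ℕ) : ℕ :=
  4 + 2 * n + 2 * L.edges.length + (((L.wins false).take i).flatMap setCode).length

theorem encode_eq : L.encode = ([n, k, L.edges.length]
    ++ List.ofFn (fun v => (G.owner v).toNat) ++ List.ofFn (fun v => (G.color v : ℕ))
    ++ L.edges.flatMap (fun e => [(e.1 : ℕ), (e.2 : ℕ)])) ++ [(L.wins false).length]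
    ++ ((L.wins false).flatMap setCode
      ++ (L.wins true).length :: (L.wins true).flatMap setCode) := by
  simp [encode]
  rfl

theorem encode_length_wins :
    L.encode.getD (3 + 2 * n + 2 * L.edges.length) 0 = (L.wins false).length := by
  rw [encode_eq]
  refine Eq.trans (congrArg (List.getD _ · 0) ?_)
    (List.getD_append_append _ [(L.wins false).length] _ (j := 0) (by simp) 0)
  simp only [List.length_append, List.length_flatMap_pair, List.length_ofFn,
      List.length_cons, List.length_nil]
  omega

theorem encode_set {i j : ℕ} (h : i < (L.wins false).length)
    (hj : j < (setCode (L.wins false)[i]).length) :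
    L.encode.getD (L.setAddr i + j) 0 = (setCode (L.wins false)[i])[j] := by
  have := List.getD_append_append ([n, k, L.edges.length]
    ++ List.ofFn (fun v => (G.owner v).toNat) ++ List.ofFn (fun v => (G.color v : ℕ))
    ++ L.edges.flatMap (fun e => [(e.1 : ℕ), (e.2 : ℕ)]) ++ [(L.wins false).length]
    ++ ((L.wins false).take i).flatMap setCode) (setCode (L.wins false)[i])
    (((L.wins false).drop (i + 1)).flatMap setCode
      ++ (L.wins true).length :: (L.wins true).flatMap setCode) hj 0
  rw [← this, encode_eq, List.flatMap_eq_take_append setCode _ h]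
  congr 1
  · simp only [List.append_assoc]
  · simp only [setAddr, List.length_append, List.length_flatMap_pair, List.length_ofFn,
      List.length_cons, List.length_nil]
    omega

theorem setAddr_succ {i : ℕ} (h : i < (L.wins false).length) :
    L.setAddr (i + 1) = L.setAddr i + 1 + ((L.wins false)[i]).length := by
  rw [setAddr, List.take_add_one, List.flatMap_append, List.getElem?_eq_getElem h]
  simp [setAddr, setCode, -List.length_flatMap]
  omega

theorem setAddr_le (i : ℕ) : L.setAddr i ≤ L.encode.length := by
  rw [encode_eq]
  conv_rhs => rw [← List.take_append_drop i (L.wins false), List.flatMap_append]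
  simp only [setAddr, List.length_append, List.length_flatMap_pair, List.length_ofFn,
      List.length_cons, List.length_nil, List.take_append_drop]
  omega

theorem length_edges : L.edges.length = G.edges.card := by
  rw [← List.toFinset_card_of_nodup L.edges_nodup]
  congr 1
  ext e
  rw [List.mem_toFinset, L.mem_edges]

theorem toFinset_wins (σ : Bool) : ((L.wins σ).map List.toFinset).toFinset = G.F σ := by
  ext S
  rw [List.mem_toFinset, L.mem_wins]

theorem length_wins (σ : Bool) : (L.wins σ).length = (G.F σ).card := by
  rw [← L.toFinset_wins, List.toFinset_card_of_nodup (L.wins_nodup σ), List.length_map]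

theorem length_flatMap_setCode (σ : Bool) :
    ((L.wins σ).flatMap setCode).length = (G.F σ).card + ∑ S ∈ G.F σ, S.card := by
  rw [← L.length_wins, ← L.toFinset_wins, List.sum_toFinset _ (L.wins_nodup σ), List.map_map]
  have : ∀ W : List (List (Fin k)), (∀ S ∈ W, S.Nodup) → (W.flatMap setCode).length
      = W.length + (W.map (Finset.card ∘ List.toFinset)).sum := by
    intro W hW
    induction W with
    | nil => rfl
    | cons S W ih =>
      rw [List.flatMap_cons, List.length_append, ih fun S' h => hW S' (List.mem_cons_of_mem _ h)]
      simp [setCode, List.toFinset_card_of_nodup (hW S List.mem_cons_self)]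
      omega
  exact this _ (L.set_nodup σ)

end Listing

theorem F_true_eq : G.F true = (G.F false)ᶜ := by
  ext S
  have := G.cover S
  have := G.disjoint S
  simp only [Finset.mem_compl]
  tauto

theorem card_F_add : (G.F false).card + (G.F true).card = 2 ^ k := by
  rw [F_true_eq, Finset.card_add_card_compl]
  simp

/-- The two conditions together contain every set of colours once; a set and its complement have `k`
elements together. -/
theorem two_mul_sum_card :
    2 * (∑ S ∈ G.F false, S.card + ∑ S ∈ G.F true, S.card) = k * 2 ^ k := by
  rw [F_true_eq, Finset.sum_add_sum_compl, two_mul]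
  conv_lhs => enter [2]; rw [← Equiv.sum_comp (compl_involutive.toPerm compl)]
  rw [← Finset.sum_add_distrib]
  simp [Finset.card_compl]
  rw [Finset.sum_congr rfl (g := fun _ => k)]
  · simp [mul_comm]
  · intro S _
    have := Finset.card_le_univ S
    simp at this
    omega

theorem size_eq : G.size
    = n + G.edges.card + (∑ S ∈ G.F false, S.card + ∑ S ∈ G.F true, S.card) := by
  simp [size, add_comm]

namespace Listing

theorem length_encode : L.encode.length = 5 + 2 * n + 2 * L.edges.length + 2 ^ k
    + (∑ S ∈ G.F false, S.card + ∑ S ∈ G.F true, S.card) := by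
  rw [encode_eq, ← card_F_add (G := G)]
  simp only [List.length_append, List.length_flatMap_pair, List.length_ofFn,
      List.length_cons, List.length_nil, length_flatMap_setCode]
  omega

theorem lt_of_mem_setCode (σ : Bool) {x B : ℕ} (hB : k < B)
    (h : x ∈ (L.wins σ).flatMap setCode) : x < B := by
  simp only [List.mem_flatMap, setCode, List.mem_cons, List.mem_map] at h
  obtain ⟨S, hS, rfl | ⟨c, -, rfl⟩⟩ := h
  · have := List.Nodup.length_le_card (L.set_nodup σ S hS)
    simp at this
    omega
  · exact c.2.trans hB

/-- The numbers in the input are counts, indices and bits, all bounded by the length of the input or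
by `n`, which is itself below this length. -/
theorem getD_encode_lt {B : ℕ} (hB : L.encode.length < B) (hkn : k ≤ n) (a : ℕ) :
    L.encode.getD a 0 < B := by
  rw [length_encode] at hB
  have h2k := Nat.two_pow_pos k
  rw [List.getD_eq_getElem?_getD]
  rcases h : L.encode[a]? with _ | x
  · simp; omega
  · have hx := List.mem_of_getElem? h
    have hF := card_F_add (G := G)
    simp only [encode_eq, List.mem_append, List.mem_cons, List.mem_ofFn, List.not_mem_nil,
      or_false] at hx
    rw [Option.getD_some]
    rcases hx with (((((hx | hx | hx) | ⟨v, rfl⟩) | ⟨v, rfl⟩) | hx) | hx) | hx | hx | hx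
    · omega
    · omega
    · omega
    · have := Bool.toNat_le (G.owner v); omega
    · omega
    · rw [List.mem_flatMap] at hx
      obtain ⟨e, -, hx⟩ := hx
      simp only [List.mem_cons, List.not_mem_nil, or_false] at hx
      omega
    · rw [hx, length_wins]; omega
    · exact lt_of_mem_setCode false (by omega) hx
    · rw [hx, length_wins]; omega
    · exact lt_of_mem_setCode true (by omega) hx

end Listing

end CMG

/-! ## The main command -/

namespace RAM

namespace Prog

open RAM.Expr

/-- Reads the numbers of positions, colours and edges. -/
def readSizes : Cmd :=
  .assign 0 (mem (const 0)) ;; .assign 1 (mem (const 1)) ;; .assign 2 (mem (const 2)) ;;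
  .assign 3 (add (const 3) (reg 0)) ;; .assign 4 (add (reg 3) (reg 0)) ;;
  .assign 7 (add (reg 0) (reg 0)) ;; .assign 8 (add (reg 7) (const 2)) ;; .assign 11 (const 1)

/-- Chooses the address of the tables. -/
def placeTables : Cmd :=
  .assign 11 (add (reg 4) (add (reg 2) (reg 2))) ;;
  .assign 5 (add (reg 11) (add (reg 12) (const 2))) ;;
  .assign 6 (add (reg 5) (reg 1)) ;; .assign 13 (const 1)

/-- Stores a power of two and doubles it. -/
def storeWeight : Cmd :=
  .store (add (reg 5) (reg 10)) (reg 13) ;; .assign 13 (add (reg 13) (reg 13))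

/-- Chooses the address of the first frame, and reads the number of members of the winning
condition of Player 0. -/
def placeFrame : Cmd :=
  .assign 9 (add (reg 6) (reg 13)) ;; .assign 13 (mem (reg 11)) ;;
  .assign 11 (add (reg 11) (const 1))

/-- Initialises the registers and the table of weights. -/
def prepare : Cmd :=
  readSizes ;; .forTo 10 1 (.assign 11 (add (reg 11) (reg 11))) ;;
  .assign 12 (reg 11) ;; .forTo 10 1 (.assign 12 (add (reg 12) (reg 11))) ;;
  placeTables ;; .forTo 10 1 storeWeight ;; placeFrame

/-- Adds the weight of an element of a set of colours to the mask of this set. -/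
def addElement : Cmd :=
  .assign 16 (add (reg 16) (mem (add (reg 5) (mem (add (reg 11) (reg 17))))))

/-- Reads a member of the winning condition of Player 0. -/
def readSet : Cmd :=
  .assign 12 (mem (reg 11)) ;; .assign 11 (add (reg 11) (const 1)) ;; .assign 16 (const 0) ;;
  .forTo 17 12 addElement ;;
  .store (add (reg 6) (reg 16)) (const 1) ;; .assign 11 (add (reg 11) (reg 12))

/-- Writes the winner of a position to its final place. -/
def output : Cmd := .store (reg 10) (sub (mem (add (reg 9) (reg 10))) (const 2))

/-- Solves the game. -/
def main : Cmd :=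
  prepare ;; .forTo 10 13 readSet ;;
  .forTo 10 0 (.store (add (reg 9) (reg 10)) (const 1)) ;; .call 0 ;; .forTo 10 0 output

end Prog

end RAM

/-! ### Correctness of initialisation, input and output -/

namespace CMG

open RAM

variable {n k : ℕ} {G : CMG (Fin n) (Fin k)} {L : G.Listing} {p B d : ℕ} {procs : List Cmd}
  {s : State}

namespace Listing

/-- The address of the tables. -/
def tableAddr (L : G.Listing) : ℕ := 5 + 2 * n + 2 * L.edges.length + (k + 1) * 2 ^ k

/-- The tables lie behind the whole input. Their address is a bound that takes only about `k`
additions to compute, whereas the exact length would require a pass over the sets. -/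
theorem length_encode_le : L.encode.length ≤ L.tableAddr := by
  have := two_mul_sum_card (G := G)
  have e : (k + 1) * 2 ^ k = k * 2 ^ k + 2 ^ k := Nat.succ_mul _ _
  rw [length_encode, tableAddr]
  omega

end Listing

theorem prepare_spec (hs : Bounded B s) (hm : ∀ a, s.mem a = L.encode.getD a 0)
    (hB : L.tableAddr + k + 2 ^ k + 2 * n + 2 < B) :
    Ends procs B d Prog.prepare s (41 * k + 100) (fun s' => Consts L L.tableAddr s'.reg ∧
      s'.reg 9 = L.tableAddr + k + 2 ^ k ∧ s'.reg 13 = (L.wins false).length ∧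
      s'.reg 11 = L.setAddr 0 ∧
      (∀ c : Fin k, s'.mem (L.tableAddr + c) = 2 ^ (c : ℕ)) ∧
      ∀ a, a < L.tableAddr ∨ L.tableAddr + k ≤ a → s'.mem a = L.encode.getD a 0) := by
  have hp : L.tableAddr = 5 + 2 * n + 2 * L.edges.length + (k + 1) * 2 ^ k := rfl
  have h2k := Nat.two_pow_pos k
  have hk2 : 2 ^ k * (k + 1) = (k + 1) * 2 ^ k := mul_comm _ _
  refine Ends.seq (T₁ := 33) (T₂ := 41 * k + 67)
    (Q' := fun s' => (s'.reg 0 = n ∧ s'.reg 1 = k ∧ s'.reg 2 = L.edges.length ∧ s'.reg 3 = 3 + n ∧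
      s'.reg 4 = 3 + 2 * n ∧ s'.reg 7 = 2 * n ∧ s'.reg 8 = 2 * n + 2) ∧ s'.reg 11 = 1 ∧
      s'.mem = s.mem) (Ends.of_wp ?_ (by decide)) hs ?_ (by omega)
  · have h1 := hs.one_lt
    simp only [Prog.readSizes, Cmd.wp, Expr.Fits, Expr.eval, Function.update_apply]
    simp only [hm, L.encode_zero, L.encode_one, L.encode_two]
    simp
    omega
  rintro s₁ hs₁ - ⟨⟨r0, r1, r2, r3, r4, r7, r8⟩, h11, hm₁⟩
  refine Ends.seq (T₁ := k * 12 + 6) (T₂ := 29 * k + 60)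
    (Q' := fun s' => s'.reg 11 = 2 ^ k ∧ s'.mem = s.mem)
    (Ends.forTo (x := 11) (T₁ := 4) (fun i mem y => y = 2 ^ i ∧ mem = s.mem) hs₁ r1 rfl rfl
      (by decide) (by decide) ⟨h11, hm₁⟩ ?_ (fun s' _ _ h => h) (by omega)) hs₁ ?_ (by omega)
  · rintro i hi s' h10 hs' - ⟨h1, h2⟩
    have : 2 ^ (i + 1) ≤ 2 ^ k := Nat.pow_le_pow_right (by omega) hi
    rw [Nat.pow_succ] at this
    refine Ends.of_wp ⟨⟨hs'.reg_lt _, hs'.reg_lt _, ?_⟩, ?_, h2⟩ (by decide)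
    · simp only [Expr.eval, h1]; omega
    · simp [Expr.eval, h1, Nat.pow_succ]; omega
  rintro s₂ hs₂ hk₂ ⟨h11, hm₂⟩
  replace r0 := (hk₂ 0 rfl).trans r0
  replace r1 := (hk₂ 1 rfl).trans r1
  replace r2 := (hk₂ 2 rfl).trans r2
  replace r3 := (hk₂ 3 rfl).trans r3
  replace r4 := (hk₂ 4 rfl).trans r4
  replace r7 := (hk₂ 7 rfl).trans r7
  replace r8 := (hk₂ 8 rfl).trans r8
  refine Ends.assign_seq (x := 2 ^ k) (T₁ := 29 * k + 58) hs₂ (hs₂.reg_lt _) h11 ?_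
    (by simp only [Expr.cost]; omega)
  intro s₃ hs₃ hm₃ h12 hr₃
  replace r1 := (hr₃ 1 (by decide)).trans r1
  replace h11 := (hr₃ 11 (by decide)).trans h11
  -- Without multiplication, `(k + 1) * 2 ^ k` is obtained by adding `2 ^ k` to itself `k` times.
  refine Ends.seq (T₁ := k * 12 + 6) (T₂ := 17 * k + 52)
    (Q' := fun s' => s'.reg 12 = 2 ^ k * (k + 1) ∧ s'.mem = s.mem)
    (Ends.forTo (x := 12) (T₁ := 4) (fun i mem y => y = 2 ^ k * (i + 1) ∧ mem = s.mem) hs₃ r1 rfl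
      rfl (by decide) (by decide) ⟨by rw [h12]; omega, hm₃.trans hm₂⟩ ?_ (fun s' _ _ h => h)
      (by omega)) hs₃ ?_ (by omega)
  · rintro i hi s' h10 hs' hk' ⟨h1, h2⟩
    have e11 : s'.reg 11 = 2 ^ k := (hk' 11 rfl (by decide)).trans h11
    have : 2 ^ k * (i + 2) ≤ 2 ^ k * (k + 1) := Nat.mul_le_mul_left _ (by omega)
    have e : 2 ^ k * (i + 2) = 2 ^ k * (i + 1) + 2 ^ k := by ring
    refine Ends.of_wp ⟨⟨hs'.reg_lt _, hs'.reg_lt _, ?_⟩, ?_, h2⟩ (by decide)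
    · simp only [Expr.eval, h1, e11]; omega
    · simp [Expr.eval, h1, e11]; omega
  rintro s₄ hs₄ hk₄ ⟨h12, hm₄⟩
  replace r0 := (hk₄ 0 rfl).trans ((hr₃ 0 (by decide)).trans r0)
  replace r1 := (hk₄ 1 rfl).trans r1
  replace r2 := (hk₄ 2 rfl).trans ((hr₃ 2 (by decide)).trans r2)
  replace r3 := (hk₄ 3 rfl).trans ((hr₃ 3 (by decide)).trans r3)
  replace r4 := (hk₄ 4 rfl).trans ((hr₃ 4 (by decide)).trans r4)
  replace r7 := (hk₄ 7 rfl).trans ((hr₃ 7 (by decide)).trans r7)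
  replace r8 := (hk₄ 8 rfl).trans ((hr₃ 8 (by decide)).trans r8)
  refine Ends.seq (T₁ := 18) (T₂ := 17 * k + 34)
    (Q' := fun s' => Consts L L.tableAddr s'.reg ∧ s'.reg 11 = 3 + 2 * n + 2 * L.edges.length ∧
      s'.reg 13 = 1 ∧ s'.mem = s.mem) (Ends.of_wp ?_ (by decide)) hs₄ ?_ (by omega)
  · simp only [Prog.placeTables, Cmd.wp, Expr.Fits, Expr.eval, Function.update_apply]
    simp [r1, r2, r4, h12]
    refine ⟨by omega, by omega, by omega, by omega, ?_, by omega, hm₄⟩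
    constructor <;> simp [r0, r1, r2, r3, r4, r7, r8] <;> omega
  rintro s₅ hs₅ - ⟨hc, h11, h13, hm₅⟩
  refine Ends.seq (T₁ := k * 17 + 6) (T₂ := 15)
    (Q' := fun s' => s'.reg 13 = 2 ^ k ∧
      (∀ c : Fin k, s'.mem (L.tableAddr + c) = 2 ^ (c : ℕ)) ∧
      ∀ a, a < L.tableAddr ∨ L.tableAddr + k ≤ a → s'.mem a = L.encode.getD a 0)
    (Ends.forArray (x := 13) (T₁ := 9) (f := fun c : Fin k => s₅.mem (L.tableAddr + c))
      (fun i y => y = 2 ^ i) hs₅ hc.r1 rfl rfl (by decide) (by decide) h13 (fun _ => rfl) ?_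
      (fun s' _ _ h1 h2 h3 => ⟨h3, h1, fun a ha => ?_⟩)
      (by omega)) hs₅ ?_ (by omega)
  · rintro c s' h10 hs' hk' - - h13
    have := c.2
    have h2 : 2 ^ (c.val + 1) ≤ 2 ^ k := Nat.pow_le_pow_right (by omega) c.2
    rw [Nat.pow_succ] at h2
    have e5 : s'.reg 5 = L.tableAddr := (hk' 5 rfl (by decide)).trans hc.r5
    refine Ends.of_wp ?_ (by decide)
    simp only [Prog.storeWeight, Cmd.wp, Expr.Fits, Expr.eval, Function.update_apply]
    simp [e5, h10, h13]
    have := Nat.pow_succ 2 c.val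
    refine ⟨by omega, by omega, by omega, fun a h h' => absurd h' h, by omega⟩
  · rw [h2 a ha, hm₅, hm]
  rintro s₆ hs₆ hk₆ ⟨h13, hw, hm₆⟩
  replace hc : Consts L L.tableAddr s₆.reg :=
    hc.of_eq fun i hi => hk₆ i (Cmd.keeps_of_keepsBelow hi rfl)
  replace h11 := (hk₆ 11 rfl).trans h11
  refine Ends.frame (T := 15) (Q := fun s' => s'.reg 9 = L.tableAddr + k + 2 ^ k ∧
      s'.reg 13 = (L.wins false).length ∧ s'.reg 11 = L.setAddr 0 ∧ s'.mem = s₆.mem)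
      (Ends.of_wp ?_ (by decide)) hs₆ (fun s' _ hk' h => ⟨hc.of_eq fun i hi =>
        hk' i (Cmd.keeps_of_keepsBelow hi rfl), h.1, h.2.1, h.2.2.1, ?_⟩) le_rfl
  · have hF : s₆.mem (3 + 2 * n + 2 * L.edges.length) = (L.wins false).length := by
      rw [hm₆ _ (by omega), L.encode_length_wins]
    have hFB := hF ▸ hs₆.mem_lt _
    simp only [Prog.placeFrame, Cmd.wp, Expr.Fits, Expr.eval, Function.update_apply]
    simp [hc.r6, h13, h11, hF, Listing.setAddr]
    omega
  · rw [h.2.2.2]; exact ⟨hw, hm₆⟩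

theorem readSet_spec (hs : Bounded B s) (hc : Consts L L.tableAddr s.reg)
    (hw : ∀ c : Fin k, s.mem (L.tableAddr + c) = 2 ^ (c : ℕ))
    (hm : ∀ a < L.tableAddr, s.mem a = L.encode.getD a 0) {i : ℕ}
    (hi : i < (L.wins false).length) (h11 : s.reg 11 = L.setAddr i)
    (hB : L.tableAddr + k + 2 ^ k + 2 * n + 2 < B) :
    Ends procs B d Prog.readSet s (18 * k + 24) (fun s' => s'.reg 11 = L.setAddr (i + 1) ∧
      s'.mem = Function.update s.mem (L.tableAddr + k + mask (L.wins false)[i].toFinset) 1) := by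
  have h2k := Nat.two_pow_pos k
  have hlen := L.length_encode_le
  have hadd := L.setAddr_succ hi
  have hle := L.setAddr_le (i + 1)
  have hnd := L.set_nodup false _ (List.getElem_mem hi)
  have hcode := fun j => L.encode_set (j := j) hi
  generalize (L.wins false)[i] = S at *
  have hSk : S.length ≤ k := by simpa using hnd.length_le_card
  have hsize : s.mem (L.setAddr i) = S.length := by
    rw [hm _ (by omega)]; exact hcode 0 (by simp [setCode])
  have helem : ∀ j (hj : j < S.length), s.mem (L.setAddr i + 1 + j) = S[j] := fun j hj => by
    rw [hm _ (by omega)]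
    have := hcode (j + 1) (by simpa [setCode] using hj)
    simpa [setCode, add_assoc, add_comm 1] using this
  refine Ends.assign_seq (x := S.length) (T₁ := 18 * k + 21) hs ⟨hs.reg_lt _, hs.mem_lt _⟩
    (by simp only [Expr.eval, h11, hsize]) ?_ (by simp only [Expr.cost]; omega)
  intro s₁ hs₁ hm₁ h12 hr₁
  refine Ends.assign_seq (x := L.setAddr i + 1) (T₁ := 18 * k + 17) hs₁ ?_ ?_ ?_
    (by simp only [Expr.cost]; omega)
  · have := hr₁ 11 (by decide)
    have := hs.one_lt
    simp only [Expr.Fits, Expr.eval]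
    omega
  · simp only [Expr.eval, hr₁ 11 (by decide), h11]
  intro s₂ hs₂ hm₂ h11' hr₂
  refine Ends.assign_seq (x := 0) (T₁ := 18 * k + 15) hs₂ (by simp only [Expr.Fits]; omega) rfl ?_
    (by simp only [Expr.cost]; omega)
  intro s₃ hs₃ hm₃ h16 hr₃
  have hc₃ := ((hc.of_ne (by decide) hr₁).of_ne (by decide) hr₂).of_ne (by decide) hr₃
  replace hm₃ : s₃.mem = s.mem := hm₃.trans (hm₂.trans hm₁)
  replace h12 : s₃.reg 12 = S.length := by rw [hr₃ 12 (by decide), hr₂ 12 (by decide), h12]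
  replace h11' : s₃.reg 11 = L.setAddr i + 1 := by rw [hr₃ 11 (by decide), h11']
  refine Ends.seq (T₁ := S.length * 18 + 6) (T₂ := 9)
    (Q' := fun s' => s'.reg 16 = mask S.toFinset ∧ s'.mem = s.mem)
    (Ends.forTo (x := 16) (T₁ := 10) (fun j mem y => y = mask (S.take j).toFinset ∧ mem = s.mem)
      hs₃ h12 rfl rfl (by decide) (by decide) ⟨by simp [h16, mask], hm₃⟩ ?_
      (fun s' _ _ h => by simpa using h) (by omega)) hs₃ ?_ (by omega)
  · rintro j hj s' h17 hs' hk' ⟨h1, h2⟩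
    have e5 : s'.reg 5 = L.tableAddr := (hk' 5 rfl (by decide)).trans hc₃.r5
    have e11 : s'.reg 11 = _ := (hk' 11 rfl (by decide)).trans h11'
    -- Sets are listed without repetitions, so every weight is added once.
    have hnot : S[j] ∉ (S.take j).toFinset := by
      have h3 : (S.take j ++ [S[j]]).Nodup := by
        rw [List.take_append_getElem hj]
        exact hnd.sublist (List.take_sublist _ _)
      rw [List.mem_toFinset]
      exact fun h => List.disjoint_of_nodup_append h3 h (by simp)
    have hmask : mask (S.take (j + 1)).toFinset = mask (S.take j).toFinset + 2 ^ (S[j] : ℕ) := by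
      rw [← mask_insert hnot, ← List.take_append_getElem hj]
      congr 1
      ext c
      simp [or_comm, -List.take_append_getElem]
    have hlt := mask_lt (S.take (j + 1)).toFinset
    have := (S[j]).2
    refine Ends.of_wp ?_ (by decide)
    simp only [Prog.addElement, Cmd.wp, Expr.Fits, Expr.eval, Function.update_apply, e5, e11, h17,
      h2, h1, helem j hj, hw, hmask]
    have := Nat.two_pow_pos (S[j] : ℕ)
    simp
    omega
  · rintro s₄ hs₄ hk₄ ⟨h16, hm₄⟩
    have e6 : s₄.reg 6 = _ := (hk₄ 6 rfl).trans hc₃.r6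
    have e11 : s₄.reg 11 = _ := (hk₄ 11 rfl).trans h11'
    have e12 : s₄.reg 12 = _ := (hk₄ 12 rfl).trans h12
    have hlt := mask_lt S.toFinset
    refine Ends.of_wp ?_ (by decide)
    simp only [Cmd.wp, Expr.Fits, Expr.eval, Function.update_apply, e6, h16, e11, e12, hm₄]
    simp
    omega

/-- Only the sets of Player 0 are read; the other condition is the complement, and its entries keep
the value `0`. -/
theorem readWins_spec (hs : Bounded B s) (hc : Consts L L.tableAddr s.reg)
    (h13 : s.reg 13 = (L.wins false).length) (h11 : s.reg 11 = L.setAddr 0)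
    (hw : ∀ c : Fin k, s.mem (L.tableAddr + c) = 2 ^ (c : ℕ))
    (hm : ∀ a, a < L.tableAddr ∨ L.tableAddr + k ≤ a → s.mem a = L.encode.getD a 0)
    (hB : L.tableAddr + k + 2 ^ k + 2 * n + 2 < B) :
    Ends procs B d (.forTo 10 13 Prog.readSet) s (2 ^ k * (18 * k + 32) + 6)
      (fun s' => Tables L L.tableAddr s'.mem) := by
  have h2k := Nat.two_pow_pos k
  have hlen := L.length_encode_le
  have hp : L.tableAddr = 5 + 2 * n + 2 * L.edges.length + (k + 1) * 2 ^ k := rfl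
  have hW : (L.wins false).length ≤ 2 ^ k := by
    have := card_F_add (G := G)
    rw [L.length_wins]; omega
  refine Ends.forTo (x := 11) (T₁ := 18 * k + 24)
    (fun i mem y => y = L.setAddr i ∧ (∀ S : Finset (Fin k), mem (L.tableAddr + k + mask S)
      = if S ∈ ((L.wins false).take i).map List.toFinset then 1 else 0) ∧
      ∀ a < L.tableAddr + k, mem a = s.mem a) hs h13 rfl rfl (by decide) (by decide)
    ⟨h11, fun S => ?_, fun _ _ => rfl⟩ ?_ ?_ ?_
  -- The table lies behind the input, so it consists of zeros before the first set is read.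
  · rw [hm _ (by omega), List.getD_eq_default _ _ (by omega)]
    simp
  · rintro i hi s' h10 hs' hk' ⟨h1, h2, h3⟩
    refine (readSet_spec hs' (hc.of_eq fun j hj => hk' j (Cmd.keeps_of_keepsBelow hj rfl) (by omega))
      (fun c => by rw [h3 _ (by omega), hw]) (fun a ha => by rw [h3 _ (by omega), hm _ (by omega)])
      hi h1 hB).mono (fun s'' h => ⟨h.1, fun S => ?_, fun a ha => ?_⟩) le_rfl
    · rw [h.2, Function.update_apply, h2, ← List.take_append_getElem hi]
      simp only [Nat.add_left_cancel_iff, mask_injective.eq_iff, List.map_append, List.mem_append,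
        List.map_cons, List.map_nil, List.mem_singleton]
      split_ifs <;> simp_all
    · rw [h.2, Function.update_of_ne (by omega), h3 a ha]
  · rintro s' hs' hk' ⟨h1, h2, h3⟩
    have hm' : ∀ a < L.tableAddr, s'.mem a = L.encode.getD a 0 := fun a ha => by
      rw [h3 a (by omega), hm a (by omega)]
    refine ⟨by omega, fun v => ?_, fun v => ?_, fun i hi => ?_, fun i hi => ?_, fun c => ?_,
      fun S => ?_⟩
    · rw [hm' _ (by omega), L.encode_owner]
    · rw [hm' _ (by omega), L.encode_color]
    · rw [hm' _ (by omega)]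
      rw [← two_mul i]
      exact L.encode_edge hi (j := 0) (by decide)
    · rw [hm' _ (by omega)]
      rw [show 3 + 2 * n + 1 + (i + i) = 3 + 2 * n + 2 * i + 1 by omega]
      exact L.encode_edge hi (j := 1) (by decide)
    · rw [h3 _ (by omega), hw]
    · simp only [h2, List.take_length, L.mem_wins]
  · gcongr ?_ + 6
    exact Nat.mul_le_mul hW (by omega)

/-- The output overwrites the beginning of the input, which is no longer needed; `hna` keeps it
apart from the frame that is being read. -/
theorem output_spec {a₀ : ℕ} (hs : Bounded B s) (hc : Consts L p s.reg) (h9 : s.reg 9 = a₀)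
    {f : Fin n → ℕ} (ha : ∀ v : Fin n, s.mem (a₀ + v) = 2 + f v) (hna : n ≤ a₀)
    (hB : a₀ + n + 2 < B) :
    Ends procs B d (.forTo 10 0 Prog.output) s (16 * n + 6)
      (fun s' => ∀ v : Fin n, s'.mem v = f v) := by
  refine Ends.forArray (x := 14) (a₀ := 0) (T₁ := 8) (fun _ _ => True) hs hc.r0 rfl rfl (by decide)
    (by decide) trivial (f := fun v : Fin n => s.mem (0 + v)) (g := f) (fun _ => rfl) ?_
    (fun s' _ _ h _ _ v => by simpa using h v) (by omega)
  rintro v s' h10 hs' hk' - hm' -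
  have hv := v.2
  have e9 : s'.reg 9 = a₀ := (hk' 9 rfl (by decide)).trans h9
  have hav : s'.mem (a₀ + v) = 2 + f v := (hm' _ (by omega)).trans (ha v)
  have hfB := hav ▸ hs'.mem_lt _
  refine Ends.of_wp ?_ (by decide)
  simp only [Prog.output, Cmd.wp, Expr.Fits, Expr.eval, e9, h10, hav, Function.update_apply]
  simp
  refine ⟨by omega, by omega, fun a h h' => absurd h' h⟩

theorem main_spec (hs : Bounded B s) (hm : ∀ a, s.mem a = L.encode.getD a 0) (hn : 0 < n)
    (hkn : k ≤ n) (hd : k < d)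
    (hB : L.tableAddr + k + 2 ^ k + (k + 1) * (2 * n + 2) < B) :
    Ends [Prog.solve] B d Prog.main s
      (100 * k + 100 * n + 100 + 2 ^ k * (18 * k + 32) + callTime L Finset.univ)
      (fun s' => ∀ v : Fin n, s'.mem v = winVal G Finset.univ v) := by
  have h2k := Nat.two_pow_pos k
  have hp : L.tableAddr = 5 + 2 * n + 2 * L.edges.length + (k + 1) * 2 ^ k := rfl
  have hκ : ((Finset.univ : Finset (Fin n)).image G.color).card ≤ k := by
    simpa using Finset.card_le_univ ((Finset.univ : Finset (Fin n)).image G.color)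
  have hB' : L.tableAddr + k + 2 ^ k + 2 * n + 2 < B := by nlinarith
  obtain ⟨d, rfl⟩ : ∃ d', d = d' + 1 := ⟨d - 1, by omega⟩
  refine Ends.seq (T₂ := 59 * k + 100 * n + 2 ^ k * (18 * k + 32) + callTime L Finset.univ)
    (prepare_spec hs hm hB') hs ?_ (by omega)
  rintro s₁ hs₁ - ⟨hc, h9, h13, h11, hw, hm₁⟩
  refine Ends.seq (T₂ := 59 * k + 94 * n + callTime L Finset.univ)
    (readWins_spec hs₁ hc h13 h11 hw hm₁ hB') hs₁ ?_ (by omega)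
  rintro s₂ hs₂ hk₂ ht
  replace hc : Consts L L.tableAddr s₂.reg :=
    hc.of_eq fun i hi => hk₂ i (Cmd.keeps_of_keepsBelow hi rfl)
  replace h9 : s₂.reg 9 = _ := (hk₂ 9 rfl).trans h9
  refine Ends.seq (T₁ := n * 13 + 6) (T₂ := 50 * n + callTime L Finset.univ)
    (Q' := fun s' => (∀ v : Fin n, s'.mem (L.tableAddr + k + 2 ^ k + v) = 1) ∧
      ∀ a < L.tableAddr + k + 2 ^ k, s'.mem a = s₂.mem a)
    (Ends.forArray (x := 14) (T₁ := 5) (fun _ _ => True) hs₂ hc.r0 rfl rfl (by decide)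
      (by decide) trivial (f := fun v : Fin n => s₂.mem (L.tableAddr + k + 2 ^ k + v))
      (g := fun _ => 1) (fun _ => rfl) ?_
      (fun s' _ _ h h' _ => ⟨h, fun a ha => h' a (Or.inl ha)⟩) (by omega)) hs₂ ?_ (by omega)
  · rintro v s' h10 hs' hk' - - -
    have hv := v.2
    have e9 : s'.reg 9 = _ := (hk' 9 rfl (by decide)).trans h9
    refine Ends.of_wp ?_ (by decide)
    simp only [Cmd.wp, Expr.Fits, Expr.eval, e9, h10, Function.update_apply]
    simp
    refine ⟨by omega, by omega, fun a h h' => absurd h' h⟩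
  rintro s₃ hs₃ hk₃ ⟨ha, hm₃⟩
  replace hc : Consts L L.tableAddr s₃.reg :=
    hc.of_eq fun i hi => hk₃ i (Cmd.keeps_of_keepsBelow hi rfl)
  replace h9 : s₃.reg 9 = _ := (hk₃ 9 rfl).trans h9
  refine Ends.seq (T₂ := 50 * n)
    (call_spec (loopWorks subArena_univ hn hkn) hn hkn (by omega) s₃ _ (fun _ => 1) hs₃ hc
      (ht.of_eq hm₃) h9 le_rfl ?_ ha (by simp)) hs₃ ?_ (by omega)
  · have := Nat.mul_le_mul_right (2 * n + 2) (Nat.add_le_add_right hκ 1)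
    omega
  rintro s₄ hs₄ - ⟨h9, hc, ha, -⟩
  refine (output_spec hs₄ hc h9 (f := winVal G Finset.univ) (fun v => by simp [ha]) (by omega)
    (by omega)).mono (fun _ h => h) (by omega)

end CMG

/-! ### Absorbing everything into the stated bounds -/

namespace CMG

open RAM

variable {n k : ℕ} {G : CMG (Fin n) (Fin k)} {L : G.Listing}

/-- By `two_mul_sum_card` the listed sets contribute `k * 2 ^ k / 2` to `G.size`, which pays for the
tables and, as `0 < k`, for `2 ^ k` itself. The `k + 1` frames are covered by `k * n`. -/
theorem space_le (hn : 0 < n) (hk : 0 < k) :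
    L.tableAddr + k + 2 ^ k + (k + 1) * (2 * n + 2) < 20000 * (G.size + k * n) := by
  have h1 := two_mul_sum_card (G := G)
  have hkn : 0 < k * n := Nat.mul_pos hk hn
  have hk2 : 2 ^ k ≤ k * 2 ^ k := Nat.le_mul_of_pos_left _ hk
  have hk' : k ≤ k * n := Nat.le_mul_of_pos_right _ hn
  have e : (k + 1) * 2 ^ k = k * 2 ^ k + 2 ^ k := Nat.succ_mul _ _
  have e' : (k + 1) * (2 * n + 2) = 2 * (k * n) + 2 * k + 2 * n + 2 := by ring
  rw [size_eq, Listing.tableAddr, L.length_edges, e, e']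
  omega

theorem bounded_start {B : ℕ} (hB : L.tableAddr + k + 2 ^ k + (k + 1) * (2 * n + 2) < B)
    (hkn : k ≤ n) : Bounded B ⟨fun _ => 0, fun a => L.encode.getD a 0⟩ := by
  have h := L.length_encode_le
  have h2k := Nat.two_pow_pos k
  have hp : L.tableAddr = 5 + 2 * n + 2 * L.edges.length + (k + 1) * 2 ^ k := rfl
  exact ⟨by omega, fun _ => by simp only []; omega, L.getD_encode_lt (by omega) hkn⟩

theorem two_pow_le_two_mul_factorial (k : ℕ) : 2 ^ k ≤ 2 * k.factorial := by
  induction k with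
  | zero => simp
  | succ k ih =>
    rcases Nat.eq_zero_or_pos k with rfl | hk
    · simp
    · rw [Nat.pow_succ, Nat.factorial_succ]
      nlinarith

/-- The cost `2 ^ k * (18 * k + 32)` of reading the winning condition is below the bound because `2
^ k ≤ 2 * k.factorial`; the rest is dominated by `callTime`. -/
theorem time_le (hn : 0 < n) (hk : 0 < k) (hkn : k ≤ n) :
    100 * k + 100 * n + 100 + 2 ^ k * (18 * k + 32) + callTime L Finset.univ
      ≤ 20000 * (k.factorial * n.choose k * n * G.edges.card) := by
  have hm := L.le_length_edges
  have hκ : ((Finset.univ : Finset (Fin n)).image G.color).card ≤ k := by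
    simpa using Finset.card_le_univ ((Finset.univ : Finset (Fin n)).image G.color)
  have hD : n.descFactorial ((Finset.univ : Finset (Fin n)).image G.color).card
      ≤ k.factorial * n.choose k := by
    rw [← Nat.descFactorial_eq_factorial_mul_choose]
    exact Nat.descFactorial_mono_right hκ hkn
  have hP : k.factorial ≤ k.factorial * n.choose k :=
    Nat.le_mul_of_pos_right _ (Nat.choose_pos hkn)
  have h2 := two_pow_le_two_mul_factorial k
  have hf := Nat.factorial_pos k
  unfold callTime
  rw [Finset.card_univ, Fintype.card_fin, ← L.length_edges]
  set D := k.factorial * n.choose k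
  set m := L.edges.length
  have h3 : n ≤ D * n := Nat.le_mul_of_pos_left _ (by omega)
  have h4 : D * n ≤ D * n * m := Nat.le_mul_of_pos_right _ (by omega)
  have h5 : m ≤ D * n * m := Nat.le_mul_of_pos_left _ (by omega)
  have h6 : 2 ^ k * (18 * k + 32) ≤ 2 * D * (50 * n) := Nat.mul_le_mul (by omega) (by omega)
  have h7 : 8 * n * n.descFactorial ((Finset.univ : Finset (Fin n)).image G.color).card
      ≤ 8 * n * D := Nat.mul_le_mul_left _ hD
  have h8 := Nat.mul_le_mul_left (1000 * m) (Nat.add_le_add_right h7 1)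
  have e : 1000 * m * (8 * n * D + 1) = 8000 * (D * n * m) + 1000 * m := by ring
  have e' : 2 * D * (50 * n) = 100 * (D * n) := by ring
  omega

end CMG

theorem mainTheorem4 :
    -- SolveCMG terminates, is correct, and makes few recursive calls
    (∀ (V C : Type*) [Fintype V] [DecidableEq V] [Fintype C] [DecidableEq C] (G : CMG V C)
      (order : Finset V → List C), Fintype.card C ≤ Fintype.card V → G.IsLoopOrder order →
      (∃ W N, G.SolveRun order Finset.univ W N) ∧
      ∀ W N, G.SolveRun order Finset.univ W N →
        (∀ σ, (W σ : Set V) = G.winRegion σ) ∧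
        N ≤ (Fintype.card C).factorial * (Fintype.card V).choose (Fintype.card C)
              * Fintype.card V) ∧
    -- computation of the winning regions, with time and space bounds
    (∃ (P : RAM.Program) (K : ℕ), ∀ (n k : ℕ), 0 < n → k ≤ n →
      ∀ (G : CMG (Fin n) (Fin k)) (L : G.Listing), ∃ (t : ℕ) (s : RAM.State),
        P.Runs (K * (G.size + k * n)) L.encode t s ∧
        t ≤ K * (k.factorial * n.choose k * n * G.edges.card) ∧
        ∀ (σ : Bool) (v : Fin n), s.mem v = σ.toNat ↔ v ∈ G.winRegion σ) := by
  refine ⟨fun V C _ _ _ _ G order hc ho => CMG.solveRun_univ hc ho,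
    ⟨[RAM.Prog.solve], RAM.Prog.main⟩, 20000, fun n k hn hkn G L => ?_⟩
  -- A nonempty game has a colour; the space bound relies on this.
  have hk : 0 < k := (G.color ⟨0, hn⟩).pos
  have hspace := CMG.space_le (L := L) hn hk
  have h2k := Nat.two_pow_pos k
  -- The stack may have as many entries as there are memory cells, far more than the `k + 1` that
  -- are used.
  obtain ⟨t, s, hexec, ht, hs⟩ := CMG.main_spec (d := 20000 * (G.size + k * n))
    (CMG.bounded_start hspace hkn) (fun _ => rfl) hn hkn (by nlinarith) hspace
  refine ⟨t, s, ⟨?_, hexec⟩, ht.trans (CMG.time_le hn hk hkn), fun σ v => ?_⟩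
  · have := L.length_encode_le
    omega
  · rw [hs, CMG.winVal_eq_iff CMG.subArena_univ (Finset.mem_univ v), CMG.wins_univ]
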